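/- Let $m>0$ and consider the extremal Reissner--Nordström exterior $M=\mathbb R_{t^*}\times[m,\infty)_r\times\mathbb S^2$ with metric $$g=-\Omega^2(dt^*)^2+2(1-\Omega^2)\,dt^*dr+(2-\Omega^2)\,dr^2+r^2d\omega^2,\qquad \Omega^2=\Big(1-\frac mr\Big)^2 .$$ Write a tangent vector as $p=(p^{t^*},p^r,p^{\perp})$, where $|p^{\perp}|$ is the length of its angular part with respect to $r^2d\omega^2$. Let $\mathcal P$ be the bundle of nonzero future-directed null vectors on $M$, and let $\mathcal H^+=\{r=m,\ t^*>0\}$. Fix $R>2m$ and let $\tau$ be the time function with $\tau=t^*$ for $r\le R$ and $\tau=u+c(R)$ for $r\ge R$. Here $u=t-r^*$ is the retarded time and the constant $c(R)$ makes $\tau$ continuous. Put $\mathcal P_0=\mathcal P|_{\{\tau=0\}}$. Let $f_0:\mathcal P_0\to[0,\infty)$ be continuous and bounded, with support contained in $\{r\le C_r,\ p^{t^*}\le C_p,\ |p^r|\le C_p,\ |p^{\perp}|\le C_p\}$ for some $C_r,C_p>0$. Let $f$ be the solution of the massless Vlasov equation to the future of $\{\tau=0\}$ with $f|_{\mathcal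 P_0}=f_0$, that is, $f$ is transported along future-directed null geodesics. Set $$T^{\alpha\beta}(x)=\int_{\mathcal P_x}p^\alpha p^\beta f\,d\mu_x,\qquad d\mu_x=\frac{r^2\sin\theta}{\Omega^2p^{t^*}-(1-\Omega^2)p^r}\,dp^r\,dp^\theta\,dp^\phi .$$ For $\mathcal C>0$ and $0<\delta<\frac12$ let $\mathfrak B_\delta=\mathfrak B_{\mathcal C,\delta}$ be the set of $(x,p)\in\mathcal P_0$ with $$m\le r\le(1+\delta)m,\quad -\mathcal C C_p\sqrt{\Omega^2}\le p^r\le C_p\Omega^2,\quad |p^{\perp}|\le\mathcal C C_p(\Omega^2)^{1/4},\quad p^{t^*}\le\tfrac12C_p .$$ Then there are universal constants $C_0,C_1,\mathcal C,c,C>0$ (independent of $m,R,C_r,C_p,f_0,\delta,x$) such that the following holds with $\tau_0=C_0\big(m+\frac{C_r^2}{m}\big)$. For all $0<\delta<\frac12$ and all $x\in\mathcal H^+$ with $\tau=\tau(x)>\max(\tau_0,\ C_1m\delta^{-1})$, the integrals defining $T^{t^*t^*},T^{t^*r},T^{rr}$ at $x$ converge absolutely, and $$c\,C_p^4\Big(\inf_{\mathfrak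 B_\delta}|f_0|\Big)\frac{m^2}{\tau^2}\le T^{t^*t^*}\le C\,\frac{C_p^4C_r^2}{m^2}\|f_0\|_{\infty}\frac{m^2}{(\tau-\tau_0)^2},$$ $$c\,C_p^4\Big(\inf_{\mathfrak B_\delta}|f_0|\Big)\frac{m^4}{\tau^4}\le |T^{t^*r}|\le C\,\frac{C_p^4C_r^2}{m^2}\|f_0\|_{\infty}\frac{m^4}{(\tau-\tau_0)^4},$$ $$c\,C_p^4\Big(\inf_{\mathfrak B_\delta}|f_0|\Big)\frac{m^6}{\tau^6}\le T^{rr}\le C\,\frac{C_p^4C_r^2}{m^2}\|f_0\|_{\infty}\frac{m^6}{(\tau-\tau_0)^6}.$$ -/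

import Mathlib

open scoped BoundedContinuousFunction

noncomputable section

namespace ERN

/-! ### The extremal Reissner–Nordström exterior

A point `(t*, r, ω)` of `ℝ × [m, ∞) × 𝕊²` is represented by `(t*, y)` with `y = r ω ∈ ℝ³`, so that
`r = ‖y‖` and `ω = y / ‖y‖`. A tangent vector is a pair `p = (p^{t*}, v)` with `v = ẏ ∈ ℝ³`. Its
`(t*, r, ω)`-components are `p^{t*}`, `p^r = ⟨y, v⟩ / ‖y‖`, and the angular part, which is the
component of `v` orthogonal to `y`; the Euclidean inner product on the latter is `r² dω²`. -/

/-- Euclidean three-space. -/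
abbrev E3 : Type := EuclideanSpace ℝ (Fin 3)

/-- Points `(t*, y)` with `y = r ω`; also tangent vectors `(p^{t*}, v)` at such a point. -/
abbrev Spacetime : Type := ℝ × E3

/-- Pairs `(x, p)` of a point and a tangent vector. -/
abbrev Phase : Type := Spacetime × Spacetime

/-- The coordinate function `t*`. -/
def tStar (x : Spacetime) : ℝ := x.1

/-- The area radius `r`. -/
def radius (x : Spacetime) : ℝ := ‖x.2‖

/-- The exterior `ℝ × [m, ∞) × 𝕊²`, including the boundary `r = m`. -/
def exterior (m : ℝ) : Set Spacetime := {x | m ≤ radius x}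

/-- The future event horizon `r = m`, `t* > 0`. -/
def horizon (m : ℝ) : Set Spacetime := {x | radius x = m ∧ 0 < tStar x}

/-- `Ω² = 1 - 2m/r + q²/r²` with `|q| = m`, i.e. `Ω² = (1 - m/r)²`. -/
def lapseSq (m r : ℝ) : ℝ := 1 - 2 * m / r + m ^ 2 / r ^ 2

/-- The component `p^{t*}` of a tangent vector. -/
def pT (p : Spacetime) : ℝ := p.1

/-- The component `p^r` of a tangent vector `p` at `x`. -/
def pR (x p : Spacetime) : ℝ := inner ℝ x.2 p.2 / ‖x.2‖

/-- The angular part of a tangent vector `p` at `x`. -/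
def pAng (x p : Spacetime) : E3 := p.2 - (pR x p / ‖x.2‖) • x.2

/-- The metric
`g = -Ω² (dt*)² + 2 (1 - Ω²) dt* dr + (2 - Ω²) dr² + r² dω²`, as a bilinear form at `x`. The formula
is smooth on `0 < r < ∞`, across the boundary `r = m` of the exterior. -/
def metric (m : ℝ) (x p q : Spacetime) : ℝ :=
  -lapseSq m (radius x) * pT p * pT q
    + (1 - lapseSq m (radius x)) * (pT p * pR x q + pR x p * pT q)
    + (2 - lapseSq m (radius x)) * pR x p * pR x q
    + inner ℝ (pAng x p) (pAng x q)

/-- Christoffel symbols of the first kind in the coordinates `(t*, y)`: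
`Γ(p, q; e) = ½ (∂_p g(q, e) + ∂_q g(p, e) - ∂_e g(p, q))`, with constant `p, q, e`. -/
def christoffel (m : ℝ) (x p q e : Spacetime) : ℝ :=
  (fderiv ℝ (fun z => metric m z q e) x p + fderiv ℝ (fun z => metric m z p e) x q
    - fderiv ℝ (fun z => metric m z p q) x e) / 2

/-! ### The time function -/

/-- The function `F` with `t* = t + F(r)`. -/
def shiftF (m r : ℝ) : ℝ := 2 * m * Real.log (r - m) - m ^ 2 / (r - m)

/-- The Regge–Wheeler radius `r*`. -/
def rStar (m r : ℝ) : ℝ :=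
  r + 2 * m * Real.log (r - m) - m ^ 2 / (r - m) - 2 * m * Real.log m - m

/-- The retarded time `u = t - r*`, where `t = t* - F(r)`. -/
def retardedTime (m : ℝ) (x : Spacetime) : ℝ :=
  (tStar x - shiftF m (radius x)) - rStar m (radius x)

/-- The constant `c(R)` that makes `τ` continuous. -/
def matchConst (m R : ℝ) : ℝ :=
  R + 4 * m * Real.log (R - m) - 2 * m ^ 2 / (R - m) - 2 * m * Real.log m - m

open Classical in
/-- The time function `τ`: it is `t*` for `r ≤ R` and `u + c(R)` for `r ≥ R`. -/
def tau (m R : ℝ) (x : Spacetime) : ℝ :=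
  if radius x ≤ R then tStar x else retardedTime m x + matchConst m R

/-! ### The mass-shell, null geodesics, and the massless Vlasov equation -/

/-- The mass-shell: nonzero future-directed null vectors at points of the exterior. As the level sets
of `t*` are spacelike, a nonzero null vector is future-directed exactly if `p^{t*} > 0`. -/
def massShell (m : ℝ) : Set Phase :=
  {z | z.1 ∈ exterior m ∧ metric m z.1 z.2 z.2 = 0 ∧ 0 < pT z.2}

/-- The mass-shell over the initial hypersurface `Σ₀ = {τ = 0}`. -/
def initialShell (m R : ℝ) : Set Phase :=
  {z | z ∈ massShell m ∧ tau m R z.1 = 0}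

/-- `x`, with velocity `p`, is on `[a, b]` an affinely parametrised future-directed null geodesic in
the exterior: `x' = p` and `g(p', e) + Γ(p, p; e) = 0` for all `e`. -/
structure IsNullGeodesic (m : ℝ) (x p : ℝ → Spacetime) (a b : ℝ) : Prop where
  mem_massShell : ∀ s ∈ Set.Icc a b, (x s, p s) ∈ massShell m
  velocity : ∀ s ∈ Set.Icc a b, HasDerivWithinAt x (p s) (Set.Icc a b) s
  geodesic : ∀ s ∈ Set.Icc a b, ∃ acc : Spacetime, HasDerivWithinAt p acc (Set.Icc a b) s ∧
    ∀ e : Spacetime, metric m (x s) acc e + christoffel m (x s) (p s) (p s) e = 0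

/-- `f` solves the massless Vlasov equation to the future of `Σ₀` with data `f₀`: it restricts to
`f₀` and it is constant along future-directed null geodesics that start at or after `Σ₀` and
end strictly after `Σ₀`. (Segments that stay in `Σ₀` are left out: `Σ₀` is ruled by outgoing radial
null rays where `r ≥ R`, and constancy along these would constrain `f₀`.)
Only the values of `f` on the mass-shell matter. -/
structure IsVlasovSolution (m R : ℝ) (f₀ : initialShell m R → ℝ) (f : Phase → ℝ) : Prop where
  initial : ∀ z : initialShell m R, f z = f₀ z
  transport : ∀ (x p : ℝ → Spacetime) (a b : ℝ), a < b → IsNullGeodesic m x p a b →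
    0 ≤ tau m R (x a) → 0 < tau m R (x b) → f (x b, p b) = f (x a, p a)

/-- The support of `f₀` lies in
`{r ≤ C_r, p^{t*} ≤ C_p, |p^r| ≤ C_p, |p̸| ≤ C_p}`. -/
def SupportBound (m R Cr Cp : ℝ) (f₀ : initialShell m R → ℝ) : Prop :=
  tsupport f₀ ⊆ {z | radius z.1.1 ≤ Cr ∧ pT z.1.2 ≤ Cp ∧ |pR z.1.1 z.1.2| ≤ Cp ∧
    ‖pAng z.1.1 z.1.2‖ ≤ Cp}

/-! ### Moments and the energy-momentum tensor -/

open Classical in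
/-- `p^{t*}` as a function of `(p^r, p̸)`, i.e. of `v`, on the mass-shell over `x`. -/
def pTOf (m : ℝ) (x : Spacetime) (v : E3) : ℝ :=
  if radius x = m then
    |pR x (0, v)| + ‖pAng x (0, v)‖ ^ 2 / (2 * |pR x (0, v)|)
  else
    ((1 - lapseSq m (radius x)) * pR x (0, v)
      + √(pR x (0, v) ^ 2 + lapseSq m (radius x) * ‖pAng x (0, v)‖ ^ 2)) / lapseSq m (radius x)

/-- The range of the parametrisation `v ↦ (p^{t*}, v)` of the fibre of the mass-shell over `x`:
all `v ≠ 0` if `r > m`; all `v` with `p^r < 0` if `r = m` (this omits only the ray `p^r = 0`). -/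
def fibreDomain (m : ℝ) (x : Spacetime) : Set E3 :=
  {v | v ≠ 0 ∧ (radius x = m → pR x (0, v) < 0)}

/-- The energy `E = Ω² p^{t*} - (1 - Ω²) p^r = -g(∂_{t*}, p)`. -/
def energy (m : ℝ) (x p : Spacetime) : ℝ :=
  lapseSq m (radius x) * pT p - (1 - lapseSq m (radius x)) * pR x p

/-- The integrand of a moment `∫_{𝒫_x} w dμ_x` with respect to Lebesgue measure `dv`. The measure is
`dμ_x = r² sin θ / (Ω² p^{t*} - (1 - Ω²) p^r) dp^r dp^θ dp^φ`, and
`r² sin θ dp^r dp^θ dp^φ = dv`. -/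
def momentIntegrand (m : ℝ) (w : Phase → ℝ) (x : Spacetime) (v : E3) : ℝ :=
  w (x, (pTOf m x v, v)) / energy m x (pTOf m x v, v)

/-- The moment `∫_{𝒫_x} w dμ_x`. -/
def moment (m : ℝ) (w : Phase → ℝ) (x : Spacetime) : ℝ :=
  ∫ v in fibreDomain m x, momentIntegrand m w x v

/-- The moment `∫_{𝒫_x} w dμ_x` converges absolutely. -/
def MomentConverges (m : ℝ) (w : Phase → ℝ) (x : Spacetime) : Prop :=
  MeasureTheory.IntegrableOn (momentIntegrand m w x) (fibreDomain m x)

/-- The weighted distribution `p^{t*} p^{t*} f`. -/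
def weightTT (f : Phase → ℝ) (z : Phase) : ℝ := pT z.2 * pT z.2 * f z

/-- The weighted distribution `p^{t*} p^r f`. -/
def weightTR (f : Phase → ℝ) (z : Phase) : ℝ := pT z.2 * pR z.1 z.2 * f z

/-- The weighted distribution `p^r p^r f`. -/
def weightRR (f : Phase → ℝ) (z : Phase) : ℝ := pR z.1 z.2 * pR z.1 z.2 * f z

/-- The component `T^{t* t*}[f]` of the energy-momentum tensor. -/
def TTT (m : ℝ) (f : Phase → ℝ) (x : Spacetime) : ℝ := moment m (weightTT f) x

/-- The component `T^{t* r}[f]` of the energy-momentum tensor. -/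
def TTR (m : ℝ) (f : Phase → ℝ) (x : Spacetime) : ℝ := moment m (weightTR f) x

/-- The component `T^{r r}[f]` of the energy-momentum tensor. -/
def TRR (m : ℝ) (f : Phase → ℝ) (x : Spacetime) : ℝ := moment m (weightRR f) x

/-! ### Almost generators of the horizon -/

/-- The set `𝔅_δ` of almost generators of the horizon over `Σ₀`: `m ≤ r ≤ (1 + δ) m`,
`-K C_p √Ω² ≤ p^r ≤ C_p Ω²`, `|p̸| ≤ K C_p (Ω²)^{1/4}`, and `p^{t*} ≤ C_p / 2`. By the mass-shell
relation the last condition gives `|p^r|, |p̸| ≤ C_p / 2`, so that the set lies well inside the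
momentum support allowed by `SupportBound`; without it, `p^{t*}` would be unbounded on the set. -/
def almostGenerators (m R Cp K δ : ℝ) : Set (initialShell m R) :=
  {z | m ≤ radius z.1.1 ∧ radius z.1.1 ≤ (1 + δ) * m ∧
    -(K * Cp * √(lapseSq m (radius z.1.1))) ≤ pR z.1.1 z.1.2 ∧
    pR z.1.1 z.1.2 ≤ Cp * lapseSq m (radius z.1.1) ∧
    ‖pAng z.1.1 z.1.2‖ ≤ K * Cp * (lapseSq m (radius z.1.1)) ^ (1 / 4 : ℝ) ∧
    pT z.1.2 ≤ Cp / 2}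

/-- `inf_{𝔅_δ} |f₀|`. -/
def infAlmostGenerators (m R Cp K δ : ℝ) (f₀ : initialShell m R → ℝ) : ℝ :=
  sInf ((fun z => |f₀ z|) '' almostGenerators m R Cp K δ)

end ERN

end

noncomputable section

namespace ERN

open Set Filter Topology

/-! ### The metric in Kerr–Schild form and the geodesic equation -/

/-! Null geodesics are traced backwards from a horizon point at time τ. In the Kerr–Schild form of
the metric the position vector `y` moves, in an affine parameter, under a central force fixed by the
squared angular momentum λ (`isNullGeodesic_of_reduced`). At the horizon p^r = -E, p^{t*} = E +
|p̸|²/(2E) and λ = m²|p̸|². Since f is constant along rays, everything depends on which pairs (E,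
p̸) belong to rays that leave the support of f₀ and arrive only at the late time τ.

There are two ways to be late. The horizon is degenerate, so a ray may start at a distance of order
m²/τ from it, nearly tangent to the generators; then E ≲ Cp m²/τ² and |p̸|² ≲ Cp E. Or the ray
lingers at the unstable photon sphere r = 2m, which forces λ/(mE)² to lie exponentially close to 16.
`late_arrival` is this dichotomy. Both delays are measured by the loss of advanced time t* + r: the
first is controlled by the function `virial`, the second by the arsinh of `photonProduct`.

The moments integrate against dv/E. For near-generators the disc |p̸|² ≲ Cp E has area proportional
to E, which cancels 1/E, and the range E ≲ Cp m²/τ² gives τ⁻². There p^{t*} ≲ Cp, while each factor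
p^r contributes another τ⁻². Nearly trapped momenta fill an annulus of relative width smaller than
any power needed. This is `lintegral_horizonIntegrand_le`.

For the lower bounds, a box of momenta with E ~ Cp m²/τ² and |p̸| ~ Cp m/τ is traced back into 𝔅_δ
(`early_position`, `IsVlasovSolution.inf_le`); its volume produces the same powers of τ.

Both directions need rays that really reach the initial hypersurface, and measurability of f on the
fibre needs their continuous dependence on the final momentum; `exists_local_backRays` provides
both. Radial momenta, where λ = 0, form a null set and are discarded. -/

lemma one_sub_lapseSq (m r : ℝ) : 1 - lapseSq m r = 2 * m / r - m ^ 2 / r ^ 2 := by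
  unfold lapseSq; ring

lemma lapseSq_eq {r : ℝ} (m : ℝ) (hr : r ≠ 0) : lapseSq m r = ((r - m) / r) ^ 2 := by
  unfold lapseSq; field_simp; ring

lemma inner_pAng {x : Spacetime} (hx : x.2 ≠ 0) (p q : Spacetime) :
    inner ℝ (pAng x p) (pAng x q) = inner ℝ p.2 q.2 - pR x p * pR x q := by
  have h : ‖x.2‖ ≠ 0 := norm_ne_zero_iff.mpr hx
  simp only [pAng, pR, inner_sub_left, inner_sub_right, real_inner_smul_left,
    real_inner_smul_right, real_inner_self_eq_norm_sq, real_inner_comm x.2 p.2]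
  field_simp
  ring

lemma norm_pAng_sq {x : Spacetime} (hx : x.2 ≠ 0) (p : Spacetime) :
    ‖pAng x p‖ ^ 2 = ‖p.2‖ ^ 2 - pR x p ^ 2 := by
  rw [← real_inner_self_eq_norm_sq, inner_pAng hx, real_inner_self_eq_norm_sq]
  ring

/-- The metric is the Minkowski metric plus `(1 - Ω²) (dt* + dr)²`. -/
lemma metric_eq_kerrSchild (m : ℝ) {x : Spacetime} (hx : x.2 ≠ 0) (p q : Spacetime) :
    metric m x p q = -(p.1 * q.1) + inner ℝ p.2 q.2
      + (2 * m / ‖x.2‖ - m ^ 2 / ‖x.2‖ ^ 2) * (p.1 + inner ℝ x.2 p.2 / ‖x.2‖)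
        * (q.1 + inner ℝ x.2 q.2 / ‖x.2‖) := by
  rw [metric, inner_pAng hx, ← one_sub_lapseSq]
  simp only [pT, pR, radius]
  ring

lemma hasFDerivAt_radius {x : Spacetime} (hx : x.2 ≠ 0) :
    HasFDerivAt (fun z : Spacetime => ‖z.2‖)
      ((‖x.2‖⁻¹ • innerSL ℝ x.2).comp (ContinuousLinearMap.snd ℝ ℝ E3)) x := by
  have h1 : HasFDerivAt (fun y : E3 => ‖y‖) (‖x.2‖⁻¹ • innerSL ℝ x.2) x.2 := by
    have h2 := (hasStrictFDerivAt_norm_sq x.2).hasFDerivAt.sqrt (by simpa using hx)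
    simp only [Real.sqrt_sq (norm_nonneg _)] at h2
    refine h2.congr_fderiv ?_
    rw [← Nat.cast_smul_eq_nsmul ℝ, smul_smul]
    congr 1
    push_cast
    field_simp
  exact h1.comp x hasFDerivAt_snd

lemma hasFDerivAt_inner_const (x : Spacetime) (v : E3) :
    HasFDerivAt (fun z : Spacetime => inner ℝ z.2 v)
      ((innerSL ℝ v).comp (ContinuousLinearMap.snd ℝ ℝ E3)) x := by
  have h := ((innerSL ℝ v).comp (ContinuousLinearMap.snd ℝ ℝ E3)).hasFDerivAt (x := x)
  refine h.congr_of_eventuallyEq (Eventually.of_forall fun z => ?_)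
  simp [real_inner_comm]

/-- The derivative of the metric coefficient `g(p, q)` in the direction `e`. -/
lemma fderiv_metric (m : ℝ) {x : Spacetime} (hx : x.2 ≠ 0) (p q e : Spacetime) :
    fderiv ℝ (fun z => metric m z p q) x e =
      (-(2 * m) / ‖x.2‖ ^ 2 + 2 * m ^ 2 / ‖x.2‖ ^ 3) * (inner ℝ x.2 e.2 / ‖x.2‖)
        * (p.1 + inner ℝ x.2 p.2 / ‖x.2‖) * (q.1 + inner ℝ x.2 q.2 / ‖x.2‖)
      + (2 * m / ‖x.2‖ - m ^ 2 / ‖x.2‖ ^ 2) *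
        ((inner ℝ p.2 e.2 / ‖x.2‖ - inner ℝ x.2 p.2 * inner ℝ x.2 e.2 / ‖x.2‖ ^ 3)
            * (q.1 + inner ℝ x.2 q.2 / ‖x.2‖)
          + (p.1 + inner ℝ x.2 p.2 / ‖x.2‖)
            * (inner ℝ q.2 e.2 / ‖x.2‖ - inner ℝ x.2 q.2 * inner ℝ x.2 e.2 / ‖x.2‖ ^ 3)) := by
  have hr : ‖x.2‖ ≠ 0 := norm_ne_zero_iff.mpr hx
  have hR := hasFDerivAt_radius hx
  have hinv : HasFDerivAt (fun z : Spacetime => ‖z.2‖⁻¹) _ x :=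
    (hasDerivAt_inv hr).comp_hasFDerivAt x hR
  have hp := (hasFDerivAt_inner_const x p.2).mul hinv
  have hq := (hasFDerivAt_inner_const x q.2).mul hinv
  have hH := (hinv.const_mul (2 * m)).sub ((hinv.mul hinv).const_mul (m ^ 2))
  have hD := ((hH.mul (hp.const_add p.1)).mul (hq.const_add q.1)).const_add
    (-(p.1 * q.1) + inner ℝ p.2 q.2)
  have hev : (fun z => metric m z p q) =ᶠ[𝓝 x] fun z => (-(p.1 * q.1) + inner ℝ p.2 q.2)
      + (2 * m * ‖z.2‖⁻¹ - m ^ 2 * (‖z.2‖⁻¹ * ‖z.2‖⁻¹)) * (p.1 + inner ℝ z.2 p.2 * ‖z.2‖⁻¹)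
        * (q.1 + inner ℝ z.2 q.2 * ‖z.2‖⁻¹) := by
    have hopen : ∀ᶠ z : Spacetime in 𝓝 x, z.2 ≠ 0 :=
      continuous_snd.continuousAt.eventually_ne hx
    filter_upwards [hopen] with z hz
    rw [metric_eq_kerrSchild m hz p q]
    simp only [div_eq_mul_inv]
    ring
  have hD' := hD.congr_of_eventuallyEq hev
  rw [hD'.fderiv]
  simp
  field_simp
  ring

lemma reduced_null {m E lam r ν : ℝ} (hr : 0 < r)
    (hE : ν ^ 2 + lam * (r - m) ^ 2 / r ^ 4 = E ^ 2) (hD : 0 < E - ν) :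
    -((lam / (r ^ 2 * (E - ν)) - ν) * (lam / (r ^ 2 * (E - ν)) - ν)) + (ν ^ 2 + lam / r ^ 2)
      + (2 * m / r - m ^ 2 / r ^ 2) * ((lam / (r ^ 2 * (E - ν)) - ν) + ν)
        * ((lam / (r ^ 2 * (E - ν)) - ν) + ν) = 0 := by
  have hl : lam * (r - m) ^ 2 = (E - ν) * (E + ν) * r ^ 4 := by
    field_simp at hE
    linear_combination hE
  field_simp
  linear_combination (-lam) * hl

lemma reduced_P_deriv {m E lam r ν : ℝ} (hr : 0 < r)
    (hE : ν ^ 2 + lam * (r - m) ^ 2 / r ^ 4 = E ^ 2) (hD : 0 < E - ν) :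
    lam * (-(2 * r * ν * (E - ν) + r ^ 2 * -(lam / r ^ 3
      + lam * (2 * m ^ 2 / r ^ 6 - 3 * m / r ^ 5) * r)) / (r ^ 2 * (E - ν)) ^ 2)
      = lam / r ^ 3 + (-m / r ^ 2 + m ^ 2 / r ^ 3) * (lam / (r ^ 2 * (E - ν))) ^ 2 := by
  have hl : lam * (r - m) ^ 2 = (E - ν) * (E + ν) * r ^ 4 := by
    field_simp at hE
    linear_combination hE
  field_simp
  linear_combination lam * hl

/-- The geodesic equation tested against `e`, with `et`, `ne`, `ue` standing for the time component
of `e` and its inner products with position and velocity. The hypotheses are the two expressions for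
P = p^{t*} + p^r; eliminating λ and E through them leaves a rational identity in r, ν, P. -/
lemma reduced_geodesic {m E lam r ν P et ne ue : ℝ} (hr : 0 < r)
    (hP1 : P * (r - m) ^ 2 = (E + ν) * r ^ 2) (hP2 : lam = P * (E - ν) * r ^ 2) :
    -((lam / r ^ 3 + (-m / r ^ 2 + m ^ 2 / r ^ 3) * P ^ 2
        - (lam / r ^ 3 + lam * (2 * m ^ 2 / r ^ 6 - 3 * m / r ^ 5) * r)) * et)
      + lam * (2 * m ^ 2 / r ^ 6 - 3 * m / r ^ 5) * ne
      + (2 * m / r - m ^ 2 / r ^ 2)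
        * ((lam / r ^ 3 + (-m / r ^ 2 + m ^ 2 / r ^ 3) * P ^ 2
        - (lam / r ^ 3 + lam * (2 * m ^ 2 / r ^ 6 - 3 * m / r ^ 5) * r))
          + lam * (2 * m ^ 2 / r ^ 6 - 3 * m / r ^ 5) * r ^ 2 / r) * (et + ne / r)
      + ((-(2 * m) / r ^ 2 + 2 * m ^ 2 / r ^ 3) * ν * P * (et + ne / r)
        + (2 * m / r - m ^ 2 / r ^ 2) * (lam / r ^ 3 * (et + ne / r)
          + P * (ue / r - ν * ne / r ^ 2))
        - ((-(2 * m) / r ^ 2 + 2 * m ^ 2 / r ^ 3) * (ne / r) * P * P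
          + (2 * m / r - m ^ 2 / r ^ 2) * ((ue / r - ν * ne / r ^ 2) * P
            + P * (ue / r - ν * ne / r ^ 2))) / 2) = 0 := by
  have hl : E = P * (r - m) ^ 2 / r ^ 2 - ν := by
    field_simp; linear_combination -hP1
  subst hP2 hl
  field_simp
  ring

lemma hasDerivWithinAt_norm_of_ne {y : ℝ → E3} {u : E3} {I : Set ℝ} {s : ℝ} (hy0 : y s ≠ 0)
    (hy : HasDerivWithinAt y u I s) :
    HasDerivWithinAt (fun s => ‖y s‖) (inner ℝ (y s) u / ‖y s‖) I s := by
  have h0 : 0 < ‖y s‖ := norm_pos_iff.mpr hy0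
  have h1 := hy.norm_sq.sqrt (by positivity)
  simp only [Real.sqrt_sq (norm_nonneg _)] at h1
  refine h1.congr_deriv ?_
  field_simp

/-- Centrifugal acceleration plus the radial part of the central force. -/
lemma hasDerivWithinAt_radial_velocity {y u : ℝ → E3} {I : Set ℝ} {s lam k : ℝ} (hy0 : y s ≠ 0)
    (hy : HasDerivWithinAt y (u s) I s) (hu : HasDerivWithinAt u ((lam * k) • y s) I s)
    (hu2 : ‖u s‖ ^ 2 = (inner ℝ (y s) (u s) / ‖y s‖) ^ 2 + lam / ‖y s‖ ^ 2) :
    HasDerivWithinAt (fun s => inner ℝ (y s) (u s) / ‖y s‖)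
      (lam / ‖y s‖ ^ 3 + lam * k * ‖y s‖) I s := by
  have h0 : 0 < ‖y s‖ := norm_pos_iff.mpr hy0
  have h1 := (hy.inner ℝ hu).div (hasDerivWithinAt_norm_of_ne hy0 hy) h0.ne'
  refine h1.congr_deriv ?_
  rw [real_inner_self_eq_norm_sq, hu2, real_inner_smul_right, real_inner_self_eq_norm_sq]
  field_simp
  ring

/-- Curves solving the reduced equations are null geodesics: the position vector moves under a
central force, and `P = p^{t*} + p^r` is determined by the energy and the angular momentum. -/
theorem isNullGeodesic_of_reduced {m E lam a b : ℝ} (hm : 0 < m) {t : ℝ → ℝ} {y u : ℝ → E3}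
    (hr : ∀ s ∈ Icc a b, m ≤ ‖y s‖)
    (hy : ∀ s ∈ Icc a b, HasDerivWithinAt y (u s) (Icc a b) s)
    (hu : ∀ s ∈ Icc a b, HasDerivWithinAt u
      ((lam * (2 * m ^ 2 / ‖y s‖ ^ 6 - 3 * m / ‖y s‖ ^ 5)) • y s) (Icc a b) s)
    (hu2 : ∀ s ∈ Icc a b, ‖u s‖ ^ 2 = (inner ℝ (y s) (u s) / ‖y s‖) ^ 2 + lam / ‖y s‖ ^ 2)
    (hE : ∀ s ∈ Icc a b, (inner ℝ (y s) (u s) / ‖y s‖) ^ 2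
      + lam * (‖y s‖ - m) ^ 2 / ‖y s‖ ^ 4 = E ^ 2)
    (hpos : ∀ s ∈ Icc a b, 0 < E - inner ℝ (y s) (u s) / ‖y s‖)
    (hpT : ∀ s ∈ Icc a b, 0 < lam / (‖y s‖ ^ 2 * (E - inner ℝ (y s) (u s) / ‖y s‖))
      - inner ℝ (y s) (u s) / ‖y s‖)
    (ht : ∀ s ∈ Icc a b, HasDerivWithinAt t
      (lam / (‖y s‖ ^ 2 * (E - inner ℝ (y s) (u s) / ‖y s‖))
        - inner ℝ (y s) (u s) / ‖y s‖) (Icc a b) s) :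
    IsNullGeodesic m (fun s => (t s, y s))
      (fun s => (lam / (‖y s‖ ^ 2 * (E - inner ℝ (y s) (u s) / ‖y s‖))
        - inner ℝ (y s) (u s) / ‖y s‖, u s)) a b := by
  have hr0 : ∀ s ∈ Icc a b, 0 < ‖y s‖ := fun s hs => hm.trans_le (hr s hs)
  have hyne : ∀ s ∈ Icc a b, y s ≠ 0 := fun s hs => norm_pos_iff.mp (hr0 s hs)
  refine ⟨fun s hs => ⟨hr s hs, ?_, hpT s hs⟩, fun s hs => (ht s hs).prodMk (hy s hs),
    fun s hs => ?_⟩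
  · rw [metric_eq_kerrSchild m (x := (t s, y s)) (hyne s hs)]
    simp only [real_inner_self_eq_norm_sq, hu2 s hs]
    exact reduced_null (hr0 s hs) (hE s hs) (hpos s hs)
  · have h0 := hr0 s hs
    have hE' := hE s hs
    have hp' := hpos s hs
    have hu2' := hu2 s hs
    have hyd := hy s hs
    have hud := hu s hs
    have hrd := hasDerivWithinAt_norm_of_ne (hyne s hs) hyd
    have hνd := hasDerivWithinAt_radial_velocity (hyne s hs) hyd hud hu2'
    have hPd : HasDerivWithinAt (fun s => lam / (‖y s‖ ^ 2 * (E - inner ℝ (y s) (u s) / ‖y s‖)))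
        (lam / ‖y s‖ ^ 3 + (-m / ‖y s‖ ^ 2 + m ^ 2 / ‖y s‖ ^ 3)
          * (lam / (‖y s‖ ^ 2 * (E - inner ℝ (y s) (u s) / ‖y s‖))) ^ 2) (Icc a b) s := by
      have h1 := (((hrd.pow 2).mul (hνd.const_sub E)).inv
        (mul_pos (pow_pos h0 2) hp').ne').const_mul lam
      refine h1.congr_deriv ?_
      rw [← reduced_P_deriv h0 hE' hp']
      simp only [Pi.mul_apply, Pi.pow_apply]
      ring
    refine ⟨_, (hPd.sub hνd).prodMk hud, fun e => ?_⟩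
    replace hyne : ((t s, y s) : Spacetime).2 ≠ 0 := hyne s hs
    rw [christoffel, fderiv_metric m hyne, fderiv_metric m hyne, metric_eq_kerrSchild m hyne]
    have hνr : inner ℝ (y s) (u s) = inner ℝ (y s) (u s) / ‖y s‖ * ‖y s‖ := by field_simp
    have hl : lam * (‖y s‖ - m) ^ 2 = (E - inner ℝ (y s) (u s) / ‖y s‖)
        * (E + inner ℝ (y s) (u s) / ‖y s‖) * ‖y s‖ ^ 4 := by
      have h3 : lam * (‖y s‖ - m) ^ 2 / ‖y s‖ ^ 4 * ‖y s‖ ^ 4 = lam * (‖y s‖ - m) ^ 2 := by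
        field_simp
      linear_combination ‖y s‖ ^ 4 * hE' - h3
    have key := reduced_geodesic (et := e.1) (ne := inner ℝ (y s) e.2) (ue := inner ℝ (u s) e.2)
      (P := lam / (‖y s‖ ^ 2 * (E - inner ℝ (y s) (u s) / ‖y s‖))) (lam := lam) (E := E)
      (ν := inner ℝ (y s) (u s) / ‖y s‖) (m := m) h0
      (by
        rw [div_mul_eq_mul_div, div_eq_iff (by positivity)]
        linear_combination hl)
      (by
        rw [div_mul_eq_mul_div, div_mul_eq_mul_div, eq_div_iff (by positivity)]
        ring)
    rw [← key]
    have hue : inner ℝ e.2 (u s) = inner ℝ (u s) e.2 := real_inner_comm _ _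
    simp only [hue, real_inner_smul_left, real_inner_smul_right, real_inner_self_eq_norm_sq, hu2']
    generalize inner ℝ (y s) e.2 = ne
    generalize inner ℝ (u s) e.2 = ue
    generalize lam / (‖y s‖ ^ 2 * (E - inner ℝ (y s) (u s) / ‖y s‖)) = P
    clear key hl hPd hνd hrd
    generalize inner ℝ (y s) (u s) / ‖y s‖ = ν at *
    rw [hνr]
    generalize ‖y s‖ = r at *
    field_simp
    ring

end ERN

namespace ERN

open Set Filter Topology

/-! ### Radial motion along null geodesics traced back from the horizon -/

lemma le_of_hasDerivWithinAt_nonneg {f f' : ℝ → ℝ} {a b : ℝ} (hab : a ≤ b)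
    (hf : ∀ s ∈ Icc a b, HasDerivWithinAt f (f' s) (Icc a b) s)
    (hf' : ∀ s ∈ Icc a b, 0 ≤ f' s) : f a ≤ f b := by
  refine monotoneOn_of_hasDerivWithinAt_nonneg (f' := f') (convex_Icc a b)
    (fun s hs => (hf s hs).continuousWithinAt)
    (fun s hs => (hf s (interior_subset hs)).mono interior_subset)
    (fun s hs => hf' s (interior_subset hs)) (left_mem_Icc.mpr hab) (right_mem_Icc.mpr hab) hab

/-- The radius `r`, its velocity `g = -p^r` and the time `T = t*` along a null geodesic of energy `E`
and squared angular momentum `lam`, as functions of the affine parameter running backwards from the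
horizon over a range in which the geodesic is in the exterior. -/
structure RadialRay (m lam E S : ℝ) (r g T : ℝ → ℝ) : Prop where
  m_pos : 0 < m
  lam_pos : 0 < lam
  E_pos : 0 < E
  S_nonneg : 0 ≤ S
  r_zero : r 0 = m
  g_zero : g 0 = E
  lt_r : ∀ s ∈ Ioc 0 S, m < r s
  deriv_r : ∀ s ∈ Icc 0 S, HasDerivWithinAt r (g s) (Icc 0 S) s
  deriv_g : ∀ s ∈ Icc 0 S, HasDerivWithinAt g
    (lam / r s ^ 3 + lam * (2 * m ^ 2 / r s ^ 6 - 3 * m / r s ^ 5) * r s) (Icc 0 S) s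
  deriv_T : ∀ s ∈ Icc 0 S, HasDerivWithinAt T (-(lam / (r s ^ 2 * (E + g s)) + g s)) (Icc 0 S) s
  energy : ∀ s ∈ Icc 0 S, g s ^ 2 + lam * (r s - m) ^ 2 / r s ^ 4 = E ^ 2

namespace RadialRay

variable {m lam E S : ℝ} {r g T : ℝ → ℝ}

lemma mono (h : RadialRay m lam E S r g T) {S' : ℝ} (h0 : 0 ≤ S') (hS : S' ≤ S) :
    RadialRay m lam E S' r g T where
  m_pos := h.m_pos
  lam_pos := h.lam_pos
  E_pos := h.E_pos
  S_nonneg := h0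
  r_zero := h.r_zero
  g_zero := h.g_zero
  lt_r s hs := h.lt_r s ⟨hs.1, hs.2.trans hS⟩
  deriv_r s hs := (h.deriv_r s ⟨hs.1, hs.2.trans hS⟩).mono (Icc_subset_Icc_right hS)
  deriv_g s hs := (h.deriv_g s ⟨hs.1, hs.2.trans hS⟩).mono (Icc_subset_Icc_right hS)
  deriv_T s hs := (h.deriv_T s ⟨hs.1, hs.2.trans hS⟩).mono (Icc_subset_Icc_right hS)
  energy s hs := h.energy s ⟨hs.1, hs.2.trans hS⟩

lemma m_le_r (h : RadialRay m lam E S r g T) {s : ℝ} (hs : s ∈ Icc 0 S) : m ≤ r s := by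
  rcases hs.1.eq_or_lt with h0 | h0
  · rw [← h0, h.r_zero]
  · exact (h.lt_r s ⟨h0, hs.2⟩).le

lemma r_pos (h : RadialRay m lam E S r g T) {s : ℝ} (hs : s ∈ Icc 0 S) : 0 < r s :=
  h.m_pos.trans_le (h.m_le_r hs)

lemma abs_g_le (h : RadialRay m lam E S r g T) {s : ℝ} (hs : s ∈ Icc 0 S) : |g s| ≤ E := by
  have h1 := h.energy s hs
  have h2 : 0 ≤ lam * (r s - m) ^ 2 / r s ^ 4 := by have := h.lam_pos; positivity
  exact abs_le_of_sq_le_sq (by linarith) h.E_pos.le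

lemma E_add_g_pos (h : RadialRay m lam E S r g T) {s : ℝ} (hs : s ∈ Icc 0 S) : 0 < E + g s := by
  have hE := h.E_pos
  rcases hs.1.eq_or_lt with h0 | h0
  · rw [← h0, h.g_zero]; linarith
  · have h1 := h.energy s hs
    have hm := h.lt_r s ⟨h0, hs.2⟩
    have h2 : 0 < lam * (r s - m) ^ 2 / r s ^ 4 := by
      have := h.lam_pos; have := h.r_pos hs
      have : 0 < r s - m := by linarith
      positivity
    have h3 := (abs_lt_of_sq_lt_sq (show g s ^ 2 < E ^ 2 by linarith) hE.le)
    have := (abs_lt.mp h3).1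
    linarith

lemma P_pos (h : RadialRay m lam E S r g T) {s : ℝ} (hs : s ∈ Icc 0 S) :
    0 < lam / (r s ^ 2 * (E + g s)) := by
  have := h.lam_pos; have := h.r_pos hs; have := h.E_add_g_pos hs
  positivity

lemma energy_factor (h : RadialRay m lam E S r g T) {s : ℝ} (hs : s ∈ Icc 0 S) :
    lam * (r s - m) ^ 2 = (E - g s) * (E + g s) * r s ^ 4 := by
  have h1 := h.energy s hs
  have := h.r_pos hs
  field_simp at h1
  linear_combination h1

/-- P = λ/(r²(E + g)) is p^{t*} + p^r, the rate at which the advanced time t* + r decreases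
backwards along the ray. Multiplying by (r - m)² and factoring the energy identity trades E + g for
E - g, the form in which P stays usable when E + g is small. -/
lemma P_mul_sq (h : RadialRay m lam E S r g T) {s : ℝ} (hs : s ∈ Icc 0 S) :
    lam / (r s ^ 2 * (E + g s)) * (r s - m) ^ 2 = (E - g s) * r s ^ 2 := by
  have := h.r_pos hs; have := h.E_add_g_pos hs
  rw [div_mul_eq_mul_div, div_eq_iff (by positivity)]
  linear_combination h.energy_factor hs

/-- E - g = P (r - m)²/r² ≤ P. -/
lemma E_le_pT (h : RadialRay m lam E S r g T) {s : ℝ} (hs : s ∈ Icc 0 S) :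
    E ≤ lam / (r s ^ 2 * (E + g s)) + g s := by
  have hr := h.r_pos hs; have hg := h.E_add_g_pos hs; have hm := h.m_pos
  have h1 := h.P_mul_sq hs
  have hP := h.P_pos hs
  have hmr := h.m_le_r hs
  have h2 : (r s - m) ^ 2 ≤ r s ^ 2 := by nlinarith
  have h3 : (E - g s) * r s ^ 2 ≤ lam / (r s ^ 2 * (E + g s)) * r s ^ 2 := by
    rw [← h1]; gcongr
  have := le_of_mul_le_mul_right h3 (by positivity)
  linarith

lemma T_le (h : RadialRay m lam E S r g T) : T S ≤ T 0 - E * S := by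
  have := le_of_hasDerivWithinAt_nonneg h.S_nonneg (f := fun s => -T s - E * s)
    (f' := fun s => lam / (r s ^ 2 * (E + g s)) + g s - E)
    (fun s hs => (((h.deriv_T s hs).neg).sub ((hasDerivWithinAt_id s _).const_mul E)).congr_deriv
      (by simp))
    (fun s hs => by have := h.E_le_pT hs; linarith)
  simp only [mul_zero, sub_zero] at this
  linarith

lemma deriv_N (h : RadialRay m lam E S r g T) {s : ℝ} (hs : s ∈ Icc 0 S) :
    HasDerivWithinAt (fun s => T s + r s) (-(lam / (r s ^ 2 * (E + g s)))) (Icc 0 S) s :=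
  ((h.deriv_T s hs).add (h.deriv_r s hs)).congr_deriv (by ring)

/-- The quantity `(E + p^r) / (E q)`, `q = m (r - m) / r²`, in a form that is regular at the
horizon. -/
def virial (m lam E : ℝ) (r g : ℝ → ℝ) (s : ℝ) : ℝ := lam * (r s - m) / (m * E * r s ^ 2 * (E + g s))

lemma virial_zero (h : RadialRay m lam E S r g T) : virial m lam E r g 0 = 0 := by
  simp [virial, h.r_zero]

/-- The growth of `virial` is the loss P of advanced time, weighted by (2m/r - 1)/m. The weight is
positive inside the photon sphere and changes sign there, so inside it the two quantities can be
compared in both directions. -/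
lemma deriv_virial (h : RadialRay m lam E S r g T) {s : ℝ} (hs : s ∈ Icc 0 S) :
    HasDerivWithinAt (virial m lam E r g)
      ((2 * m / r s - 1) / m * (lam / (r s ^ 2 * (E + g s)))) (Icc 0 S) s := by
  have hr := h.r_pos hs; have hg := h.E_add_g_pos hs; have hm := h.m_pos; have hE := h.E_pos
  have hl := h.energy_factor hs
  have h1 := (((h.deriv_r s hs).sub_const m).const_mul lam).div
    (((((h.deriv_r s hs).pow 2).const_mul (m * E))).mul ((h.deriv_g s hs).const_add E))
    (mul_pos (mul_pos (mul_pos hm hE) (pow_pos hr 2)) hg).ne'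
  refine h1.congr_deriv ?_
  simp only [Pi.mul_apply, Pi.pow_apply]
  generalize r s = ρ at *
  generalize g s = ν at *
  field_simp
  push_cast
  linear_combination (-lam * (ρ - 2 * m)) * hl

lemma virial_eq (h : RadialRay m lam E S r g T) {s : ℝ} (hs : s ∈ Icc 0 S) :
    E - g s = virial m lam E r g s * E * (m * (r s - m) / r s ^ 2) := by
  have hr := h.r_pos hs; have hg := h.E_add_g_pos hs; have hm := h.m_pos; have hE := h.E_pos
  have hl := h.energy_factor hs
  unfold virial
  field_simp
  linear_combination -hl

lemma virial_nonneg (h : RadialRay m lam E S r g T) {s : ℝ} (hs : s ∈ Icc 0 S) :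
    0 ≤ virial m lam E r g s := by
  have hr := h.r_pos hs; have hg := h.E_add_g_pos hs; have hm := h.m_pos; have hE := h.E_pos
  have := h.lam_pos
  have : 0 ≤ r s - m := by linarith [h.m_le_r hs]
  unfold virial
  positivity

/-- The weight 2m/r - 1 is at most 1 outside the horizon. -/
lemma virial_le (h : RadialRay m lam E S r g T) :
    m * virial m lam E r g S ≤ T 0 + m - (T S + r S) := by
  have := le_of_hasDerivWithinAt_nonneg h.S_nonneg
    (f := fun s => -(T s + r s) - m * virial m lam E r g s) (f' := _)
    (fun s hs => (h.deriv_N hs).neg.sub ((h.deriv_virial hs).const_mul m))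
    (fun s hs => by
      have hP := h.P_pos hs
      have hr := h.r_pos hs; have hm := h.m_pos; have hmr := h.m_le_r hs
      have h1 : 2 * m / r s ≤ 2 := by rw [div_le_iff₀ hr]; linarith
      have h2 : m * ((2 * m / r s - 1) / m * (lam / (r s ^ 2 * (E + g s))))
        = (2 * m / r s - 1) * (lam / (r s ^ 2 * (E + g s))) := by field_simp
      rw [h2]
      nlinarith)
  simp only [h.virial_zero, h.r_zero] at this
  linarith

lemma continuousOn_r (h : RadialRay m lam E S r g T) : ContinuousOn r (Icc 0 S) :=
  fun s hs => (h.deriv_r s hs).continuousWithinAt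

lemma continuousOn_g (h : RadialRay m lam E S r g T) : ContinuousOn g (Icc 0 S) :=
  fun s hs => (h.deriv_g s hs).continuousWithinAt

lemma lt_of_forall_ne (h : RadialRay m lam E S r g T) {c : ℝ} (hc : m < c)
    (hne : ∀ s ∈ Icc 0 S, r s ≠ c) {s : ℝ} (hs : s ∈ Icc 0 S) : r s < c := by
  by_contra! hcon
  have h1 := intermediate_value_Icc hs.1 (h.continuousOn_r.mono (Icc_subset_Icc_right hs.2))
  obtain ⟨s', hs', he⟩ := h1 ⟨by rw [h.r_zero]; exact hc.le, hcon⟩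
  exact hne s' ⟨hs'.1, hs'.2.trans hs.2⟩ he

/-- The energy identity in terms of `ν = g / E`, `z = m / r - 1/2`, `B = lam / (m E)²`. -/
lemma energy_normalized (h : RadialRay m lam E S r g T) {s : ℝ} (hs : s ∈ Icc 0 S) :
    (g s / E) ^ 2 + lam / (m * E) ^ 2 * (1 / 4 - (m / r s - 1 / 2) ^ 2) ^ 2 = 1 := by
  have hr := h.r_pos hs; have hm := h.m_pos; have hE := h.E_pos
  have hl := h.energy_factor hs
  field_simp
  linear_combination 256 * m ^ 2 * hl

/-- At the photon sphere z = 0 the angular term of the normalized energy identity equals B/16 > 1: a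
barrier that the ray, starting inside, never crosses. -/
lemma r_lt_two_mul (h : RadialRay m lam E S r g T) (hlam : 16 * (m * E) ^ 2 < lam) {s : ℝ}
    (hs : s ∈ Icc 0 S) : r s < 2 * m := by
  have hm := h.m_pos; have hE := h.E_pos
  refine h.lt_of_forall_ne (by linarith) (fun s hs he => ?_) hs
  have h1 := h.energy_normalized hs
  have h2 : m / r s = 1 / 2 := by rw [he]; field_simp
  rw [h2] at h1
  have h3 : 16 < lam / (m * E) ^ 2 := by rwa [lt_div_iff₀ (by positivity)]
  nlinarith [sq_nonneg (g s / E)]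

/-- At r = 4m/3, that is z = 1/4, the angular term is B (3/16)², which is at least 1 exactly when B
≥ 256/9. -/
lemma r_lt_of_lam_ge (h : RadialRay m lam E S r g T) (hlam : 256 / 9 * (m * E) ^ 2 ≤ lam) {s : ℝ}
    (hs : s ∈ Icc 0 S) : 3 * r s ≤ 4 * m := by
  have hm := h.m_pos; have hE := h.E_pos; have hr := h.r_pos hs
  have h1 := h.energy_normalized hs
  have h2 := h.r_lt_two_mul (by nlinarith [mul_pos hm hE]) hs
  have h3 : 256 / 9 ≤ lam / (m * E) ^ 2 := by rwa [le_div_iff₀ (by positivity)]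
  have h4 : 1 / 2 < m / r s := by rw [lt_div_iff₀ hr]; linarith
  have h5 : m / r s ≤ 1 := by rw [div_le_one hr]; exact h.m_le_r hs
  by_contra! hcon
  have h6 : m / r s < 3 / 4 := by rw [div_lt_iff₀ hr]; linarith
  have h7 : 3 / 16 < 1 / 4 - (m / r s - 1 / 2) ^ 2 := by nlinarith
  have h8 : 9 / 256 < (1 / 4 - (m / r s - 1 / 2) ^ 2) ^ 2 := by nlinarith
  nlinarith [sq_nonneg (g s / E)]

/-- The angular term is at most B/16 < 1 everywhere, so there is no turning point. -/
lemma g_pos (h : RadialRay m lam E S r g T) (hlam : lam < 16 * (m * E) ^ 2) {s : ℝ}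
    (hs : s ∈ Icc 0 S) : 0 < g s := by
  have hm := h.m_pos; have hE := h.E_pos; have hl := h.lam_pos
  have hne : ∀ s ∈ Icc 0 S, g s ≠ 0 := by
    intro s hs he
    have hr := h.r_pos hs
    have h1 := h.energy_normalized hs
    have h3 : lam / (m * E) ^ 2 < 16 := by rwa [div_lt_iff₀ (by positivity)]
    have h3' : 0 < lam / (m * E) ^ 2 := by positivity
    have h4 : 0 ≤ 1 / 4 - (m / r s - 1 / 2) ^ 2 := by
      have h5 : m / r s ≤ 1 := by rw [div_le_one hr]; exact h.m_le_r hs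
      have h6 : 0 < m / r s := by positivity
      nlinarith
    have h5 : (1 / 4 - (m / r s - 1 / 2) ^ 2) ^ 2 ≤ 1 / 16 := by
      nlinarith [sq_nonneg (m / r s - 1 / 2)]
    rw [he, zero_div] at h1
    nlinarith [mul_le_mul_of_nonneg_left h5 h3'.le]
  by_contra! hcon
  have h1 := intermediate_value_Icc' hs.1 (h.continuousOn_g.mono (Icc_subset_Icc_right hs.2))
  obtain ⟨s', hs', he⟩ := h1 ⟨hcon, by rw [h.g_zero]; exact hE.le⟩
  exact hne s' ⟨hs'.1, hs'.2.trans hs.2⟩ he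

/-- Far inside the photon sphere the virial quantity controls the elapsed advanced time. -/
lemma advanced_time_le_of_lam_ge (h : RadialRay m lam E S r g T)
    (hlam : 256 / 9 * (m * E) ^ 2 ≤ lam) :
    T 0 + m - (T S + r S) ≤ 2 * (m * virial m lam E r g S) := by
  have := le_of_hasDerivWithinAt_nonneg h.S_nonneg
    (f := fun s => (T s + r s) + 2 * m * virial m lam E r g s) (f' := _)
    (fun s hs => (h.deriv_N hs).add ((h.deriv_virial hs).const_mul (2 * m)))
    (fun s hs => by
      have hP := h.P_pos hs
      have hr := h.r_pos hs; have hm := h.m_pos; have hmr := h.r_lt_of_lam_ge hlam hs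
      have h1 : 3 / 2 ≤ 2 * m / r s := by rw [le_div_iff₀ hr]; linarith
      have h2 : 2 * m * ((2 * m / r s - 1) / m * (lam / (r s ^ 2 * (E + g s))))
        = 2 * (2 * m / r s - 1) * (lam / (r s ^ 2 * (E + g s))) := by field_simp
      rw [h2]
      nlinarith)
  simp only [h.virial_zero, h.r_zero] at this
  linarith

end RadialRay

/-- Instability of the photon sphere. The right side is, up to the factor mE/r², the rate of
decrease of the product zν; it dominates both |zν| (exponential departure) and the distance of B
from the critical value 16 (departure even at zν = 0). For B ≥ 4 the product is bounded by
completing a square, for B ≤ 4 because ν² ≥ 3/4. -/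
lemma hyperbolic_estimate {B ν z : ℝ} (hB : 0 ≤ B) (hν : ν ^ 2 + B * (1 / 4 - z ^ 2) ^ 2 = 1)
    (hz : |z| ≤ 1 / 4) :
    3 / 8 * (|1 - B / 16| + |z * ν|) ≤ ν ^ 2 + 2 * B * (1 / 4 - z ^ 2) * z ^ 2 := by
  have hz2 : z ^ 2 ≤ 1 / 16 := by
    have := sq_le_sq' (by linarith [abs_nonneg z]) hz
    rw [sq_abs] at this; linarith
  have hz0 := sq_nonneg z
  have hBz : 0 ≤ B * z ^ 2 := by positivity
  have hF : ν ^ 2 + 3 / 8 * (B * z ^ 2) ≤ ν ^ 2 + 2 * B * (1 / 4 - z ^ 2) * z ^ 2 := by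
    nlinarith
  have h1 : 3 / 4 * |1 - B / 16| ≤ ν ^ 2 + 3 / 8 * (B * z ^ 2) := by
    have e1 : ν ^ 2 = (1 - B / 16) + B * z ^ 2 * (1 / 2 - z ^ 2) := by linear_combination hν
    rcases abs_cases (1 - B / 16) with ⟨h, h'⟩ | ⟨h, h'⟩ <;> rw [h] <;>
      nlinarith [sq_nonneg ν]
  have h2 : |z * ν| ≤ ν ^ 2 + 3 / 8 * (B * z ^ 2) := by
    rw [abs_mul]
    have hν2 : |ν| ^ 2 = ν ^ 2 := sq_abs ν
    have hzz : |z| ^ 2 = z ^ 2 := sq_abs z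
    rcases le_total 4 B with h4 | h4
    · nlinarith [sq_nonneg (|z| - |ν|), abs_nonneg z, abs_nonneg ν]
    · have h5 : 3 / 4 ≤ ν ^ 2 := by nlinarith [sq_nonneg (1 / 4 - z ^ 2)]
      have h6 : |z| ≤ |ν| := by
        by_contra! hcon
        nlinarith [abs_nonneg z, abs_nonneg ν]
      nlinarith [abs_nonneg z, abs_nonneg ν]
  linarith [abs_nonneg (1 - B / 16), abs_nonneg (z * ν)]

lemma sqrt_one_add_sq_le (t : ℝ) : √(1 + t ^ 2) ≤ 1 + |t| := by
  rw [Real.sqrt_le_left (by positivity)]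
  nlinarith [abs_nonneg t, sq_abs t]

/-! ### Time spent near the photon sphere. -/

namespace RadialRay

variable {m lam E S : ℝ} {r g T : ℝ → ℝ}

/-- The product of position and velocity relative to the photon sphere. -/
def photonProduct (m E : ℝ) (r g : ℝ → ℝ) (s : ℝ) : ℝ := (m / r s - 1 / 2) * (g s / E)

lemma deriv_photonProduct (h : RadialRay m lam E S r g T) {s : ℝ} (hs : s ∈ Icc 0 S) :
    HasDerivWithinAt (photonProduct m E r g)
      (-(m * E / r s ^ 2 * ((g s / E) ^ 2 + 2 * (lam / (m * E) ^ 2)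
        * (1 / 4 - (m / r s - 1 / 2) ^ 2) * (m / r s - 1 / 2) ^ 2))) (Icc 0 S) s := by
  have hr := h.r_pos hs; have hm := h.m_pos; have hE := h.E_pos
  have h1 := ((((h.deriv_r s hs).inv hr.ne').const_mul m).sub_const (1 / 2)).mul
    ((h.deriv_g s hs).div_const E)
  have h2 : HasDerivWithinAt (photonProduct m E r g) _ (Icc 0 S) s :=
    h1.congr_of_mem (fun x _ => by simp [photonProduct, div_eq_mul_inv]) hs
  refine h2.congr_deriv ?_
  simp only [Pi.inv_apply]
  field_simp
  ring

lemma abs_w_sub_half_le (h : RadialRay m lam E S r g T) {s : ℝ} (hs : s ∈ Icc 0 S) :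
    |m / r s - 1 / 2| ≤ 1 / 2 := by
  have hr := h.r_pos hs; have hm := h.m_pos
  have h5 : m / r s ≤ 1 := by rw [div_le_one hr]; exact h.m_le_r hs
  have h6 : 0 < m / r s := by positivity
  rw [abs_le]; constructor <;> linarith

lemma abs_photonProduct_le (h : RadialRay m lam E S r g T) {s : ℝ} (hs : s ∈ Icc 0 S) :
    |photonProduct m E r g s| ≤ 1 / 2 := by
  have hE := h.E_pos
  rw [photonProduct, abs_mul]
  have h1 := h.abs_w_sub_half_le hs
  have h2 : |g s / E| ≤ 1 := by
    rw [abs_div, abs_of_pos hE, div_le_one hE]; exact h.abs_g_le hs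
  nlinarith [abs_nonneg (m / r s - 1 / 2), abs_nonneg (g s / E)]

/-- Near the photon sphere, `p^{t*} + p^r` is controlled by the angular velocity. -/
lemma P_le_near_photonSphere (h : RadialRay m lam E S r g T) {s : ℝ} (hs : s ∈ Icc 0 S)
    (hz : |m / r s - 1 / 2| ≤ 1 / 4) :
    lam / (r s ^ 2 * (E + g s)) ≤ 57 * (m ^ 2 * E / r s ^ 2) := by
  have hr := h.r_pos hs; have hm := h.m_pos; have hE := h.E_pos
  have h1 := h.P_mul_sq hs
  have h2 := (abs_le.mp (h.abs_g_le hs)).1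
  obtain ⟨hz1, hz2⟩ := abs_le.mp hz
  generalize hP : lam / (r s ^ 2 * (E + g s)) = P at *
  have hP0 : 0 < P := hP ▸ h.P_pos hs
  have h3 : (r s - m) ^ 2 = (1 - m / r s) ^ 2 * r s ^ 2 := by field_simp
  have h4 : P * (1 - m / r s) ^ 2 = E - g s := by
    rw [h3, ← mul_assoc] at h1
    exact mul_right_cancel₀ (by positivity) h1
  have h5 : m ^ 2 * E / r s ^ 2 = (m / r s) ^ 2 * E := by field_simp
  rw [h5]
  generalize m / r s = w at *
  -- From P(1 - w)² = E - g ≤ 2E and w(1 - w) ≥ 3/16 one gets P ≤ (512/9) w² E, and 512/9 < 57.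
  have h6 : 3 / 16 ≤ w * (1 - w) := by nlinarith
  have h7 : 9 / 256 ≤ (w * (1 - w)) ^ 2 := by nlinarith
  have h8 : P * (9 / 256) ≤ P * (w * (1 - w)) ^ 2 := by gcongr
  have h9 : P * (w * (1 - w)) ^ 2 = (E - g s) * w ^ 2 := by rw [← h4]; ring
  have h10 : (E - g s) * w ^ 2 ≤ 2 * E * w ^ 2 := by gcongr; linarith
  nlinarith [mul_nonneg (sq_nonneg w) hE.le]

/-- A monotone combination of advanced time and three compensators, one for each zone. For z > 1/4
the virial term, which contributes 4zP, pays for the loss P. For |z| ≤ 1/4 it may cost another P,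
and the arsinh term pays for 2P: 304 · 3/8 = 2 · 57. For z < -1/4, that is r > 4m, the virial term
costs up to 2P, and the multiple γ of m/r pays for 3P, as `hγ'` demands. -/
lemma advanced_time_le (h : RadialRay m lam E S r g T) (hne : lam ≠ 16 * (m * E) ^ 2) {γ ε : ℝ}
    (hε : ε = |1 - lam / (m * E) ^ 2 / 16|)
    (hγ : ∀ s ∈ Icc 0 S, 0 ≤ γ * g s)
    (hγ' : ∀ s ∈ Icc 0 S, 4 * m < r s →
      3 * (lam / (r s ^ 2 * (E + g s))) ≤ γ * (m ^ 2 / r s ^ 2) * g s) :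
    T 0 + m - (T S + r S) ≤ m * (2 * virial m lam E r g S
      + 304 * (Real.arsinh (photonProduct m E r g 0 / ε)
        - Real.arsinh (photonProduct m E r g S / ε)) + γ * (1 - m / r S)) := by
  have hm := h.m_pos; have hE := h.E_pos
  have hε0 : 0 < ε := by
    rw [hε, abs_pos]
    intro h0
    apply hne
    have : lam / (m * E) ^ 2 = 16 := by linarith
    rwa [div_eq_iff (by positivity)] at this
  have hY : ∀ s ∈ Icc 0 S, HasDerivWithinAt
      (fun s => Real.arsinh (photonProduct m E r g s / ε)) _ (Icc 0 S) s :=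
    fun s hs => ((h.deriv_photonProduct hs).div_const ε).arsinh
  have := le_of_hasDerivWithinAt_nonneg h.S_nonneg
    (f := fun s => (T s + r s) + m * (2 * virial m lam E r g s
      - 304 * Real.arsinh (photonProduct m E r g s / ε) - γ * (m * (r s)⁻¹))) (f' := _)
    (fun s hs => (h.deriv_N hs).add (((((h.deriv_virial hs).const_mul 2).sub
      ((hY s hs).const_mul 304)).sub
      ((((h.deriv_r s hs).inv (h.r_pos hs).ne').const_mul m).const_mul γ)).const_mul m))
    (fun s hs => by
      have hP := h.P_pos hs
      have hr := h.r_pos hs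
      have hg1 := hγ s hs
      have hg2 := hγ' s hs
      have hen := h.energy_normalized hs
      have hz := h.abs_w_sub_half_le hs
      have hPn := h.P_le_near_photonSphere hs
      have hz2 : (m / r s - 1 / 2) ^ 2 ≤ 1 / 4 := by
        have := sq_le_sq' (by linarith [abs_nonneg (m / r s - 1 / 2)]) hz
        rw [sq_abs] at this; linarith
      have hB : 0 ≤ lam / (m * E) ^ 2 := by have := h.lam_pos; positivity
      have hhyp := hyperbolic_estimate hB hen
      set F := (g s / E) ^ 2 + 2 * (lam / (m * E) ^ 2) * (1 / 4 - (m / r s - 1 / 2) ^ 2)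
        * (m / r s - 1 / 2) ^ 2 with hF
      have hF0 : 0 ≤ F := by
        have : 0 ≤ 1 / 4 - (m / r s - 1 / 2) ^ 2 := by linarith
        positivity
      set X := photonProduct m E r g s with hX
      have hX' : (m / r s - 1 / 2) * (g s / E) = X := rfl
      rw [hX', ← hε] at hhyp
      set P := lam / (r s ^ 2 * (E + g s)) with hPdef
      set W := (√(1 + (X / ε) ^ 2))⁻¹ * (F / ε) with hW
      have hW0 : 0 ≤ W := by positivity
      -- √(1 + (X/ε)²) ε ≤ ε + |X|, which `hyperbolic_estimate` bounds by 8F/3; hence arsinh(X/ε)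
      -- moves at a rate bounded below, uniformly in ε.
      have hWn : |m / r s - 1 / 2| ≤ 1 / 4 → 3 / 8 ≤ W := by
        intro hz4
        have h1 := hhyp hz4
        have h2 := sqrt_one_add_sq_le (X / ε)
        have h3 : 0 < √(1 + (X / ε) ^ 2) := by positivity
        rw [hW, inv_mul_eq_div, le_div_iff₀ h3, le_div_iff₀ hε0]
        have h4 : √(1 + (X / ε) ^ 2) * ε ≤ (1 + |X / ε|) * ε := by gcongr
        have h5 : (1 + |X / ε|) * ε = ε + |X| := by
          rw [abs_div, abs_of_pos hε0]; field_simp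
        nlinarith
      have hexp : -P + m * (2 * ((2 * m / r s - 1) / m * P)
          - 304 * ((√(1 + (X / ε) ^ 2))⁻¹ • (-(m * E / r s ^ 2 * F) / ε))
          - γ * (m * (-g s / r s ^ 2)))
          = -P + 4 * (m / r s - 1 / 2) * P + 304 * (m ^ 2 * E / r s ^ 2) * W
            + γ * g s * (m ^ 2 / r s ^ 2) := by
        rw [hW, smul_eq_mul]
        field_simp
        ring
      rw [hexp]
      have hmE : 0 < m ^ 2 * E / r s ^ 2 := by positivity
      have hmr : 0 < m ^ 2 / r s ^ 2 := by positivity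
      have hγm : 0 ≤ γ * g s * (m ^ 2 / r s ^ 2) := by positivity
      obtain ⟨hz1, hz3⟩ := abs_le.mp hz
      rcases lt_or_ge (1 / 4) |m / r s - 1 / 2| with hc | hc
      · have : 0 ≤ 304 * (m ^ 2 * E / r s ^ 2) * W := by positivity
        rcases lt_abs.mp hc with hc | hc
        · have := mul_le_mul_of_nonneg_right hc.le hP.le
          linarith
        · have h4 : 4 * m < r s := by
            have : m / r s < 1 / 4 := by linarith
            rw [div_lt_iff₀ hr] at this; linarith
          have := hg2 h4
          have h5 := mul_le_mul_of_nonneg_right hz1 hP.le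
          have h6 : γ * (m ^ 2 / r s ^ 2) * g s = γ * g s * (m ^ 2 / r s ^ 2) := by ring
          linarith
      · have h1 := hWn hc
        have h2 := hPn hc
        have h3 : 304 * (m ^ 2 * E / r s ^ 2) * (3 / 8) ≤ 304 * (m ^ 2 * E / r s ^ 2) * W := by
          gcongr
        have h4 := mul_le_mul_of_nonneg_right (abs_le.mp hc).1 hP.le
        linarith)
  simp only [h.virial_zero, h.r_zero, ← div_eq_mul_inv, div_self hm.ne'] at this
  linarith

lemma arsinh_photonProduct_sub_le (h : RadialRay m lam E S r g T) {ε : ℝ} (hε : 0 < ε) :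
    Real.arsinh (photonProduct m E r g 0 / ε) - Real.arsinh (photonProduct m E r g S / ε)
      ≤ 2 * Real.arsinh (1 / (2 * ε)) := by
  have h0 := abs_le.mp (h.abs_photonProduct_le (left_mem_Icc.mpr h.S_nonneg))
  have h1 := abs_le.mp (h.abs_photonProduct_le (right_mem_Icc.mpr h.S_nonneg))
  have e : 1 / (2 * ε) = 1 / 2 / ε := by field_simp
  have a0 : Real.arsinh (photonProduct m E r g 0 / ε) ≤ Real.arsinh (1 / (2 * ε)) := by
    rw [Real.arsinh_le_arsinh, e]; gcongr; exact h0.2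
  have a1 : -Real.arsinh (1 / (2 * ε)) ≤ Real.arsinh (photonProduct m E r g S / ε) := by
    rw [← Real.arsinh_neg, Real.arsinh_le_arsinh, e, ← neg_div]; gcongr; exact h1.1
  linarith

/-- Elapsed advanced time along rays confined inside the photon sphere. -/
lemma advanced_time_le_of_lam_gt (h : RadialRay m lam E S r g T) (hlam : 16 * (m * E) ^ 2 < lam) :
    T 0 + m - (T S + r S) ≤ m * (2 * virial m lam E r g S
      + 608 * Real.arsinh (1 / (2 * |1 - lam / (m * E) ^ 2 / 16|))) := by
  have hm := h.m_pos; have hE := h.E_pos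
  -- The ray never reaches r > 4m, so γ = 0 is allowed.
  have h1 := h.advanced_time_le hlam.ne' rfl (γ := 0) (fun s hs => by simp) (fun s hs h4 => by
    have := h.r_lt_two_mul hlam hs; linarith)
  have hε : 0 < |1 - lam / (m * E) ^ 2 / 16| := by
    rw [abs_pos]
    have : 16 < lam / (m * E) ^ 2 := by rwa [lt_div_iff₀ (by positivity)]
    linarith
  have h2 := h.arsinh_photonProduct_sub_le hε
  refine h1.trans (mul_le_mul_of_nonneg_left ?_ hm.le)
  linarith

/-- Elapsed advanced time along rays that cross the photon sphere. -/
lemma advanced_time_le_of_lam_lt (h : RadialRay m lam E S r g T) (hlam : lam < 16 * (m * E) ^ 2) :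
    T 0 + m - (T S + r S) ≤ m * (2 * virial m lam E r g S
      + 608 * Real.arsinh (1 / (2 * |1 - lam / (m * E) ^ 2 / 16|)) + 96) := by
  have hm := h.m_pos; have hE := h.E_pos
  have hB : lam / (m * E) ^ 2 < 16 := by rwa [div_lt_iff₀ (by positivity)]
  have hB0 : 0 < lam / (m * E) ^ 2 := by have := h.lam_pos; positivity
  -- For r > 4m one has g ≥ E/2 and P ≤ 16 m²E/r², so 3P ≤ 48 m²E/r² ≤ 96 (m²/r²) g.
  have h1 := h.advanced_time_le hlam.ne rfl (γ := 96)
    (fun s hs => by have := h.g_pos hlam hs; positivity) (fun s hs h4 => by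
    have hr := h.r_pos hs
    have hg := h.g_pos hlam hs
    have hen := h.energy_normalized hs
    have hw : m / r s < 1 / 4 := by rw [div_lt_iff₀ hr]; linarith
    have hw0 : 0 < m / r s := by positivity
    have hq0 : 0 ≤ 1 / 4 - (m / r s - 1 / 2) ^ 2 := by nlinarith
    have hq : 1 / 4 - (m / r s - 1 / 2) ^ 2 ≤ 3 / 16 := by nlinarith
    have hq2 : (1 / 4 - (m / r s - 1 / 2) ^ 2) ^ 2 ≤ 9 / 256 := by nlinarith
    have hg2 : 7 / 16 ≤ (g s / E) ^ 2 := by nlinarith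
    have hgE : 1 / 2 ≤ g s / E := by
      by_contra! hc
      have : 0 < g s / E := by positivity
      nlinarith
    rw [le_div_iff₀ hE] at hgE
    rw [div_lt_iff₀ (by positivity)] at hB
    have h5 : lam / (r s ^ 2 * (E + g s)) ≤ lam / (r s ^ 2 * E) := by
      have := h.lam_pos
      gcongr; linarith
    have h6 : lam / (r s ^ 2 * E) ≤ 16 * (m * E) ^ 2 / (r s ^ 2 * E) := by gcongr
    have h7 : 16 * (m * E) ^ 2 / (r s ^ 2 * E) = 16 * (m ^ 2 / r s ^ 2) * E := by field_simp
    have h8 : 0 < m ^ 2 / r s ^ 2 := by positivity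
    nlinarith)
  have hε : 0 < |1 - lam / (m * E) ^ 2 / 16| := by
    rw [abs_pos]
    linarith
  have h2 := h.arsinh_photonProduct_sub_le hε
  have h3 : 0 < m / r S := div_pos hm (h.r_pos (right_mem_Icc.mpr h.S_nonneg))
  refine h1.trans (mul_le_mul_of_nonneg_left ?_ hm.le)
  linarith

end RadialRay

end ERN

/-! ### Which energies and angular momenta arrive late. -/

namespace ERN

open Set Filter Topology

/-- The hypothesis says that ε is at most of order e^{-N}, which beats every power. The sixth power
suffices for the fastest decay rate required, that of T^{rr}; 1440 = 2 · 6!. -/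
lemma mul_pow_le_of_le_arsinh {ε N : ℝ} {k : ℕ} (hε : 0 < ε) (hε1 : ε ≤ 1) (hN : 0 < N)
    (h : N ≤ Real.arsinh (1 / (2 * ε))) (hk : k ≤ 6) : ε * N ^ k ≤ 1440 := by
  have h1 : Real.sinh N ≤ 1 / (2 * ε) := by
    rw [← Real.sinh_arsinh (1 / (2 * ε))]; exact Real.sinh_le_sinh.mpr h
  rcases le_total N 1 with hN1 | hN1
  · have : N ^ k ≤ 1 := pow_le_one₀ hN.le hN1
    nlinarith
  · have h2 : N ^ k ≤ N ^ 6 := pow_le_pow_right₀ hN1 hk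
    have h3 := Real.pow_div_factorial_le_exp N hN.le 6
    have h4 : N ^ 6 ≤ 720 * Real.exp N := by
      rw [div_le_iff₀ (by positivity)] at h3
      have h720 : ((Nat.factorial 6 : ℕ) : ℝ) = 720 := by norm_num [Nat.factorial]
      rw [h720] at h3
      linarith
    rw [Real.sinh_eq, div_le_div_iff₀ two_pos (by positivity)] at h1
    have h5 := Real.add_one_le_exp N
    have h6 : Real.exp (-N) ≤ 1 := Real.exp_le_one_iff.mpr (by linarith)
    have h7 : Real.exp N / 2 * ε ≤ (Real.exp N - Real.exp (-N)) * ε := by gcongr; linarith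
    calc ε * N ^ k ≤ ε * (720 * Real.exp N) := by gcongr; linarith
      _ ≤ 1440 := by linarith

namespace RadialRay

variable {m lam E S : ℝ} {r g T : ℝ → ℝ}

/-- E is the convex combination Ω² p^{t*} + (1 - Ω²) g. -/
lemma E_le_of_pT_le (h : RadialRay m lam E S r g T) {Cp : ℝ}
    (hpT : lam / (r S ^ 2 * (E + g S)) + g S ≤ Cp) (hpR : |g S| ≤ Cp) : E ≤ Cp := by
  have hS := right_mem_Icc.mpr h.S_nonneg
  have hr := h.r_pos hS; have hm := h.m_pos; have hmr := h.m_le_r hS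
  have h1 := h.P_mul_sq hS
  have h2 := (abs_le.mp hpR).2
  have h3 : (r S - m) ^ 2 ≤ r S ^ 2 := by nlinarith
  have h4 : (lam / (r S ^ 2 * (E + g S)) + g S) * (r S - m) ^ 2 ≤ Cp * (r S - m) ^ 2 := by gcongr
  have h5 : g S * (r S ^ 2 - (r S - m) ^ 2) ≤ Cp * (r S ^ 2 - (r S - m) ^ 2) :=
    mul_le_mul_of_nonneg_right h2 (by linarith)
  have h6 : E * r S ^ 2 ≤ Cp * r S ^ 2 := by nlinarith
  exact le_of_mul_le_mul_right h6 (by positivity)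

/-- With V for `virial`: V E = P (r - m)/m, while E - g ≤ 2E bounds V (r - m) by 8m as long as r ≤
2m. Multiplying gives the square. Thus a bounded momentum at the starting point and a large delay
force E to be of order (delay)⁻². -/
lemma virial_sq_le (h : RadialRay m lam E S r g T) (hr2 : r S ≤ 2 * m) :
    virial m lam E r g S ^ 2 * E ≤ 8 * (lam / (r S ^ 2 * (E + g S))) := by
  have hS := right_mem_Icc.mpr h.S_nonneg
  have hr := h.r_pos hS; have hm := h.m_pos; have hmr := h.m_le_r hS; have hE := h.E_pos
  have hg := h.E_add_g_pos hS
  have hP := h.P_pos hS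
  have hA := h.virial_nonneg hS
  have h1 : virial m lam E r g S * E = lam / (r S ^ 2 * (E + g S)) * (r S - m) / m := by
    unfold virial; field_simp
  have h2 := h.virial_eq hS
  have h3 : virial m lam E r g S * (m * (r S - m) / r S ^ 2) ≤ 2 := by
    have : virial m lam E r g S * (m * (r S - m) / r S ^ 2) * E ≤ 2 * E := by linarith
    exact le_of_mul_le_mul_right this hE
  have h4 : virial m lam E r g S * (r S - m) ≤ 8 * m := by
    have e : virial m lam E r g S * (m * (r S - m) / r S ^ 2)
      = virial m lam E r g S * (r S - m) * m / r S ^ 2 := by ring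
    rw [e, div_le_iff₀ (by positivity)] at h3
    have : r S ^ 2 ≤ 4 * m ^ 2 := by nlinarith
    have : virial m lam E r g S * (r S - m) * m ≤ 8 * m * m := by nlinarith
    exact le_of_mul_le_mul_right this hm
  have h5 : virial m lam E r g S ^ 2 * E
      = lam / (r S ^ 2 * (E + g S)) * (virial m lam E r g S * (r S - m)) / m := by
    rw [sq, mul_assoc, h1]; ring
  rw [h5, div_le_iff₀ hm]
  calc _ ≤ lam / (r S ^ 2 * (E + g S)) * (8 * m) := by gcongr
    _ = _ := by ring

lemma lam_le_of_P_le (h : RadialRay m lam E S r g T) (hr2 : r S ≤ 2 * m) {B : ℝ}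
    (hB : lam / (r S ^ 2 * (E + g S)) ≤ B) : lam ≤ 8 * B * E * m ^ 2 := by
  have hS := right_mem_Icc.mpr h.S_nonneg
  have hr := h.r_pos hS; have hm := h.m_pos; have hE := h.E_pos
  have hg := h.E_add_g_pos hS
  have hP := h.P_pos hS
  have hg2 := (abs_le.mp (h.abs_g_le hS)).2
  rw [div_le_iff₀ (by positivity)] at hB
  have hB0 : 0 < B := by
    by_contra! hc
    have := h.lam_pos
    have : B * (r S ^ 2 * (E + g S)) ≤ 0 := mul_nonpos_of_nonpos_of_nonneg hc (by positivity)
    linarith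
  have h1 : r S ^ 2 ≤ (2 * m) ^ 2 := by gcongr
  calc lam ≤ B * (r S ^ 2 * (E + g S)) := hB
    _ ≤ B * ((2 * m) ^ 2 * (E + E)) := by gcongr
    _ = _ := by ring

/-- Below the critical angular momentum g > 0, so E + g ≥ E, and 4m(r - m) ≤ r² does the rest. -/
lemma virial_le_four (h : RadialRay m lam E S r g T) (hlam : lam < 16 * (m * E) ^ 2) :
    virial m lam E r g S ≤ 4 := by
  have hS := right_mem_Icc.mpr h.S_nonneg
  have hr := h.r_pos hS; have hm := h.m_pos; have hE := h.E_pos; have hmr := h.m_le_r hS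
  have hg := h.g_pos hlam hS
  unfold virial
  rw [div_le_iff₀ (by positivity)]
  have h0 : 0 ≤ r S - m := by linarith
  have h1 : 4 * m * (r S - m) ≤ r S ^ 2 := by nlinarith [sq_nonneg (r S - 2 * m)]
  calc lam * (r S - m) ≤ 16 * (m * E) ^ 2 * (r S - m) := by gcongr
    _ = 4 * (m * E * E * (4 * m * (r S - m))) := by ring
    _ ≤ 4 * (m * E * E * r S ^ 2) := by gcongr
    _ ≤ 4 * (m * E * r S ^ 2 * (E + g S)) := by
      have : 0 ≤ m * E * r S ^ 2 * g S := by positivity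
      nlinarith

/-- A ray that starts in a bounded set of phase space and reaches the horizon at a late time either
has a small energy or is close to trapping at the photon sphere. -/
theorem late_arrival (h : RadialRay m lam E S r g T) {Cp Cr : ℝ}
    (hpT : lam / (r S ^ 2 * (E + g S)) + g S ≤ Cp) (hpR : |g S| ≤ Cp) (hr : r S ≤ Cr)
    (hT : T S ≤ 5 * Cr + 2 * m) (hτ : 110 * (m + Cr ^ 2 / m) < T 0) :
    E ≤ Cp ∧ ((E * ((T 0 - 110 * (m + Cr ^ 2 / m)) / m) ^ 2 ≤ 256 * Cp
        ∧ lam ≤ 16 * Cp * E * m ^ 2) ∨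
      (lam ≤ 256 / 9 * (m * E) ^ 2 ∧ ∀ k : ℕ, k ≤ 6 → |1 - lam / (m * E) ^ 2 / 16|
        * ((T 0 - 110 * (m + Cr ^ 2 / m)) / m) ^ k ≤ 1440 * 1216 ^ k)) := by
  have hS := right_mem_Icc.mpr h.S_nonneg
  have hm := h.m_pos; have hE := h.E_pos; have hmr := h.m_le_r hS
  have hA := h.virial_nonneg hS
  have hP : lam / (r S ^ 2 * (E + g S)) ≤ 2 * Cp := by linarith [(abs_le.mp hpR).1]
  have hECp := h.E_le_of_pT_le hpT hpR
  refine ⟨hECp, ?_⟩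
  set D := (T 0 - 110 * (m + Cr ^ 2 / m)) / m with hD
  have hD0 : 0 < D := div_pos (by linarith) hm
  have hTD : T 0 = m * D + 110 * (m + Cr ^ 2 / m) := by rw [hD]; field_simp; ring
  -- This lets 110 (m + Cr²/m) absorb the position and time of the starting point, `T S + r S ≤ 6 Cr
  -- + 2 m`, together with the constants 96 and 2 · 4 of the crossing case.
  have hCr : 2 * Cr ≤ m + Cr ^ 2 / m := by
    have : m + Cr ^ 2 / m - 2 * Cr = (m - Cr) ^ 2 / m := by field_simp; ring
    have : 0 ≤ (m - Cr) ^ 2 / m := by positivity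
    linarith
  have hCr' : 0 ≤ Cr ^ 2 / m := by positivity
  -- the trapped case follows once `arsinh` is bounded below
  have trapped : lam ≤ 256 / 9 * (m * E) ^ 2 → lam ≠ 16 * (m * E) ^ 2 →
      D / 1216 ≤ Real.arsinh (1 / (2 * |1 - lam / (m * E) ^ 2 / 16|)) →
      ∀ k : ℕ, k ≤ 6 → |1 - lam / (m * E) ^ 2 / 16| * D ^ k ≤ 1440 * 1216 ^ k := by
    intro hl hne hs k hk
    have hB : lam / (m * E) ^ 2 ≤ 256 / 9 := by rwa [div_le_iff₀ (by positivity)]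
    have hB0 : 0 < lam / (m * E) ^ 2 := by have := h.lam_pos; positivity
    have hne' : 1 - lam / (m * E) ^ 2 / 16 ≠ 0 := by
      intro h0
      apply hne
      have : lam / (m * E) ^ 2 = 16 := by linarith
      rwa [div_eq_iff (by positivity)] at this
    have := mul_pow_le_of_le_arsinh (abs_pos.mpr hne') (by rw [abs_le]; constructor <;> linarith)
      (by positivity) hs hk
    rw [div_pow, ← mul_div_assoc, div_le_iff₀ (by positivity)] at this
    exact this
  have small : r S ≤ 2 * m → D / 4 ≤ virial m lam E r g S →
      E * D ^ 2 ≤ 256 * Cp ∧ lam ≤ 16 * Cp * E * m ^ 2 := by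
    intro hr2 hV
    have h1 := h.virial_sq_le hr2
    have h2 := h.lam_le_of_P_le hr2 hP
    have h3 : (D / 4) ^ 2 ≤ virial m lam E r g S ^ 2 := by gcongr
    have h4 : (D / 4) ^ 2 * E ≤ virial m lam E r g S ^ 2 * E := by gcongr
    constructor <;> nlinarith
  rcases lt_trichotomy lam (16 * (m * E) ^ 2) with hl | hl | hl
  · have h1 := h.advanced_time_le_of_lam_lt hl
    have h2 := h.virial_le_four hl
    have hl' : lam ≤ 256 / 9 * (m * E) ^ 2 := by nlinarith [sq_nonneg (m * E)]
    refine Or.inr ⟨hl', trapped hl' hl.ne ?_⟩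
    set a := Real.arsinh (1 / (2 * |1 - lam / (m * E) ^ 2 / 16|))
    have h3 : m * D ≤ m * (608 * a) := by nlinarith
    have := le_of_mul_le_mul_left h3 hm
    linarith
  · refine Or.inr ⟨by rw [hl]; nlinarith [sq_nonneg (m * E)], fun k hk => ?_⟩
    have : lam / (m * E) ^ 2 = 16 := by rw [hl]; field_simp
    rw [this]; norm_num
  · have hr2 : r S ≤ 2 * m := (h.r_lt_two_mul hl hS).le
    rcases le_or_gt (256 / 9 * (m * E) ^ 2) lam with hl2 | hl2
    · have h1 := h.advanced_time_le_of_lam_ge hl2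
      refine Or.inl (small hr2 ?_)
      have h3 : m * D ≤ m * (2 * virial m lam E r g S) := by nlinarith
      have := le_of_mul_le_mul_left h3 hm
      linarith
    · have h1 := h.advanced_time_le_of_lam_gt hl
      set a := Real.arsinh (1 / (2 * |1 - lam / (m * E) ^ 2 / 16|))
      have h3 : m * D ≤ m * (2 * virial m lam E r g S + 608 * a) := by nlinarith
      have h4 := le_of_mul_le_mul_left h3 hm
      -- In D ≤ 2 virial + 608 a one of the two terms carries at least half of D; this is the origin
      -- of D/4 and of 1216 = 2 · 608.
      rcases le_or_gt (D / 4) (virial m lam E r g S) with hV | hV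
      · exact Or.inl (small hr2 hV)
      · exact Or.inr ⟨hl2.le, trapped hl2.le hl.ne' (by linarith)⟩

/-- Rays of small energy whose angular momentum is comparable to `E τ` start close to the horizon,
moving outwards. -/
theorem early_position (h : RadialRay m lam E S r g T) {L : ℝ} (hL : 0 < L) (hlam : lam = L ^ 2)
    (hTS : T S = 0) (hτ : 64 * m ≤ T 0) (hL1 : E * T 0 ≤ 8 * L) (hL2 : 4 * L ≤ E * T 0) :
    g S ≤ 0 ∧ 3 * r S ≤ 4 * m ∧ m ≤ T 0 * (m * (r S - m) / r S ^ 2) ∧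
      T 0 * (m * (r S - m) / r S ^ 2) ≤ 8 * m := by
  have hS := right_mem_Icc.mpr h.S_nonneg
  have hm := h.m_pos; have hE := h.E_pos; have hmr := h.m_le_r hS; have hr := h.r_pos hS
  have hA := h.virial_nonneg hS
  have hge : 8 * (m * E) ≤ L := by nlinarith
  have hl2 : 256 / 9 * (m * E) ^ 2 ≤ lam := by
    rw [hlam]; nlinarith [mul_pos hm hE]
  have h43 := h.r_lt_of_lam_ge hl2 hS
  have h1 := h.advanced_time_le_of_lam_ge hl2
  have h2 := h.virial_le
  rw [hTS] at h1 h2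
  have hq0 : 0 ≤ m * (r S - m) / r S ^ 2 := by
    have : 0 ≤ r S - m := by linarith
    positivity
  -- If g were positive, then L(r - m)/r² ≤ E would give m · virial ≤ L/E ≤ T 0/4, whereas the
  -- elapsed advanced time, about T 0, is at most 2m · virial.
  have hg : g S ≤ 0 := by
    by_contra! hc
    have h3 : L * (r S - m) / r S ^ 2 ≤ E := by
      have h4 := h.energy S hS
      have h5 : (L * (r S - m) / r S ^ 2) ^ 2 = lam * (r S - m) ^ 2 / r S ^ 4 := by
        rw [hlam]; ring
      refine le_of_sq_le_sq ?_ hE.le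
      rw [h5]; nlinarith [sq_nonneg (g S)]
    have h6 : m * virial m lam E r g S * E ≤ L := by
      have e : m * virial m lam E r g S * E = L * (L * (r S - m) / r S ^ 2) / (E + g S) := by
        unfold virial; rw [hlam]; field_simp
      rw [e, div_le_iff₀ (by linarith)]
      have : L * (L * (r S - m) / r S ^ 2) ≤ L * E := by gcongr
      nlinarith
    nlinarith
  refine ⟨hg, h43, ?_, ?_⟩
  -- An outgoing start means E ≤ E - g, so virial · q ≥ 1 with q = m(r - m)/r², while m · virial ≤ T
  -- 0.
  · have h3 := h.virial_eq hS
    have h4 : 1 ≤ virial m lam E r g S * (m * (r S - m) / r S ^ 2) := by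
      have : 1 * E ≤ virial m lam E r g S * (m * (r S - m) / r S ^ 2) * E := by linarith
      exact le_of_mul_le_mul_right this hE
    have h5 : m * virial m lam E r g S ≤ T 0 := by linarith
    calc m ≤ m * (virial m lam E r g S * (m * (r S - m) / r S ^ 2)) := by nlinarith
      _ = m * virial m lam E r g S * (m * (r S - m) / r S ^ 2) := by ring
      _ ≤ _ := by gcongr
  -- Conversely E - g ≤ 2E gives virial · q ≤ 2, while m · virial ≥ T 0/4.
  · have h3 := h.virial_eq hS
    have h6 := (abs_le.mp (h.abs_g_le hS)).1
    have h4 : virial m lam E r g S * (m * (r S - m) / r S ^ 2) ≤ 2 := by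
      have : virial m lam E r g S * (m * (r S - m) / r S ^ 2) * E ≤ 2 * E := by linarith
      exact le_of_mul_le_mul_right this hE
    have h5 : T 0 / 4 ≤ m * virial m lam E r g S := by linarith
    have h7 : T 0 / 4 * (m * (r S - m) / r S ^ 2)
        ≤ m * virial m lam E r g S * (m * (r S - m) / r S ^ 2) := by gcongr
    nlinarith

end RadialRay

end ERN

namespace ERN

open Set Filter Topology

/-! ### Flows of bounded Lipschitz vector fields -/

section BoundedLipschitz

variable {E F G : Type*} [NormedAddCommGroup E] [NormedAddCommGroup F] [NormedAddCommGroup G]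

/-- Bounded Lipschitz maps. -/
def IsBddLip (f : E → F) : Prop :=
  ∃ C : ℝ, (∀ x y, ‖f x - f y‖ ≤ C * ‖x - y‖) ∧ ∀ x, ‖f x‖ ≤ C

lemma IsBddLip.add {f g : E → F} (hf : IsBddLip f) (hg : IsBddLip g) :
    IsBddLip fun x => f x + g x := by
  obtain ⟨C, h1, h2⟩ := hf
  obtain ⟨D, h3, h4⟩ := hg
  refine ⟨C + D, fun x y => ?_, fun x => (norm_add_le _ _).trans (add_le_add (h2 x) (h4 x))⟩
  calc ‖f x + g x - (f y + g y)‖ = ‖(f x - f y) + (g x - g y)‖ := by congr 1; abel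
    _ ≤ ‖f x - f y‖ + ‖g x - g y‖ := norm_add_le _ _
    _ ≤ C * ‖x - y‖ + D * ‖x - y‖ := add_le_add (h1 x y) (h3 x y)
    _ = (C + D) * ‖x - y‖ := by ring

lemma IsBddLip.smul [NormedSpace ℝ F] {f : E → ℝ} {g : E → F} (hf : IsBddLip f) (hg : IsBddLip g) :
    IsBddLip fun x => f x • g x := by
  obtain ⟨C, h1, h2⟩ := hf
  obtain ⟨D, h3, h4⟩ := hg
  have hC : 0 ≤ C := (norm_nonneg _).trans (h2 0)
  have hD : 0 ≤ D := (norm_nonneg _).trans (h4 0)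
  refine ⟨2 * (C * D), fun x y => ?_, fun x => ?_⟩
  · calc ‖f x • g x - f y • g y‖ = ‖f x • (g x - g y) + (f x - f y) • g y‖ := by
          congr 1; rw [smul_sub, sub_smul]; abel
      _ ≤ ‖f x‖ * ‖g x - g y‖ + ‖f x - f y‖ * ‖g y‖ := by
          rw [← norm_smul, ← norm_smul]; exact norm_add_le _ _
      _ ≤ C * (D * ‖x - y‖) + C * ‖x - y‖ * D := by
          gcongr
          exacts [h2 x, h3 x y, h1 x y, h4 y]
      _ = 2 * (C * D) * ‖x - y‖ := by ring
  · rw [norm_smul]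
    have : ‖f x‖ * ‖g x‖ ≤ C * D := by gcongr; exacts [h2 x, h4 x]
    nlinarith [mul_nonneg hC hD]

lemma IsBddLip.const (c : F) : IsBddLip fun _ : E => c :=
  ⟨‖c‖, fun x y => by simpa using by positivity, fun _ => le_rfl⟩

lemma IsBddLip.comp {f : F → G} (hf : IsBddLip f) {g : E → F}
    (hg : ∀ x y, ‖g x - g y‖ ≤ ‖x - y‖) : IsBddLip fun x => f (g x) := by
  obtain ⟨C, h1, h2⟩ := hf
  have hC : 0 ≤ C := (norm_nonneg _).trans (h2 0)
  exact ⟨C, fun x y => (h1 _ _).trans (by gcongr; exact hg x y), fun x => h2 _⟩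

lemma IsBddLip.prodMk {f : E → F} {g : E → G} (hf : IsBddLip f) (hg : IsBddLip g) :
    IsBddLip fun x => (f x, g x) := by
  obtain ⟨C, h1, h2⟩ := hf
  obtain ⟨D, h3, h4⟩ := hg
  refine ⟨max C D, fun x y => ?_, fun x => ?_⟩
  · rw [Prod.mk_sub_mk, Prod.norm_mk, max_mul_of_nonneg _ _ (norm_nonneg _)]
    exact max_le_max (h1 x y) (h3 x y)
  · rw [Prod.norm_mk]
    exact max_le_max (h2 x) (h4 x)

lemma abs_inv_max_norm_sub_le {c : ℝ} (hc : 0 < c) (x y : E) :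
    |(max c ‖x‖)⁻¹ - (max c ‖y‖)⁻¹| ≤ (max c ‖x‖)⁻¹ * (max c ‖y‖)⁻¹ * ‖x - y‖ := by
  have hx : 0 < max c ‖x‖ := lt_max_of_lt_left hc
  have hy : 0 < max c ‖y‖ := lt_max_of_lt_left hc
  rw [inv_sub_inv hx.ne' hy.ne', abs_div, abs_of_pos (mul_pos hx hy), ← mul_inv,
    inv_mul_eq_div]
  gcongr
  calc |max c ‖y‖ - max c ‖x‖| ≤ max |c - c| |‖y‖ - ‖x‖| := abs_max_sub_max_le_max _ _ _ _
    _ ≤ ‖x - y‖ := by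
      rw [sub_self, abs_zero, norm_sub_rev x y]
      exact max_le (norm_nonneg _) (abs_norm_sub_norm_le _ _)

lemma isBddLip_inv_max_norm {c : ℝ} (hc : 0 < c) : IsBddLip fun x : E => (max c ‖x‖)⁻¹ := by
  have hb : ∀ x : E, (max c ‖x‖)⁻¹ ≤ c⁻¹ := fun x => by gcongr; exact le_max_left _ _
  have h0 : ∀ x : E, 0 ≤ (max c ‖x‖)⁻¹ := fun x =>
    (inv_pos.mpr (lt_max_of_lt_left hc)).le
  refine ⟨max (c⁻¹ * c⁻¹) c⁻¹, fun x y => ?_, fun x => ?_⟩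
  · refine (abs_inv_max_norm_sub_le hc x y).trans ?_
    gcongr
    exact (mul_le_mul (hb x) (hb y) (h0 y) (by positivity)).trans (le_max_left _ _)
  · rw [Real.norm_eq_abs, abs_of_nonneg (h0 x)]
    exact (hb x).trans (le_max_right _ _)

/-- The radial retraction onto the ball of radius `c`, divided by `c`. -/
lemma isBddLip_retraction [NormedSpace ℝ E] {c : ℝ} (hc : 0 < c) : IsBddLip fun x : E => (max c ‖x‖)⁻¹ • x := by
  have h0 : ∀ x : E, 0 < max c ‖x‖ := fun x => lt_max_of_lt_left hc
  have h1 : ∀ x : E, (max c ‖x‖)⁻¹ * ‖x‖ ≤ 1 := fun x => by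
    rw [inv_mul_le_one₀ (h0 x)]; exact le_max_right _ _
  refine ⟨max (2 * c⁻¹) 1, fun x y => ?_, fun x => ?_⟩
  · refine le_trans ?_ (mul_le_mul_of_nonneg_right (le_max_left _ _) (norm_nonneg _))
    calc ‖(max c ‖x‖)⁻¹ • x - (max c ‖y‖)⁻¹ • y‖
        = ‖(max c ‖x‖)⁻¹ • (x - y) + ((max c ‖x‖)⁻¹ - (max c ‖y‖)⁻¹) • y‖ := by
          congr 1; rw [smul_sub, sub_smul]; abel
      _ ≤ (max c ‖x‖)⁻¹ * ‖x - y‖ + |(max c ‖x‖)⁻¹ - (max c ‖y‖)⁻¹| * ‖y‖ := by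
          refine (norm_add_le _ _).trans (le_of_eq ?_)
          rw [norm_smul, norm_smul, Real.norm_eq_abs, Real.norm_eq_abs,
            abs_of_pos (inv_pos.mpr (h0 x))]
      _ ≤ (max c ‖x‖)⁻¹ * ‖x - y‖
          + (max c ‖x‖)⁻¹ * (max c ‖y‖)⁻¹ * ‖x - y‖ * ‖y‖ := by
          gcongr; exact abs_inv_max_norm_sub_le hc x y
      _ = (max c ‖x‖)⁻¹ * ‖x - y‖ * (1 + (max c ‖y‖)⁻¹ * ‖y‖) := by ring
      _ ≤ c⁻¹ * ‖x - y‖ * (1 + 1) := by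
          gcongr
          exacts [le_max_left _ _, h1 y]
      _ = 2 * c⁻¹ * ‖x - y‖ := by ring
  · rw [norm_smul, Real.norm_eq_abs, abs_of_pos (inv_pos.mpr (h0 x))]
    exact (h1 x).trans (le_max_right _ _)

/-- Bounded Lipschitz vector fields have flows over arbitrarily long times. -/
theorem IsBddLip.exists_flow [NormedSpace ℝ E] [CompleteSpace E] {X : E → E} (hX : IsBddLip X) (x₀ : E) {S : ℝ}
    (hS : 0 ≤ S) :
    ∃ α : E × ℝ → E, (∀ x ∈ Metric.closedBall x₀ 1, α ⟨x, 0⟩ = x ∧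
      ∀ t ∈ Icc 0 S, HasDerivWithinAt (α ⟨x, ·⟩) (X (α ⟨x, t⟩)) (Icc 0 S) t) ∧
      ContinuousOn α (Metric.closedBall x₀ 1 ×ˢ Icc 0 S) := by
  obtain ⟨C, h1, h2⟩ := hX
  have hC : 0 ≤ C := (norm_nonneg _).trans (h2 0)
  lift C to NNReal using hC
  lift S to NNReal using hS
  have hlip : LipschitzWith C X := LipschitzWith.of_dist_le_mul fun x y => by
    rw [dist_eq_norm, dist_eq_norm]; exact h1 x y
  -- A field bounded by C moves points by at most C S, so the ball of radius C S + 1 contains every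
  -- solution starting in the unit ball.
  have hpl : IsPicardLindelof (fun _ => X) (⟨0, le_rfl, S.2⟩ : Icc (0 : ℝ) S) x₀
      (C * S + 1) 1 C C :=
    { lipschitzOnWith := fun t _ => hlip.lipschitzOnWith
      continuousOn := fun x _ => continuousOn_const
      norm_le := fun t _ x _ => h2 x
      mul_max_le := by simp }
  exact hpl.exists_forall_mem_closedBall_eq_hasDerivWithinAt_continuousOn

end BoundedLipschitz

/-! ### Motion under the central force -/

/-- The coefficient of the central force, continued as a bounded function to `r < m`. -/
def centralCoeff (m : ℝ) (y : E3) : ℝ :=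
  2 * m ^ 2 / (max m ‖y‖) ^ 6 - 3 * m / (max m ‖y‖) ^ 5

/-- The squared angular momentum. -/
def angMomSq (y u : E3) : ℝ := ‖y‖ ^ 2 * ‖u‖ ^ 2 - inner ℝ y u ^ 2

/-- Each factor 1/max(m, ‖y‖) is bounded Lipschitz, and so is y/max(m, ‖y‖); the force is a
polynomial in the former times the latter. -/
lemma isBddLip_centralForce {m : ℝ} (hm : 0 < m) :
    IsBddLip fun y : E3 => centralCoeff m y • y := by
  have hi := isBddLip_inv_max_norm (E := E3) hm
  have hr := isBddLip_retraction (E := E3) hm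
  have h2 := hi.smul hi
  have h4 := h2.smul h2
  have h5 := hi.smul h4
  have h := (((IsBddLip.const (E := E3) (2 * m ^ 2)).smul h5).add
    ((IsBddLip.const (E := E3) (-3 * m)).smul h4)).smul hr
  convert h using 2 with y
  rw [smul_smul]
  congr 1
  have : 0 < max m ‖y‖ := lt_max_of_lt_left hm
  simp only [centralCoeff, smul_eq_mul]
  field_simp
  ring

/-- Motion from `y₀` with initial velocity `u₀` under the central force. -/
structure IsCentralCurve (m S : ℝ) (y₀ u₀ : E3) (Y W : ℝ → E3) : Prop where
  Y_zero : Y 0 = y₀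
  W_zero : W 0 = u₀
  deriv_Y : ∀ s ∈ Icc 0 S, HasDerivWithinAt Y (W s) (Icc 0 S) s
  deriv_W : ∀ s ∈ Icc 0 S, HasDerivWithinAt W
    ((angMomSq y₀ u₀ * centralCoeff m (Y s)) • Y s) (Icc 0 S) s

/-- The force depends on the initial velocity through the angular momentum, which is therefore
carried along as a state variable with zero derivative. The field is made bounded and Lipschitz by
radial truncations of velocity and angular momentum, which a priori bounds then show to be inactive.
-/
theorem exists_centralCurves {m : ℝ} (hm : 0 < m) (y₀ u₀ : E3) {S : ℝ} (hS : 0 ≤ S) :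
    ∃ U ∈ 𝓝 u₀, ∃ Y W : E3 → ℝ → E3,
      (∀ u ∈ U, IsCentralCurve m S y₀ u (Y u) (W u)) ∧
      ContinuousOn (fun p : E3 × ℝ => Y p.1 p.2) (U ×ˢ Icc 0 S) ∧
      ContinuousOn (fun p : E3 × ℝ => W p.1 p.2) (U ×ˢ Icc 0 S) := by
  obtain ⟨C, hC1, hC2⟩ := isBddLip_centralForce hm
  have hC0 : 0 ≤ C := (norm_nonneg _).trans (hC2 0)
  set Λ : ℝ := |angMomSq y₀ u₀| + 1 with hΛ
  have hΛ0 : 0 < Λ := by positivity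
  -- An a priori bound for the speed up to parameter S: initial speed at most `‖u₀‖ + 1`,
  -- acceleration at most Λ C.
  set M : ℝ := ‖u₀‖ + 1 + Λ * C * S with hM
  have hM0 : 0 < M := by positivity
  have h1 : IsBddLip fun x : ℝ × E3 × E3 => M • ((max M ‖x.2.2‖)⁻¹ • x.2.2) :=
    (IsBddLip.const M).smul ((isBddLip_retraction (E := E3) hM0).comp
      fun x y => (norm_snd_le (x - y).2).trans (norm_snd_le (x - y)))
  have h2 : IsBddLip fun x : ℝ × E3 × E3 =>
      (Λ • ((max Λ ‖x.1‖)⁻¹ • x.1)) • (centralCoeff m x.2.1 • x.2.1) :=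
    ((IsBddLip.const Λ).smul ((isBddLip_retraction (E := ℝ) hΛ0).comp
      fun x y => norm_fst_le (x - y))).smul ((isBddLip_centralForce hm).comp
      fun x y => (norm_fst_le (x - y).2).trans (norm_snd_le (x - y)))
  have hX := (IsBddLip.const (E := ℝ × E3 × E3) (0 : ℝ)).prodMk (h1.prodMk h2)
  obtain ⟨α, hα, hαc⟩ := hX.exists_flow (angMomSq y₀ u₀, y₀, u₀) hS
  have hι : Continuous fun u : E3 => (angMomSq y₀ u, y₀, u) := by
    unfold angMomSq; fun_prop
  set U : Set E3 := {u | (angMomSq y₀ u, y₀, u) ∈ Metric.closedBall (angMomSq y₀ u₀, y₀, u₀) 1}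
    with hU
  have hUn : U ∈ 𝓝 u₀ := hι.continuousAt.preimage_mem_nhds (Metric.closedBall_mem_nhds _ one_pos)
  have hαc' : ContinuousOn (fun p : E3 × ℝ => α ((angMomSq y₀ p.1, y₀, p.1), p.2))
      (U ×ˢ Icc 0 S) :=
    hαc.comp ((hι.comp continuous_fst).prodMk continuous_snd).continuousOn
      fun p hp => ⟨hp.1, hp.2⟩
  refine ⟨U, hUn, fun u s => (α ((angMomSq y₀ u, y₀, u), s)).2.1,
    fun u s => (α ((angMomSq y₀ u, y₀, u), s)).2.2, fun u hu => ?_,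
    (continuous_fst.comp continuous_snd).comp_continuousOn hαc',
    (continuous_snd.comp continuous_snd).comp_continuousOn hαc'⟩
  obtain ⟨h0, hd⟩ := hα _ hu
  set β : ℝ → ℝ × E3 × E3 := fun s => α ((angMomSq y₀ u, y₀, u), s) with hβ
  have hd1 : ∀ s ∈ Icc 0 S, HasDerivWithinAt (fun s => (β s).1) 0 (Icc 0 S) s :=
    fun s hs => (hd s hs).fst
  have hd2 : ∀ s ∈ Icc 0 S, HasDerivWithinAt (fun s => (β s).2.1)
      (M • ((max M ‖(β s).2.2‖)⁻¹ • (β s).2.2)) (Icc 0 S) s := fun s hs => (hd s hs).snd.fst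
  have hd3 : ∀ s ∈ Icc 0 S, HasDerivWithinAt (fun s => (β s).2.2)
      ((Λ • ((max Λ ‖(β s).1‖)⁻¹ • (β s).1)) • (centralCoeff m (β s).2.1 • (β s).2.1))
      (Icc 0 S) s := fun s hs => (hd s hs).snd.snd
  have hβ0 : β 0 = (angMomSq y₀ u, y₀, u) := h0
  have hdist : dist (angMomSq y₀ u, y₀, u) (angMomSq y₀ u₀, y₀, u₀) ≤ 1 := hu
  rw [Prod.dist_eq, Prod.dist_eq] at hdist
  have hΛu : |angMomSq y₀ u| ≤ Λ := by
    have : |angMomSq y₀ u - angMomSq y₀ u₀| ≤ 1 := (le_max_left _ _).trans hdist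
    have := abs_sub_abs_le_abs_sub (angMomSq y₀ u) (angMomSq y₀ u₀)
    rw [hΛ]; linarith
  have hu1 : ‖u‖ ≤ ‖u₀‖ + 1 := by
    have : dist u u₀ ≤ 1 := (le_max_right _ _).trans ((le_max_right _ _).trans hdist)
    rw [dist_eq_norm] at this
    linarith [norm_sub_norm_le u u₀]
  have hlam : ∀ s ∈ Icc 0 S, (β s).1 = angMomSq y₀ u := by
    intro s hs
    have := norm_image_sub_le_of_norm_deriv_le_segment' hd1 (C := 0) (fun x _ => by simp) s hs
    rw [zero_mul, norm_le_zero_iff, sub_eq_zero, hβ0] at this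
    exact this
  have hclΛ : ∀ x : ℝ, ‖Λ • ((max Λ ‖x‖)⁻¹ • x)‖ ≤ Λ := by
    intro x
    have hp : 0 < max Λ ‖x‖ := lt_max_of_lt_left hΛ0
    rw [norm_smul, norm_smul, Real.norm_eq_abs, abs_of_pos hΛ0, norm_inv, Real.norm_eq_abs,
      abs_of_pos hp]
    have : (max Λ ‖x‖)⁻¹ * ‖x‖ ≤ 1 := by
      rw [inv_mul_le_one₀ hp]; exact le_max_right _ _
    nlinarith
  have hW : ∀ s ∈ Icc 0 S, ‖(β s).2.2‖ ≤ M := by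
    intro s hs
    have h3 := norm_image_sub_le_of_norm_deriv_le_segment' hd3 (C := Λ * C) (fun x _ => by
      rw [norm_smul]
      exact mul_le_mul (hclΛ _) (hC2 _) (norm_nonneg _) hΛ0.le) s hs
    rw [hβ0, sub_zero] at h3
    have h4 : Λ * C * s ≤ Λ * C * S := by gcongr; exact hs.2
    have h5 : ‖(β s).2.2‖ ≤ ‖u‖ + ‖(β s).2.2 - u‖ := norm_le_insert' _ _
    linarith
  refine ⟨congrArg (fun x => x.2.1) hβ0, congrArg (fun x => x.2.2) hβ0, fun s hs => (hd2 s hs).congr_deriv ?_,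
    fun s hs => (hd3 s hs).congr_deriv ?_⟩
  · rw [max_eq_left (hW s hs), smul_inv_smul₀ hM0.ne']
  · rw [hlam s hs, Real.norm_eq_abs, max_eq_left hΛu, smul_inv_smul₀ hΛ0.ne', smul_smul]

end ERN

namespace ERN

open Set Filter Topology

/-! ### Null geodesics traced back from the horizon -/

/-- The radial velocity of the position `y` with velocity `u`. -/
def radialVel (y u : E3) : ℝ := inner ℝ y u / ‖y‖

/-- `p^{t*} + p^r` for a ray of energy `E` and squared angular momentum `lam`, in terms of the position
and the reversed velocity. -/
def advancedRate (lam E : ℝ) (y u : E3) : ℝ := lam / (‖y‖ ^ 2 * (E + radialVel y u))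

lemma norm_sq_eq_of_angMomSq {y u : E3} (hy : y ≠ 0) :
    ‖u‖ ^ 2 = (inner ℝ y u / ‖y‖) ^ 2 + angMomSq y u / ‖y‖ ^ 2 := by
  have : ‖y‖ ≠ 0 := norm_ne_zero_iff.mpr hy
  unfold angMomSq
  field_simp
  ring

/-- A null geodesic traced back from the horizon; `Z s` is its point at backward parameter `s`. -/
structure BackRay (m lam E S : ℝ) (Z : ℝ → Phase) : Prop where
  radial : RadialRay m lam E S (fun s => radius (Z s).1) (fun s => -pR (Z s).1 (Z s).2)
    (fun s => tStar (Z s).1)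
  geodesic : IsNullGeodesic m (fun s => (Z (-s)).1) (fun s => (Z (-s)).2) (-S) 0
  pT_eq : ∀ s ∈ Icc 0 S, pT (Z s).2
    = lam / (radius (Z s).1 ^ 2 * (E + -pR (Z s).1 (Z s).2)) + -pR (Z s).1 (Z s).2
  norm_pAng : ∀ s ∈ Icc 0 S, ‖pAng (Z s).1 (Z s).2‖ ^ 2 * radius (Z s).1 ^ 2 = lam

namespace IsCentralCurve

variable {m S : ℝ} {y₀ u₀ : E3} {Y W : ℝ → E3}

lemma mono (h : IsCentralCurve m S y₀ u₀ Y W) {S' : ℝ} (hS : S' ≤ S) :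
    IsCentralCurve m S' y₀ u₀ Y W where
  Y_zero := h.Y_zero
  W_zero := h.W_zero
  deriv_Y s hs := (h.deriv_Y s ⟨hs.1, hs.2.trans hS⟩).mono (Icc_subset_Icc_right hS)
  deriv_W s hs := (h.deriv_W s ⟨hs.1, hs.2.trans hS⟩).mono (Icc_subset_Icc_right hS)

/-- The force is central, also in its continuation to r < m; no condition on the radius is needed.
-/
lemma angMomSq_eq (h : IsCentralCurve m S y₀ u₀ Y W) {s : ℝ} (hs : s ∈ Icc 0 S) :
    angMomSq (Y s) (W s) = angMomSq y₀ u₀ := by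
  have hd : ∀ s ∈ Icc 0 S, HasDerivWithinAt (fun s => angMomSq (Y s) (W s)) 0 (Icc 0 S) s := by
    intro s hs
    have h1 := h.deriv_Y s hs
    have h2 := h.deriv_W s hs
    have h3 := ((h1.norm_sq).mul (h2.norm_sq)).sub ((h1.inner ℝ h2).pow 2)
    refine h3.congr_deriv ?_
    simp only [real_inner_smul_right, real_inner_self_eq_norm_sq, real_inner_comm (Y s) (W s)]
    push_cast
    ring
  have := norm_image_sub_le_of_norm_deriv_le_segment' hd (C := 0) (fun x _ => by simp) s hs
  rw [zero_mul, norm_le_zero_iff, sub_eq_zero, h.Y_zero, h.W_zero] at this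
  exact this

lemma deriv_W' (h : IsCentralCurve m S y₀ u₀ Y W) {s : ℝ} (hs : s ∈ Icc 0 S) (hr : m ≤ ‖Y s‖) :
    HasDerivWithinAt W ((angMomSq y₀ u₀ * (2 * m ^ 2 / ‖Y s‖ ^ 6 - 3 * m / ‖Y s‖ ^ 5)) • Y s)
      (Icc 0 S) s := by
  have := h.deriv_W s hs
  rwa [centralCoeff, max_eq_right hr] at this

lemma norm_W_sq (h : IsCentralCurve m S y₀ u₀ Y W) (hm : 0 < m) {s : ℝ} (hs : s ∈ Icc 0 S)
    (hr : m ≤ ‖Y s‖) :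
    ‖W s‖ ^ 2 = (inner ℝ (Y s) (W s) / ‖Y s‖) ^ 2 + angMomSq y₀ u₀ / ‖Y s‖ ^ 2 := by
  rw [← h.angMomSq_eq hs]
  exact norm_sq_eq_of_angMomSq (norm_pos_iff.mp (hm.trans_le hr))

lemma energy (h : IsCentralCurve m S y₀ u₀ Y W) (hm : 0 < m) (hy₀ : ‖y₀‖ = m)
    (hr : ∀ s ∈ Icc 0 S, m ≤ ‖Y s‖) {s : ℝ} (hs : s ∈ Icc 0 S) :
    radialVel (Y s) (W s) ^ 2 + angMomSq y₀ u₀ * (‖Y s‖ - m) ^ 2 / ‖Y s‖ ^ 4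
      = radialVel y₀ u₀ ^ 2 := by
  have hd : ∀ s ∈ Icc 0 S, HasDerivWithinAt (fun s => radialVel (Y s) (W s) ^ 2
      + angMomSq y₀ u₀ * (‖Y s‖ - m) ^ 2 / ‖Y s‖ ^ 4) 0 (Icc 0 S) s := by
    intro s hs
    have h0 : 0 < ‖Y s‖ := hm.trans_le (hr s hs)
    have hne : Y s ≠ 0 := norm_pos_iff.mp h0
    have h1 := hasDerivWithinAt_norm_of_ne hne (h.deriv_Y s hs)
    have h2 := hasDerivWithinAt_radial_velocity hne (h.deriv_Y s hs) (h.deriv_W' hs (hr s hs))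
      (h.norm_W_sq hm hs (hr s hs))
    have h3 := (h2.pow 2).add ((((h1.sub_const m).pow 2).const_mul (angMomSq y₀ u₀)).div
      (h1.pow 4) (pow_pos h0 4).ne')
    refine h3.congr_deriv ?_
    simp only [Pi.pow_apply]
    generalize inner ℝ (Y s) (W s) / ‖Y s‖ = ν
    generalize ‖Y s‖ = r at *
    push_cast
    field_simp
    ring
  have := norm_image_sub_le_of_norm_deriv_le_segment' hd (C := 0) (fun x _ => by simp) s hs
  rw [zero_mul, norm_le_zero_iff, sub_eq_zero, h.Y_zero, h.W_zero, hy₀] at this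
  rw [this]; simp

lemma lt_of_Ioc (h : IsCentralCurve m S y₀ u₀ Y W) (hy₀ : ‖y₀‖ = m)
    (hlt : ∀ s ∈ Ioc 0 S, m < ‖Y s‖) {s : ℝ} (hs : s ∈ Icc 0 S) : m ≤ ‖Y s‖ := by
  rcases hs.1.eq_or_lt with h0 | h0
  · rw [← h0, h.Y_zero, hy₀]
  · exact (hlt s ⟨h0, hs.2⟩).le

lemma E_add_radialVel_pos (h : IsCentralCurve m S y₀ u₀ Y W) (hm : 0 < m) (hy₀ : ‖y₀‖ = m)
    (hE : 0 < radialVel y₀ u₀) (hlam : 0 < angMomSq y₀ u₀)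
    (hlt : ∀ s ∈ Ioc 0 S, m < ‖Y s‖) {s : ℝ} (hs : s ∈ Icc 0 S) :
    0 < radialVel y₀ u₀ + radialVel (Y s) (W s) := by
  rcases hs.1.eq_or_lt with h0 | h0
  · rw [← h0, h.Y_zero, h.W_zero]; linarith
  · have h1 := h.energy hm hy₀ (fun s hs => h.lt_of_Ioc hy₀ hlt hs) hs
    have h2 := hlt s ⟨h0, hs.2⟩
    have h3 : 0 < angMomSq y₀ u₀ * (‖Y s‖ - m) ^ 2 / ‖Y s‖ ^ 4 := by
      have : 0 < ‖Y s‖ := by linarith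
      have : 0 < ‖Y s‖ - m := by linarith
      positivity
    have h4 := (abs_lt.mp (abs_lt_of_sq_lt_sq
      (show radialVel (Y s) (W s) ^ 2 < radialVel y₀ u₀ ^ 2 by linarith) hE.le)).1
    linarith

lemma radialRay (h : IsCentralCurve m S y₀ u₀ Y W) (hm : 0 < m) (hS : 0 ≤ S) (hy₀ : ‖y₀‖ = m)
    (hE : 0 < radialVel y₀ u₀) (hlam : 0 < angMomSq y₀ u₀)
    (hlt : ∀ s ∈ Ioc 0 S, m < ‖Y s‖) {T : ℝ → ℝ}
    (hT : ∀ s ∈ Icc 0 S, HasDerivWithinAt T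
      (-(advancedRate (angMomSq y₀ u₀) (radialVel y₀ u₀) (Y s) (W s) + radialVel (Y s) (W s)))
      (Icc 0 S) s) :
    RadialRay m (angMomSq y₀ u₀) (radialVel y₀ u₀) S (fun s => ‖Y s‖)
      (fun s => radialVel (Y s) (W s)) T := by
  have hr : ∀ s ∈ Icc 0 S, m ≤ ‖Y s‖ := fun s hs => h.lt_of_Ioc hy₀ hlt hs
  have hne : ∀ s ∈ Icc 0 S, Y s ≠ 0 := fun s hs => norm_pos_iff.mp (hm.trans_le (hr s hs))
  exact
  { m_pos := hm
    lam_pos := hlam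
    E_pos := hE
    S_nonneg := hS
    r_zero := by rw [h.Y_zero, hy₀]
    g_zero := by rw [h.Y_zero, h.W_zero]
    lt_r := hlt
    deriv_r := fun s hs => hasDerivWithinAt_norm_of_ne (hne s hs) (h.deriv_Y s hs)
    deriv_g := fun s hs => hasDerivWithinAt_radial_velocity (hne s hs) (h.deriv_Y s hs)
      (h.deriv_W' hs (hr s hs)) (h.norm_W_sq hm hs (hr s hs))
    deriv_T := hT
    energy := fun s hs => h.energy hm hy₀ hr hs }

lemma _root_.ERN.hasDerivWithinAt_comp_neg {F : Type*} [NormedAddCommGroup F] [NormedSpace ℝ F]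
    {f : ℝ → F} {f' : F} {S s : ℝ} (hf : HasDerivWithinAt f f' (Icc 0 S) (-s)) :
    HasDerivWithinAt (fun s => f (-s)) (-f') (Icc (-S) 0) s := by
  have := hf.scomp s (hasDerivWithinAt_neg s (Icc (-S) 0))
    (fun x hx => ⟨by linarith [hx.2], by linarith [hx.1]⟩)
  rw [neg_one_smul] at this
  exact this

/-- The central curve runs backwards in time, hence momentum -W. Reversing the parameter as well
restores a future-directed curve, and the force law is invariant under this reversal. -/
theorem backRay (h : IsCentralCurve m S y₀ u₀ Y W) (hm : 0 < m) (hS : 0 ≤ S) (hy₀ : ‖y₀‖ = m)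
    (hE : 0 < radialVel y₀ u₀) (hlam : 0 < angMomSq y₀ u₀)
    (hlt : ∀ s ∈ Ioc 0 S, m < ‖Y s‖) {T : ℝ → ℝ}
    (hT : ∀ s ∈ Icc 0 S, HasDerivWithinAt T
      (-(advancedRate (angMomSq y₀ u₀) (radialVel y₀ u₀) (Y s) (W s) + radialVel (Y s) (W s)))
      (Icc 0 S) s) :
    BackRay m (angMomSq y₀ u₀) (radialVel y₀ u₀) S (fun s => ((T s, Y s),
      (advancedRate (angMomSq y₀ u₀) (radialVel y₀ u₀) (Y s) (W s) + radialVel (Y s) (W s),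
        -W s))) := by
  have hray := h.radialRay hm hS hy₀ hE hlam hlt hT
  have hr : ∀ s ∈ Icc 0 S, m ≤ ‖Y s‖ := fun s hs => h.lt_of_Ioc hy₀ hlt hs
  have hpR : ∀ s, -pR (T s, Y s) (advancedRate (angMomSq y₀ u₀) (radialVel y₀ u₀) (Y s) (W s)
      + radialVel (Y s) (W s), -W s) = radialVel (Y s) (W s) := fun s => by
    simp [pR, radialVel, inner_neg_right, neg_div]
  have hneg : ∀ s ∈ Icc (-S) 0, -s ∈ Icc 0 S := fun s hs =>
    ⟨by linarith [hs.2], by linarith [hs.1]⟩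
  refine ⟨?_, ?_, fun s hs => ?_, fun s hs => ?_⟩
  · simp only [hpR]; exact hray
  · have := isNullGeodesic_of_reduced (m := m) (E := radialVel y₀ u₀) (lam := angMomSq y₀ u₀)
      (a := -S) (b := 0) hm (t := fun s => T (-s)) (y := fun s => Y (-s)) (u := fun s => -W (-s))
      (fun s hs => hr _ (hneg s hs))
      (fun s hs => hasDerivWithinAt_comp_neg (h.deriv_Y _ (hneg s hs)))
      (fun s hs => by
        have := (hasDerivWithinAt_comp_neg (h.deriv_W' (hneg s hs) (hr _ (hneg s hs)))).neg
        rwa [neg_neg] at this)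
      (fun s hs => by
        have := h.norm_W_sq hm (hneg s hs) (hr _ (hneg s hs))
        rwa [norm_neg, inner_neg_right, neg_div, neg_sq])
      (fun s hs => by
        have := h.energy hm hy₀ hr (hneg s hs)
        rwa [inner_neg_right, neg_div, neg_sq])
      (fun s hs => by
        have := hray.E_add_g_pos (hneg s hs)
        rwa [inner_neg_right, neg_div, sub_neg_eq_add])
      (fun s hs => by
        have := hray.E_le_pT (hneg s hs)
        rw [inner_neg_right, neg_div, sub_neg_eq_add, sub_neg_eq_add]
        exact hE.trans_le this)
      (fun s hs => by
        have := hasDerivWithinAt_comp_neg (hT _ (hneg s hs))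
        rw [neg_neg] at this
        rwa [inner_neg_right, neg_div, sub_neg_eq_add, sub_neg_eq_add])
    simp only [inner_neg_right, neg_div, sub_neg_eq_add] at this
    exact this
  · simp only [hpR]; rfl
  · have h0 : 0 < ‖Y s‖ := hm.trans_le (hr s hs)
    rw [norm_pAng_sq (x := (T s, Y s)) (norm_pos_iff.mp h0), ← neg_sq (pR _ _), hpR]
    simp only [radius, norm_neg]
    rw [h.norm_W_sq hm hs (hr s hs), radialVel]
    field_simp
    ring

end IsCentralCurve

end ERN

namespace ERN

open Set Filter Topology

/-! ### Rays reach the initial hypersurface and depend continuously on their endpoint -/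

lemma exists_first_le {f : ℝ → ℝ} {a b c : ℝ}
    (hf : ContinuousOn f (Icc a b)) (ha : c < f a) :
    (∀ s ∈ Icc a b, c < f s) ∨ ∃ t ∈ Ioc a b, f t = c ∧ ∀ s ∈ Ico a t, c < f s := by
  by_cases hall : ∀ s ∈ Icc a b, c < f s
  · exact Or.inl hall
  · push Not at hall
    obtain ⟨s₀, hs₀, hfs₀⟩ := hall
    have hK : IsCompact (Icc a b ∩ f ⁻¹' Iic c) :=
      isCompact_Icc.of_isClosed_subset (hf.preimage_isClosed_of_isClosed isClosed_Icc isClosed_Iic)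
        inter_subset_left
    obtain ⟨t, ⟨ht, hft⟩, hmin⟩ := hK.exists_isLeast ⟨s₀, hs₀, hfs₀⟩
    have hlt : ∀ s ∈ Ico a t, c < f s := fun s hs => by
      by_contra! hcon
      exact absurd (hmin ⟨⟨hs.1, hs.2.le.trans ht.2⟩, hcon⟩) (not_le.mpr hs.2)
    have hat : a < t := by
      rcases ht.1.eq_or_lt with h | h
      · rw [← h] at hft; exact absurd hft (not_le.mpr ha)
      · exact h
    refine Or.inr ⟨t, ⟨hat, ht.2⟩, le_antisymm hft ?_, hlt⟩
    have hcl : t ∈ closure (Ico a t) := by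
      rw [closure_Ico hat.ne]; exact right_mem_Icc.mpr hat.le
    have hcw : ContinuousWithinAt f (Ico a t) t :=
      (hf t ht).mono fun s hs => ⟨hs.1, hs.2.le.trans ht.2⟩
    exact continuousWithinAt_const.closure_le hcl hcw fun s hs => (hlt s hs).le

/-- The rate of change of `t*` along a ray. -/
def timeRate (lam E : ℝ) (y u : E3) : ℝ := advancedRate lam E y u + radialVel y u

namespace IsCentralCurve

variable {m S : ℝ} {y₀ u₀ : E3} {Y W : ℝ → E3}

lemma continuousOn_Y (h : IsCentralCurve m S y₀ u₀ Y W) : ContinuousOn Y (Icc 0 S) :=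
  fun s hs => (h.deriv_Y s hs).continuousWithinAt

lemma continuousOn_W (h : IsCentralCurve m S y₀ u₀ Y W) : ContinuousOn W (Icc 0 S) :=
  fun s hs => (h.deriv_W s hs).continuousWithinAt

lemma lt_norm_of_inner_pos (h : IsCentralCurve m S y₀ u₀ Y W) {κ : ℝ} (hκ : κ ≤ S)
    (hpos : ∀ s ∈ Icc 0 κ, 0 < inner ℝ (Y s) (W s)) {s : ℝ} (hs : s ∈ Ioc 0 κ) :
    ‖y₀‖ < ‖Y s‖ := by
  have h' := h.mono hκ
  have hmono : StrictMonoOn (fun s => ‖Y s‖ ^ 2) (Icc 0 κ) := by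
    refine strictMonoOn_of_hasDerivWithinAt_pos (f' := fun s => 2 * inner ℝ (Y s) (W s))
      (convex_Icc 0 κ) (h'.continuousOn_Y.norm.pow 2)
      (fun s hs => (((h'.deriv_Y s (interior_subset hs)).norm_sq).mono interior_subset))
      (fun s hs => by have := hpos s (interior_subset hs); positivity)
  have := hmono (left_mem_Icc.mpr (hs.1.le.trans hs.2)) ⟨hs.1.le, hs.2⟩ hs.1
  simp only [h.Y_zero] at this
  exact lt_of_pow_lt_pow_left₀ 2 (norm_nonneg _) this

lemma continuousOn_timeRate (h : IsCentralCurve m S y₀ u₀ Y W) (hm : 0 < m) (hy₀ : ‖y₀‖ = m)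
    (hE : 0 < radialVel y₀ u₀) (hlam : 0 < angMomSq y₀ u₀) (hlt : ∀ s ∈ Ioc 0 S, m < ‖Y s‖) :
    ContinuousOn (fun s => timeRate (angMomSq y₀ u₀) (radialVel y₀ u₀) (Y s) (W s))
      (Icc 0 S) := by
  have hY := h.continuousOn_Y
  have hW := h.continuousOn_W
  have h0 : ∀ s ∈ Icc 0 S, ‖Y s‖ ≠ 0 := fun s hs =>
    (hm.trans_le (h.lt_of_Ioc hy₀ hlt hs)).ne'
  have hg : ContinuousOn (fun s => radialVel (Y s) (W s)) (Icc 0 S) :=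
    (hY.inner (𝕜 := ℝ) hW).div hY.norm h0
  exact (continuousOn_const.div ((hY.norm.pow 2).mul (continuousOn_const.add hg)) fun s hs =>
    mul_ne_zero (pow_ne_zero 2 (h0 s hs)) (h.E_add_radialVel_pos hm hy₀ hE hlam hlt hs).ne').add hg

lemma hasDerivWithinAt_time (h : IsCentralCurve m S y₀ u₀ Y W) (hm : 0 < m) (hy₀ : ‖y₀‖ = m)
    (hE : 0 < radialVel y₀ u₀) (hlam : 0 < angMomSq y₀ u₀) (hlt : ∀ s ∈ Ioc 0 S, m < ‖Y s‖)
    (t₀ : ℝ) {s : ℝ} (hs : s ∈ Icc 0 S) :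
    HasDerivWithinAt (fun s => t₀ - ∫ σ in (0 : ℝ)..s,
        timeRate (angMomSq y₀ u₀) (radialVel y₀ u₀) (Y σ) (W σ))
      (-(advancedRate (angMomSq y₀ u₀) (radialVel y₀ u₀) (Y s) (W s) + radialVel (Y s) (W s)))
      (Icc 0 S) s := by
  have hc := h.continuousOn_timeRate hm hy₀ hE hlam hlt
  have : Fact (s ∈ Icc 0 S) := ⟨hs⟩
  have h1 := intervalIntegral.integral_hasDerivWithinAt_right (a := 0) (s := Icc 0 S)
    (t := Icc 0 S)
    ((hc.mono (by rw [uIcc_of_le hs.1]; exact Icc_subset_Icc_right hs.2)).intervalIntegrable)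
    (hc.stronglyMeasurableAtFilter_nhdsWithin measurableSet_Icc s) (hc s hs)
  exact h1.const_sub t₀

/-- Traced back far enough, a ray reaches negative times while still in the exterior. -/
theorem exists_negative_time (h : IsCentralCurve m S y₀ u₀ Y W) (hm : 0 < m) (hy₀ : ‖y₀‖ = m)
    (hE : 0 < radialVel y₀ u₀) (hlam : 0 < angMomSq y₀ u₀) {t₀ : ℝ} (ht₀ : 0 < t₀)
    (hS : t₀ < radialVel y₀ u₀ * S) :
    ∃ s₁ ∈ Ioc 0 S, (∀ s ∈ Ioc 0 s₁, m < ‖Y s‖) ∧ t₀ - (∫ σ in (0 : ℝ)..s₁,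
        timeRate (angMomSq y₀ u₀) (radialVel y₀ u₀) (Y σ) (W σ)) < 0 := by
  have hS0 : 0 < S := by
    by_contra! hc
    nlinarith
  have hinner : 0 < inner ℝ y₀ u₀ := by
    have h1 : inner ℝ y₀ u₀ = radialVel y₀ u₀ * ‖y₀‖ := by
      unfold radialVel; rw [hy₀]; field_simp
    rw [h1, hy₀]; positivity
  have hray : ∀ s₁ ∈ Ioc 0 S, (∀ s ∈ Ioc 0 s₁, m < ‖Y s‖) →
      RadialRay m (angMomSq y₀ u₀) (radialVel y₀ u₀) s₁ (fun s => ‖Y s‖)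
        (fun s => radialVel (Y s) (W s)) (fun s => t₀ - ∫ σ in (0 : ℝ)..s,
          timeRate (angMomSq y₀ u₀) (radialVel y₀ u₀) (Y σ) (W σ)) := fun s₁ hs₁ hlt =>
    (h.mono hs₁.2).radialRay hm hs₁.1.le hy₀ hE hlam hlt fun s hs =>
      (h.mono hs₁.2).hasDerivWithinAt_time hm hy₀ hE hlam hlt t₀ hs
  -- the ray enters the exterior
  have hev : ∀ᶠ s in 𝓝[Icc 0 S] 0, 0 < inner ℝ (Y s) (W s) := by
    have hc : ContinuousWithinAt (fun s => inner ℝ (Y s) (W s)) (Icc 0 S) 0 :=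
      (h.continuousOn_Y.inner (𝕜 := ℝ) h.continuousOn_W) 0 (left_mem_Icc.mpr hS0.le)
    refine hc.eventually (lt_mem_nhds ?_)
    simpa only [h.Y_zero, h.W_zero] using hinner
  obtain ⟨ε, hε, hball⟩ := Metric.mem_nhdsWithin_iff.mp hev
  set κ := min (ε / 2) S with hκ
  have hκ0 : 0 < κ := by positivity
  have hκS : κ ≤ S := min_le_right _ _
  have hpos : ∀ s ∈ Icc 0 κ, 0 < inner ℝ (Y s) (W s) := fun s hs => hball ⟨by
    rw [Metric.mem_ball, Real.dist_eq, sub_zero, abs_of_nonneg hs.1]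
    have := min_le_left (ε / 2) S
    linarith [hs.2], hs.1, hs.2.trans hκS⟩
  have hnear : ∀ s ∈ Ioc 0 κ, m < ‖Y s‖ := fun s hs => hy₀ ▸ h.lt_norm_of_inner_pos hκS hpos hs
  rcases exists_first_le (c := m)
      (h.continuousOn_Y.norm.mono (Icc_subset_Icc_left hκ0.le))
      (hnear κ (right_mem_Ioc.mpr hκ0)) with hall | ⟨t, ht, htm, hlt⟩
  · have hlt : ∀ s ∈ Ioc 0 S, m < ‖Y s‖ := fun s hs => by
      rcases le_total s κ with h1 | h1
      · exact hnear s ⟨hs.1, h1⟩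
      · exact hall s ⟨h1, hs.2⟩
    refine ⟨S, right_mem_Ioc.mpr hS0, hlt, ?_⟩
    have := (hray S (right_mem_Ioc.mpr hS0) hlt).T_le
    simp only [intervalIntegral.integral_same] at this
    linarith
  · have ht0 : 0 < t := hκ0.trans ht.1
    have hlt' : ∀ s ∈ Ioo 0 t, m < ‖Y s‖ := fun s hs => by
      rcases le_total s κ with h1 | h1
      · exact hnear s ⟨hs.1, h1⟩
      · exact hlt s ⟨h1, hs.2⟩
    by_contra! hcon
    have htS : t ∈ Icc 0 S := ⟨ht0.le, ht.2⟩
    have hle : ∀ s ∈ Icc 0 t, m ≤ ‖Y s‖ := fun s hs => by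
      rcases hs.1.eq_or_lt with h0 | h0
      · rw [← h0, h.Y_zero, hy₀]
      · rcases hs.2.eq_or_lt with h1 | h1
        · rw [h1, htm]
        · exact (hlt' s ⟨h0, h1⟩).le
    have hcl : t ∈ closure (Ioo 0 t) := by
      rw [closure_Ioo ht0.ne]; exact right_mem_Icc.mpr ht0.le
    have hYc : ContinuousWithinAt Y (Ioo 0 t) t :=
      (h.continuousOn_Y t htS).mono fun s hs => ⟨hs.1.le, hs.2.le.trans ht.2⟩
    have hWc : ContinuousWithinAt W (Ioo 0 t) t :=
      (h.continuousOn_W t htS).mono fun s hs => ⟨hs.1.le, hs.2.le.trans ht.2⟩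
    have ht_ne : ‖Y t‖ ≠ 0 := by rw [htm]; exact hm.ne'
    have hgc : ContinuousWithinAt (fun s => radialVel (Y s) (W s)) (Ioo 0 t) t :=
      (hYc.inner (𝕜 := ℝ) hWc).div hYc.norm ht_ne
    -- bounded virial quantity forces `g` to be at least `E` on return
    have hge : radialVel y₀ u₀ ≤ radialVel (Y t) (W t) := by
      have hbound : ∀ s ∈ Ioo 0 t, radialVel y₀ u₀ - t₀ / m * radialVel y₀ u₀
          * (m * (‖Y s‖ - m) / ‖Y s‖ ^ 2) ≤ radialVel (Y s) (W s) := by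
        intro s hs
        have hsS : s ∈ Ioc 0 S := ⟨hs.1, hs.2.le.trans ht.2⟩
        have hlts : ∀ σ ∈ Ioc 0 s, m < ‖Y σ‖ := fun σ hσ => hlt' σ ⟨hσ.1, hσ.2.trans_lt hs.2⟩
        have hr := hray s hsS hlts
        have hss : s ∈ Icc 0 s := right_mem_Icc.mpr hs.1.le
        have h1 := hr.virial_le
        have h2 := hcon s hsS hlts
        have h3 := hr.virial_eq hss
        have h4 := hlt' s hs
        simp only [intervalIntegral.integral_same] at h1
        have h5 : RadialRay.virial m (angMomSq y₀ u₀) (radialVel y₀ u₀) (fun s => ‖Y s‖)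
            (fun s => radialVel (Y s) (W s)) s ≤ t₀ / m := by
          rw [le_div_iff₀ hm]; linarith
        have h6 : 0 ≤ radialVel y₀ u₀ * (m * (‖Y s‖ - m) / ‖Y s‖ ^ 2) := by
          have : 0 ≤ ‖Y s‖ - m := by linarith
          positivity
        nlinarith
      have hcl1 : ContinuousWithinAt (fun s => radialVel y₀ u₀ - t₀ / m * radialVel y₀ u₀
          * (m * (‖Y s‖ - m) / ‖Y s‖ ^ 2)) (Ioo 0 t) t :=
        continuousWithinAt_const.sub (continuousWithinAt_const.mul
          ((continuousWithinAt_const.mul (hYc.norm.sub continuousWithinAt_const)).div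
            (hYc.norm.pow 2) (pow_ne_zero 2 ht_ne)))
      have := hcl1.closure_le hcl hgc hbound
      simpa [htm] using this
    -- but the radius decreases to `m`
    have hderiv := (h.deriv_Y t htS).mono (Icc_subset_Icc_right ht.2 : Icc 0 t ⊆ Icc 0 S)
    have hrd := hasDerivWithinAt_norm_of_ne (norm_ne_zero_iff.mp ht_ne) hderiv
    have hneg : radialVel (Y t) (W t) ≤ 0 := by
      by_contra! hc
      have hrd2 : HasDerivWithinAt (fun s => ‖Y s‖) (inner ℝ (Y t) (W t) / ‖Y t‖) (Iio t) t :=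
        hrd.mono_of_mem_nhdsWithin (Icc_mem_nhdsLT ht0)
      have hrd' := (hasDerivWithinAt_iff_tendsto_slope' self_notMem_Iio).mp hrd2
      have h1 := hrd'.eventually (lt_mem_nhds hc)
      have h2 : ∀ᶠ s in 𝓝[<] t, s ∈ Ioo 0 t := Ioo_mem_nhdsLT ht0
      obtain ⟨s, hs1, hs2⟩ := (h1.and h2).exists
      rw [slope_def_field] at hs1
      have h3 : ‖Y s‖ - ‖Y t‖ < 0 := by
        have h5 : s - t < 0 := by linarith [hs2.2]
        by_contra! h6
        exact absurd hs1 (not_lt.mpr (div_nonpos_of_nonneg_of_nonpos h6 h5.le))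
      have := hle s ⟨hs2.1.le, hs2.2.le⟩
      linarith
    linarith

end IsCentralCurve

end ERN

/-! ### Continuous dependence of the traced-back rays on the final momentum. -/

namespace ERN

open Set Filter Topology

lemma continuousOn_primitive {X : Type*} [TopologicalSpace X] {F : X → ℝ → ℝ} {U : Set X}
    (hF : ContinuousOn (fun p : X × ℝ => F p.1 p.2) (U ×ˢ univ)) :
    ContinuousOn (fun p : X × ℝ => ∫ σ in (0 : ℝ)..p.2, F p.1 σ) (U ×ˢ univ) := by
  have h1 : Continuous (Function.uncurry fun (u : U) (σ : ℝ) => F u σ) :=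
    hF.comp_continuous (f := fun p : U × ℝ => ((p.1 : X), p.2)) (by fun_prop)
      fun p => ⟨p.1.2, mem_univ _⟩
  have h2 := intervalIntegral.continuous_parametric_primitive_of_continuous
    (μ := MeasureTheory.volume) (a₀ := 0) h1
  rw [continuousOn_iff_continuous_domRestrict]
  exact h2.comp (f := fun p : (U ×ˢ univ : Set (X × ℝ)) => ((⟨p.1.1, p.2.1⟩ : U), p.1.2))
    (by fun_prop)

lemma eventually_forall_lt {X : Type*} [TopologicalSpace X] {G : X × ℝ → ℝ} {U : Set X} {x₀ : X}
    (hU : U ∈ 𝓝 x₀) (hG : ContinuousOn G (U ×ˢ univ)) {a b c : ℝ}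
    (h : ∀ s ∈ Icc a b, c < G (x₀, s)) : ∀ᶠ x in 𝓝 x₀, ∀ s ∈ Icc a b, c < G (x, s) := by
  refine isCompact_Icc.eventually_forall_of_forall_eventually
    (P := fun x s => c < G (x, s)) fun s hs => ?_
  have hc : ContinuousAt G (x₀, s) := hG.continuousAt (prod_mem_nhds hU univ_mem)
  exact hc.eventually (lt_mem_nhds (h s hs))

lemma continuous_radialVel_right (y : E3) : Continuous (radialVel y) := by
  unfold radialVel; fun_prop

lemma continuous_angMomSq_right (y : E3) : Continuous (angMomSq y) := by
  unfold angMomSq; fun_prop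

lemma IsNullGeodesic.congr {m a b : ℝ} {x p x' p' : ℝ → Spacetime} (h : IsNullGeodesic m x p a b)
    (hx : ∀ s ∈ Icc a b, x' s = x s) (hp : ∀ s ∈ Icc a b, p' s = p s) :
    IsNullGeodesic m x' p' a b where
  mem_massShell s hs := by rw [hx s hs, hp s hs]; exact h.mem_massShell s hs
  velocity s hs := by rw [hp s hs]; exact (h.velocity s hs).congr_of_mem hx hs
  geodesic s hs := by
    obtain ⟨acc, h1, h2⟩ := h.geodesic s hs
    refine ⟨acc, h1.congr_of_mem hp hs, ?_⟩
    rw [hx s hs, hp s hs]; exact h2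

lemma BackRay.congr {m lam E S : ℝ} {Z Z' : ℝ → Phase} (h : BackRay m lam E S Z)
    (hZ : ∀ s ∈ Icc 0 S, Z' s = Z s) : BackRay m lam E S Z' where
  radial :=
    have h0 : (0 : ℝ) ∈ Icc 0 S := left_mem_Icc.mpr h.radial.S_nonneg
    { m_pos := h.radial.m_pos
      lam_pos := h.radial.lam_pos
      E_pos := h.radial.E_pos
      S_nonneg := h.radial.S_nonneg
      r_zero := by rw [hZ 0 h0]; exact h.radial.r_zero
      g_zero := by rw [hZ 0 h0]; exact h.radial.g_zero
      lt_r := fun s hs => by rw [hZ s (Ioc_subset_Icc_self hs)]; exact h.radial.lt_r s hs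
      deriv_r := fun s hs => by
        rw [hZ s hs]; exact (h.radial.deriv_r s hs).congr_of_mem (fun x hx => by rw [hZ x hx]) hs
      deriv_g := fun s hs => by
        rw [hZ s hs]; exact (h.radial.deriv_g s hs).congr_of_mem (fun x hx => by rw [hZ x hx]) hs
      deriv_T := fun s hs => by
        rw [hZ s hs]; exact (h.radial.deriv_T s hs).congr_of_mem (fun x hx => by rw [hZ x hx]) hs
      energy := fun s hs => by rw [hZ s hs]; exact h.radial.energy s hs }
  geodesic := h.geodesic.congr
    (fun s hs => by rw [hZ (-s) ⟨by linarith [hs.2], by linarith [hs.1]⟩])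
    (fun s hs => by rw [hZ (-s) ⟨by linarith [hs.2], by linarith [hs.1]⟩])
  pT_eq s hs := by rw [hZ s hs]; exact h.pT_eq s hs
  norm_pAng s hs := by rw [hZ s hs]; exact h.norm_pAng s hs

/-- The null geodesics ending at the horizon can be traced back to negative times, and locally they
depend continuously on their final momentum. -/
theorem exists_local_backRays {m : ℝ} (hm : 0 < m) {y₀ u₀ : E3} (hy₀ : ‖y₀‖ = m)
    (hE : 0 < radialVel y₀ u₀) (hlam : 0 < angMomSq y₀ u₀) {t₀ : ℝ} (ht₀ : 0 < t₀) :
    ∃ s₁ : ℝ, 0 < s₁ ∧ ∃ V ∈ 𝓝 u₀, ∃ Z : E3 → ℝ → Phase,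
      ContinuousOn (fun p : E3 × ℝ => Z p.1 p.2) (V ×ˢ univ) ∧
      (∀ u ∈ V, BackRay m (angMomSq y₀ u) (radialVel y₀ u) s₁ (Z u) ∧
        Z u 0 = ((t₀, y₀), (timeRate (angMomSq y₀ u) (radialVel y₀ u) y₀ u, -u))) ∧
      tStar (Z u₀ s₁).1 < 0 := by
  set S : ℝ := t₀ / radialVel y₀ u₀ + 1 with hSdef
  have hS : 0 ≤ S := by positivity
  obtain ⟨U, hU, Y, W, hYW, hYc, hWc⟩ := exists_centralCurves hm y₀ u₀ hS
  have hu₀U : u₀ ∈ U := mem_of_mem_nhds hU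
  obtain ⟨s₁, hs₁, hlt, hneg⟩ := (hYW u₀ hu₀U).exists_negative_time hm hy₀ hE hlam ht₀
    (by rw [hSdef, mul_add, mul_div_cancel₀ _ hE.ne']; linarith)
  -- extend in time
  set Ye : E3 → ℝ → E3 := fun u s => Y u (projIcc 0 S hS s) with hYe
  set We : E3 → ℝ → E3 := fun u s => W u (projIcc 0 S hS s) with hWe
  have hproj : ContinuousOn (fun p : E3 × ℝ => (p.1, (projIcc 0 S hS p.2 : ℝ))) (U ×ˢ univ) := by
    fun_prop
  have hmaps : MapsTo (fun p : E3 × ℝ => (p.1, (projIcc 0 S hS p.2 : ℝ))) (U ×ˢ univ)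
      (U ×ˢ Icc 0 S) := fun p hp => ⟨hp.1, (projIcc 0 S hS p.2).2⟩
  have hYec : ContinuousOn (fun p : E3 × ℝ => Ye p.1 p.2) (U ×ˢ univ) := hYc.comp hproj hmaps
  have hWec : ContinuousOn (fun p : E3 × ℝ => We p.1 p.2) (U ×ˢ univ) := hWc.comp hproj hmaps
  have hYeq : ∀ u, ∀ s ∈ Icc 0 S, Ye u s = Y u s := fun u s hs => by
    simp only [hYe, projIcc_of_mem hS hs]
  have hWeq : ∀ u, ∀ s ∈ Icc 0 S, We u s = W u s := fun u s hs => by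
    simp only [hWe, projIcc_of_mem hS hs]
  have hs₁S : Icc 0 s₁ ⊆ Icc 0 S := Icc_subset_Icc_right hs₁.2
  -- regularized radial quantities
  set re : E3 → ℝ → ℝ := fun u s => max m ‖Ye u s‖ with hre
  have hre0 : ∀ u s, 0 < re u s := fun u s => lt_max_of_lt_left hm
  have hrec : ContinuousOn (fun p : E3 × ℝ => re p.1 p.2) (U ×ˢ univ) :=
    continuousOn_const.sup hYec.norm
  set ge : E3 → ℝ → ℝ := fun u s => inner ℝ (Ye u s) (We u s) / re u s with hge
  have hgec : ContinuousOn (fun p : E3 × ℝ => ge p.1 p.2) (U ×ˢ univ) :=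
    (hYec.inner (𝕜 := ℝ) hWec).div hrec fun p _ => (hre0 _ _).ne'
  have hEc : ContinuousOn (fun p : E3 × ℝ => radialVel y₀ p.1) (U ×ˢ univ) :=
    ((continuous_radialVel_right y₀).comp continuous_fst).continuousOn
  have hLc : ContinuousOn (fun p : E3 × ℝ => angMomSq y₀ p.1) (U ×ˢ univ) :=
    ((continuous_angMomSq_right y₀).comp continuous_fst).continuousOn
  have hgeq : ∀ u, ∀ s ∈ Icc 0 S, m ≤ ‖Y u s‖ → ge u s = radialVel (Y u s) (W u s) :=
    fun u s hs hr => by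
      simp only [hge, hre, radialVel, hYeq u s hs, hWeq u s hs, max_eq_right hr]
  have hmr₀ : ∀ s ∈ Icc 0 s₁, m ≤ ‖Y u₀ s‖ := fun s hs =>
    ((hYW u₀ hu₀U).mono hs₁.2).lt_of_Ioc hy₀ hlt hs
  -- a lower bound for `E + g`
  obtain ⟨κ, hκ0, hκ⟩ : ∃ κ : ℝ, 0 < κ ∧ ∀ s ∈ Icc 0 s₁, κ < radialVel y₀ u₀ + ge u₀ s := by
    have hc : ContinuousOn (fun s => radialVel y₀ u₀ + ge u₀ s) (Icc 0 s₁) :=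
      (hEc.add hgec).comp (f := fun s => (u₀, s)) (by fun_prop) fun s _ => ⟨hu₀U, mem_univ _⟩
    obtain ⟨s₂, hs₂, hmin⟩ := isCompact_Icc.exists_isMinOn (nonempty_Icc.mpr hs₁.1.le) hc
    have hpos : 0 < radialVel y₀ u₀ + ge u₀ s₂ := by
      rw [hgeq u₀ s₂ (hs₁S hs₂) (hmr₀ s₂ hs₂)]
      exact ((hYW u₀ hu₀U).mono hs₁.2).E_add_radialVel_pos hm hy₀ hE hlam hlt hs₂
    exact ⟨_, half_pos hpos, fun s hs => (half_lt_self hpos).trans_le (hmin hs)⟩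
  -- the regularized time
  set Pe : E3 → ℝ → ℝ := fun u s =>
    angMomSq y₀ u / (re u s ^ 2 * max κ (radialVel y₀ u + ge u s)) with hPe
  have hPec : ContinuousOn (fun p : E3 × ℝ => Pe p.1 p.2) (U ×ˢ univ) :=
    hLc.div ((hrec.pow 2).mul (continuousOn_const.sup (hEc.add hgec))) fun p _ =>
      (mul_pos (pow_pos (hre0 _ _) 2) (lt_max_of_lt_left hκ0)).ne'
  set Te : E3 → ℝ → ℝ := fun u s => t₀ - ∫ σ in (0 : ℝ)..s, (Pe u σ + ge u σ) with hTe
  have hTec : ContinuousOn (fun p : E3 × ℝ => Te p.1 p.2) (U ×ˢ univ) :=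
    continuousOn_const.sub (continuousOn_primitive
      (F := fun u σ => Pe u σ + ge u σ) (hPec.add hgec))
  have hrate : ∀ u, (∀ s ∈ Icc 0 s₁, m ≤ ‖Y u s‖) →
      (∀ s ∈ Icc 0 s₁, κ < radialVel y₀ u + ge u s) → ∀ s ∈ Icc 0 s₁,
      Pe u s + ge u s = timeRate (angMomSq y₀ u) (radialVel y₀ u) (Y u s) (W u s) := by
    intro u hr hk s hs
    have h1 := hk s hs
    rw [hgeq u s (hs₁S hs) (hr s hs)] at h1
    simp only [hPe, timeRate, advancedRate, hgeq u s (hs₁S hs) (hr s hs), max_eq_right h1.le]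
    simp only [hre, hYeq u s (hs₁S hs), max_eq_right (hr s hs)]
  have hTeq : ∀ u, (∀ s ∈ Icc 0 s₁, m ≤ ‖Y u s‖) →
      (∀ s ∈ Icc 0 s₁, κ < radialVel y₀ u + ge u s) → ∀ s ∈ Icc 0 s₁,
      Te u s = t₀ - ∫ σ in (0 : ℝ)..s,
        timeRate (angMomSq y₀ u) (radialVel y₀ u) (Y u σ) (W u σ) := by
    intro u hr hk s hs
    simp only [hTe]
    congr 1
    refine intervalIntegral.integral_congr fun σ hσ => ?_
    rw [uIcc_of_le hs.1] at hσ
    exact hrate u hr hk σ ⟨hσ.1, hσ.2.trans hs.2⟩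
  -- conditions that hold for nearby final momenta
  have hinner₀ : 0 < inner ℝ (Ye u₀ 0) (We u₀ 0) := by
    rw [hYeq u₀ 0 (left_mem_Icc.mpr hS), hWeq u₀ 0 (left_mem_Icc.mpr hS), (hYW u₀ hu₀U).Y_zero,
      (hYW u₀ hu₀U).W_zero]
    rw [radialVel, hy₀] at hE
    exact (div_pos_iff_of_pos_right hm).mp hE
  have hic : ContinuousOn (fun p : E3 × ℝ => inner ℝ (Ye p.1 p.2) (We p.1 p.2)) (U ×ˢ univ) :=
    hYec.inner (𝕜 := ℝ) hWec
  obtain ⟨ε, hε0, hεs₁, hεi⟩ : ∃ ε : ℝ, 0 < ε ∧ ε ≤ s₁ ∧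
      ∀ s ∈ Icc 0 ε, 0 < inner ℝ (Ye u₀ s) (We u₀ s) := by
    have hc : ContinuousAt (fun s => inner ℝ (Ye u₀ s) (We u₀ s)) 0 := by
      have h1 : ContinuousOn (fun s => inner ℝ (Ye u₀ s) (We u₀ s)) univ :=
        hic.comp (f := fun s => (u₀, s)) (by fun_prop) fun s _ => ⟨hu₀U, mem_univ _⟩
      exact (continuousOn_univ.mp h1).continuousAt
    obtain ⟨δ, hδ, hball⟩ := Metric.eventually_nhds_iff.mp (hc.eventually (lt_mem_nhds hinner₀))
    refine ⟨min (δ / 2) s₁, lt_min (by positivity) hs₁.1, min_le_right _ _, fun s hs => hball ?_⟩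
    rw [Real.dist_eq, sub_zero, abs_of_nonneg hs.1]
    have := min_le_left (δ / 2) s₁
    linarith [hs.2]
  have ev1 : ∀ᶠ u in 𝓝 u₀, 0 < radialVel y₀ u :=
    (continuous_radialVel_right y₀).continuousAt.eventually (lt_mem_nhds hE)
  have ev2 : ∀ᶠ u in 𝓝 u₀, 0 < angMomSq y₀ u :=
    (continuous_angMomSq_right y₀).continuousAt.eventually (lt_mem_nhds hlam)
  have ev3 : ∀ᶠ u in 𝓝 u₀, ∀ s ∈ Icc 0 ε, 0 < inner ℝ (Ye u s) (We u s) :=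
    eventually_forall_lt hU hic hεi
  have ev4 : ∀ᶠ u in 𝓝 u₀, ∀ s ∈ Icc ε s₁, m < ‖Ye u s‖ :=
    eventually_forall_lt hU hYec.norm fun s hs => by
      have hs' : s ∈ Icc 0 s₁ := ⟨hε0.le.trans hs.1, hs.2⟩
      simpa only [hYeq u₀ s (hs₁S hs')] using hlt s ⟨hε0.trans_le hs.1, hs.2⟩
  have ev5 : ∀ᶠ u in 𝓝 u₀, ∀ s ∈ Icc 0 s₁, κ < radialVel y₀ u + ge u s :=
    eventually_forall_lt hU (hEc.add hgec) hκ
  refine ⟨s₁, hs₁.1, U ∩ {u | 0 < radialVel y₀ u ∧ 0 < angMomSq y₀ u ∧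
    (∀ s ∈ Icc 0 ε, 0 < inner ℝ (Ye u s) (We u s)) ∧ (∀ s ∈ Icc ε s₁, m < ‖Ye u s‖) ∧
    ∀ s ∈ Icc 0 s₁, κ < radialVel y₀ u + ge u s},
    inter_mem hU (ev1.and (ev2.and (ev3.and (ev4.and ev5)))),
    fun u s => ((Te u s, Ye u s), (Pe u s + ge u s, -We u s)), ?_, ?_, ?_⟩
  · exact (((hTec.prodMk hYec).prodMk ((hPec.add hgec).prodMk hWec.neg))).mono
      (prod_mono inter_subset_left Subset.rfl)
  · rintro u ⟨huU, hu1, hu2, hu3, hu4, hu5⟩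
    have hcc := hYW u huU
    have hltu : ∀ s ∈ Ioc 0 s₁, m < ‖Y u s‖ := by
      intro s hs
      have hsS : s ∈ Icc 0 S := hs₁S ⟨hs.1.le, hs.2⟩
      rcases le_total s ε with h1 | h1
      · refine hy₀ ▸ hcc.lt_norm_of_inner_pos (hεs₁.trans hs₁.2) (fun σ hσ => ?_) ⟨hs.1, h1⟩
        have hσS : σ ∈ Icc 0 S := hs₁S ⟨hσ.1, hσ.2.trans hεs₁⟩
        have := hu3 σ hσ
        rwa [hYeq u σ hσS, hWeq u σ hσS] at this
      · have := hu4 s ⟨h1, hs.2⟩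
        rwa [hYeq u s hsS] at this
    have hcc' := hcc.mono hs₁.2
    have hmr : ∀ s ∈ Icc 0 s₁, m ≤ ‖Y u s‖ := fun s hs => hcc'.lt_of_Ioc hy₀ hltu hs
    have hray := hcc'.backRay hm hs₁.1.le hy₀ hu1 hu2 hltu (T := Te u) fun s hs =>
      (hcc'.hasDerivWithinAt_time hm hy₀ hu1 hu2 hltu t₀ hs).congr_of_mem
        (fun x hx => hTeq u hmr hu5 x hx) hs
    have hpt : ∀ s ∈ Icc 0 s₁, ((Te u s, Ye u s), (Pe u s + ge u s, -We u s))
        = (((Te u s, Y u s), (advancedRate (angMomSq y₀ u) (radialVel y₀ u) (Y u s) (W u s)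
          + radialVel (Y u s) (W u s), -W u s)) : Phase) := fun s hs => by
      rw [hrate u hmr hu5 s hs, hYeq u s (hs₁S hs), hWeq u s (hs₁S hs)]; rfl
    refine ⟨hray.congr hpt, ?_⟩
    have h0 : (0 : ℝ) ∈ Icc 0 s₁ := left_mem_Icc.mpr hs₁.1.le
    simp only []
    rw [hpt 0 h0, hcc.Y_zero, hcc.W_zero]
    simp [hTe, timeRate]
  · have h1 : s₁ ∈ Icc 0 s₁ := right_mem_Icc.mpr hs₁.1.le
    change Te u₀ s₁ < 0
    rw [hTeq u₀ hmr₀ hκ s₁ h1]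
    exact hneg

end ERN

namespace ERN
open Set Filter Topology

/-! ### The time function along a ray -/

/-- Outgoing null rays are the level sets of `t* - outgoingHeight m r`. -/
def outgoingHeight (m r : ℝ) : ℝ := r + 4 * m * Real.log (r - m) - 2 * m ^ 2 / (r - m)

theorem hasDerivAt_outgoingHeight {m r : ℝ} (hr : m < r) :
    HasDerivAt (outgoingHeight m) (2 * r ^ 2 / (r - m) ^ 2 - 1) r := by
  have h : r - m ≠ 0 := (sub_pos.mpr hr).ne'
  have h1 : HasDerivAt (fun r : ℝ => r - m) 1 r := (hasDerivAt_id r).sub_const m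
  have h2 := ((hasDerivAt_id r).add ((h1.log h).const_mul (4 * m))).sub
    ((hasDerivAt_const r (2 * m ^ 2)).div h1 h)
  refine h2.congr_deriv ?_
  field_simp
  ring

theorem strictMonoOn_outgoingHeight {m : ℝ} (hm : 0 < m) :
    StrictMonoOn (outgoingHeight m) (Ioi m) := by
  refine strictMonoOn_of_deriv_pos (convex_Ioi m)
    (fun r hr => (hasDerivAt_outgoingHeight hr).continuousAt.continuousWithinAt) fun r hr => ?_
  rw [interior_Ioi, mem_Ioi] at hr
  rw [(hasDerivAt_outgoingHeight hr).deriv, sub_pos, one_lt_div (by have := sub_pos.mpr hr; positivity)]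
  nlinarith

/-- u + c(R) equals t* minus the increment of `outgoingHeight` from R to r, and `outgoingHeight`
increases; so the defining case distinction selects the smaller branch. Continuity and monotonicity
of τ then follow without treating r = R separately. -/
theorem tau_eq_min {m R : ℝ} (hm : 0 < m) (hR : m < R) {x : Spacetime} (hx : m < radius x) :
    tau m R x = min (tStar x)
      (tStar x - (outgoingHeight m (radius x) - outgoingHeight m R)) := by
  have hG := strictMonoOn_outgoingHeight hm
  unfold tau
  split_ifs with h
  · have := (hG.le_iff_le hx hR).mpr h
    rw [min_eq_left (by linarith)]
  · have := (hG.lt_iff_lt hR hx).mpr (not_le.mp h)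
    rw [min_eq_right (by linarith)]
    simp only [retardedTime, shiftF, rStar, matchConst, outgoingHeight]
    ring

theorem tau_le_tStar {m R : ℝ} (hm : 0 < m) (hR : m < R) (x : Spacetime) :
    tau m R x ≤ tStar x := by
  by_cases h : radius x ≤ R
  · simp [tau, h]
  · rw [tau_eq_min hm hR (hR.trans (not_le.mp h))]
    exact min_le_left _ _

theorem continuousAt_tau {m R : ℝ} (hm : 0 < m) (hR : m < R) {x : Spacetime} (hx : m < radius x) :
    ContinuousAt (tau m R) x := by
  have hrad : Continuous radius := continuous_snd.norm
  have hG : ContinuousAt (fun x : Spacetime => outgoingHeight m (radius x)) x :=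
    ContinuousAt.comp (g := outgoingHeight m) (hasDerivAt_outgoingHeight hx).continuousAt
      hrad.continuousAt
  have hT : ContinuousAt tStar x := continuous_fst.continuousAt
  refine (ContinuousAt.inf hT (ContinuousAt.sub hT (hG.sub (continuousAt_const (y := outgoingHeight m R))))).congr ?_
  filter_upwards [hrad.continuousAt.eventually (lt_mem_nhds hx)] with z hz
  exact (tau_eq_min hm hR hz).symm

theorem tau_of_radius_le {m R : ℝ} {x : Spacetime} (h : radius x ≤ R) : tau m R x = tStar x := by
  simp [tau, h]

/-- In the region r > R, log x ≤ x - 1 and R - m > m bound the logarithmic part of t* linearly in r.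
This is how the starting time is controlled uniformly in R. -/
theorem tStar_le_of_tau_eq_zero {m R : ℝ} (hm : 0 < m) (hR : 2 * m < R) {x : Spacetime}
    (hx : m < radius x) (h : tau m R x = 0) : tStar x ≤ 5 * radius x + 2 * m := by
  by_cases hr : radius x ≤ R
  · rw [tau_of_radius_le hr] at h
    rw [h]; linarith
  · push Not at hr
    have hG := (strictMonoOn_outgoingHeight hm).lt_iff_lt (show R ∈ Ioi m by simp; linarith) hx
    rw [tau_eq_min hm (by linarith) hx, min_eq_right (by linarith [hG.mpr hr])] at h
    have h1 : tStar x = outgoingHeight m (radius x) - outgoingHeight m R := by linarith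
    have hRm : 0 < R - m := by linarith
    have hrm : 0 < radius x - m := by linarith
    have h2 := Real.log_le_sub_one_of_pos (div_pos hrm hRm)
    rw [Real.log_div hrm.ne' hRm.ne'] at h2
    have h3 : (radius x - m) / (R - m) ≤ (radius x - m) / m :=
      div_le_div_of_nonneg_left hrm.le hm (by linarith)
    have h4 : m * ((radius x - m) / m) = radius x - m := by field_simp
    have h5 : 2 * m ^ 2 / (R - m) ≤ 2 * m := by
      rw [div_le_iff₀ hRm]; nlinarith
    have h6 : 0 < 2 * m ^ 2 / (radius x - m) := by positivity
    simp only [outgoingHeight] at h1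
    nlinarith

namespace RadialRay

variable {m lam E S : ℝ} {r g T : ℝ → ℝ}

theorem continuousOn_T (h : RadialRay m lam E S r g T) : ContinuousOn T (Icc 0 S) :=
  fun s hs => (h.deriv_T s hs).continuousWithinAt

theorem strictAntiOn_time (h : RadialRay m lam E S r g T) : StrictAntiOn T (Icc 0 S) := by
  refine strictAntiOn_of_deriv_neg (convex_Icc 0 S)
    (fun s hs => (h.deriv_T s hs).continuousWithinAt) fun s hs => ?_
  rw [interior_Icc] at hs
  have hs' := Ioo_subset_Icc_self hs
  rw [((h.deriv_T s hs').hasDerivAt (Icc_mem_nhds hs.1 hs.2)).deriv]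
  linarith [h.E_le_pT hs', h.E_pos]

/-- The derivative is -(E + g) r²/(r - m)². Together with the decrease of t* it makes τ strictly
decreasing backwards, so a ray meets the initial hypersurface only once. -/
theorem strictAntiOn_retarded (h : RadialRay m lam E S r g T) :
    StrictAntiOn (fun s => T s - outgoingHeight m (r s)) (Ioc 0 S) := by
  have hd : ∀ s ∈ Ioc 0 S, HasDerivWithinAt (fun s => T s - outgoingHeight m (r s))
      (-((E + g s) * r s ^ 2 / (r s - m) ^ 2)) (Icc 0 S) s := by
    intro s hs
    have hs' := Ioc_subset_Icc_self hs
    have hr := h.lt_r s hs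
    have hne : (r s - m) ^ 2 ≠ 0 := pow_ne_zero 2 (sub_pos.mpr hr).ne'
    have h1 := (hasDerivAt_outgoingHeight hr).comp_hasDerivWithinAt s (h.deriv_r s hs')
    refine ((h.deriv_T s hs').sub h1).congr_deriv ?_
    have h2 := h.P_mul_sq hs'
    rw [← eq_div_iff hne] at h2
    rw [h2]
    field_simp
    ring
  refine strictAntiOn_of_deriv_neg (convex_Ioc 0 S)
    (fun s hs => ((hd s hs).mono Ioc_subset_Icc_self).continuousWithinAt) fun s hs => ?_
  rw [interior_Ioc] at hs
  have hs' := Ioo_subset_Ioc_self hs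
  rw [((hd s hs').hasDerivAt (Icc_mem_nhds hs.1 hs.2)).deriv]
  have hr := sub_pos.mpr (h.lt_r s hs')
  have := h.E_add_g_pos (Ioc_subset_Icc_self hs')
  have := h.r_pos (Ioc_subset_Icc_self hs')
  rw [neg_lt_zero]
  positivity

end RadialRay

namespace BackRay

variable {m lam E S R : ℝ} {Z : ℝ → Phase}

theorem strictAntiOn_tau (h : BackRay m lam E S Z) (hR : m < R) :
    StrictAntiOn (fun s => tau m R (Z s).1) (Ioc 0 S) := by
  intro s hs t ht hst
  have hm := h.radial.m_pos
  simp only [tau_eq_min hm hR (h.radial.lt_r s hs), tau_eq_min hm hR (h.radial.lt_r t ht)]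
  have h1 := h.radial.strictAntiOn_time (Ioc_subset_Icc_self hs) (Ioc_subset_Icc_self ht) hst
  have h2 := h.radial.strictAntiOn_retarded hs ht hst
  simp only at h1 h2
  exact min_lt_min h1 (by linarith)

theorem continuousOn_tau (h : BackRay m lam E S Z) (hR : m < R) :
    ContinuousOn (fun s => tau m R (Z s).1) (Ioc 0 S) := by
  have hm := h.radial.m_pos
  have hT := h.radial.continuousOn_T.mono (Ioc_subset_Icc_self (a := 0) (b := S))
  have hr := h.radial.continuousOn_r.mono (Ioc_subset_Icc_self (a := 0) (b := S))
  have hG : ContinuousOn (fun s => outgoingHeight m (radius (Z s).1)) (Ioc 0 S) :=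
    ContinuousOn.comp (g := outgoingHeight m) (t := Ioi m)
      (fun r hr => (hasDerivAt_outgoingHeight hr).continuousAt.continuousWithinAt) hr
      fun s hs => h.radial.lt_r s hs
  refine (ContinuousOn.inf hT (ContinuousOn.sub hT (hG.sub (continuousOn_const (c := outgoingHeight m R))))).congr
    fun s hs => ?_
  exact tau_eq_min hm hR (h.radial.lt_r s hs)

theorem geodesic_mono (h : BackRay m lam E S Z) {s : ℝ} (hs : s ∈ Icc 0 S) :
    IsNullGeodesic m (fun s => (Z (-s)).1) (fun s => (Z (-s)).2) (-s) 0 := by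
  have hsub : Icc (-s) 0 ⊆ Icc (-S) 0 := Icc_subset_Icc_left (neg_le_neg hs.2)
  exact ⟨fun t ht => h.geodesic.mem_massShell t (hsub ht),
    fun t ht => (h.geodesic.velocity t (hsub ht)).mono hsub, fun t ht =>
    let ⟨acc, h1, h2⟩ := h.geodesic.geodesic t (hsub ht); ⟨acc, h1.mono hsub, h2⟩⟩

theorem mem_massShell (h : BackRay m lam E S Z) {s : ℝ} (hs : s ∈ Icc 0 S) :
    Z s ∈ massShell m := by
  have := h.geodesic.mem_massShell (-s) ⟨neg_le_neg hs.2, neg_nonpos.mpr hs.1⟩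
  simpa using this

theorem transport (h : BackRay m lam E S Z) {f₀ : initialShell m R → ℝ} {f : Phase → ℝ}
    (hf : IsVlasovSolution m R f₀ f) (hR : m < R) (hT : 0 < tStar (Z 0).1) {s : ℝ}
    (hs : s ∈ Ioc 0 S) (hτ : tau m R (Z s).1 = 0) :
    f (Z 0) = f₀ ⟨Z s, h.mem_massShell (Ioc_subset_Icc_self hs), hτ⟩ := by
  have h0 : radius (Z 0).1 = m := h.radial.r_zero
  have := hf.transport _ _ (-s) 0 (neg_lt_zero.mpr hs.1) (h.geodesic_mono (Ioc_subset_Icc_self hs))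
    (by simp [hτ]) (by simp only [neg_zero]; rwa [tau_of_radius_le (h0.trans_le hR.le)])
  simp only [neg_zero, neg_neg] at this
  rw [← hf.initial]
  exact this

theorem exists_tau_eq_zero (h : BackRay m lam E S Z) (hR : m < R) (hT : 0 < tStar (Z 0).1)
    (hneg : tStar (Z S).1 < 0) : ∃ s ∈ Ioc 0 S, tau m R (Z s).1 = 0 := by
  have hm := h.radial.m_pos
  have hS : 0 < S := by
    refine lt_of_le_of_ne h.radial.S_nonneg fun h0 => ?_
    rw [← h0] at hneg
    linarith
  have hT0 := h.radial.continuousOn_T 0 (left_mem_Icc.mpr hS.le)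
  have hr0 := h.radial.continuousOn_r 0 (left_mem_Icc.mpr hS.le)
  have e1 : ∀ᶠ s in 𝓝[Icc 0 S] 0, 0 < tStar (Z s).1 := hT0.eventually (lt_mem_nhds hT)
  have e2 : ∀ᶠ s in 𝓝[Icc 0 S] 0, radius (Z s).1 < R :=
    hr0.eventually (gt_mem_nhds (h.radial.r_zero.trans_lt hR))
  have e3 : ∀ᶠ s in 𝓝[>] (0 : ℝ), s ∈ Ioc 0 S := Ioc_mem_nhdsGT hS
  have hle : 𝓝[>] (0 : ℝ) ≤ 𝓝[Icc 0 S] 0 := by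
    rw [← nhdsWithin_Ioc_eq_nhdsGT hS]
    exact nhdsWithin_mono 0 Ioc_subset_Icc_self
  obtain ⟨s, ⟨h1, h2⟩, hs⟩ := (((e1.and e2).filter_mono hle).and e3).exists
  have h3 : 0 < tau m R (Z s).1 := by rwa [tau_of_radius_le h2.le]
  have h4 : tau m R (Z S).1 < 0 := (tau_le_tStar hm hR _).trans_lt hneg
  have hc := (h.continuousOn_tau hR).mono (fun t ht => ⟨hs.1.trans_le ht.1, ht.2⟩ : Icc s S ⊆ Ioc 0 S)
  obtain ⟨t, ht, ht0⟩ := intermediate_value_Icc' hs.2 hc ⟨h4.le, h3.le⟩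
  exact ⟨t, ⟨hs.1.trans_le ht.1, ht.2⟩, ht0⟩

theorem exists_tStar_eq_zero (h : BackRay m lam E S Z) (hT : 0 < tStar (Z 0).1)
    (hneg : tStar (Z S).1 < 0) : ∃ s ∈ Ioc 0 S, tStar (Z s).1 = 0 := by
  obtain ⟨s, hs, h0⟩ := intermediate_value_Icc' h.radial.S_nonneg h.radial.continuousOn_T
    ⟨hneg.le, hT.le⟩
  refine ⟨s, ⟨lt_of_le_of_ne hs.1 fun h1 => ?_, hs.2⟩, h0⟩
  rw [← h1] at h0
  exact hT.ne' h0

end BackRay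

/-! ### The distribution function on the horizon -/

theorem radialVel_neg_eq (x : Spacetime) (v : E3) : radialVel x.2 (-v) = -pR x (0, v) := by
  simp [radialVel, pR, neg_div]

theorem angMomSq_neg_right (y v : E3) : angMomSq y (-v) = angMomSq y v := by
  simp [angMomSq]

theorem angMomSq_eq_of_radius_pos {x : Spacetime} (hx : 0 < radius x) (v : E3) :
    angMomSq x.2 v = radius x ^ 2 * ‖pAng x (0, v)‖ ^ 2 := by
  have h0 : x.2 ≠ 0 := norm_pos_iff.mp hx
  rw [norm_pAng_sq h0]
  simp only [angMomSq, pR, radius]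
  field_simp [norm_ne_zero_iff.mpr h0]

theorem timeRate_eq_pTOf {m : ℝ} (hm : 0 < m) {x : Spacetime} (hx : radius x = m) {v : E3}
    (hv : pR x (0, v) < 0) :
    timeRate (angMomSq x.2 v) (-pR x (0, v)) x.2 (-v) = pTOf m x v := by
  have hx' : ‖x.2‖ = m := hx
  rw [timeRate, advancedRate, radialVel_neg_eq, angMomSq_eq_of_radius_pos (hx ▸ hm), pTOf, if_pos hx,
    abs_of_neg hv, hx, hx']
  have := neg_pos.mpr hv
  field_simp
  ring

variable {m R : ℝ} {f₀ : initialShell m R → ℝ} {f : Phase → ℝ} {x : Spacetime}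

theorem exists_backRay (hm : 0 < m) (hx : x ∈ horizon m) {v : E3} (hv : pR x (0, v) < 0)
    (hL : 0 < angMomSq x.2 v) :
    ∃ (S : ℝ) (Z : ℝ → Phase), BackRay m (angMomSq x.2 v) (-pR x (0, v)) S Z ∧
      Z 0 = (x, (pTOf m x v, v)) ∧ tStar (Z S).1 < 0 := by
  have hE : 0 < radialVel x.2 (-v) := by rw [radialVel_neg_eq]; linarith
  obtain ⟨s₁, -, V, hV, Z, -, hZ, hneg⟩ := exists_local_backRays hm (y₀ := x.2) (u₀ := -v) hx.1 hE
    (by rwa [angMomSq_neg_right]) hx.2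
  obtain ⟨hB, hZ0⟩ := hZ _ (mem_of_mem_nhds hV)
  rw [radialVel_neg_eq, angMomSq_neg_right] at hB hZ0
  rw [timeRate_eq_pTOf hm hx.1 hv, neg_neg] at hZ0
  exact ⟨s₁, Z (-v), hB, hZ0, hneg⟩

/-- The value is f₀ at the crossing with τ = 0. Strict monotonicity of τ along the reference ray
gives opposite signs of τ at σ ± ε'; these signs persist for nearby rays and confine their crossing
parameters to a neighbourhood of σ, so the crossing points converge. -/
theorem IsVlasovSolution.continuousOn_fibre (hf : IsVlasovSolution m R f₀ f) (hf₀ : Continuous f₀)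
    (hm : 0 < m) (hR : m < R) (hx : x ∈ horizon m) :
    ContinuousOn (fun v => f (x, (pTOf m x v, v)))
      {v | pR x (0, v) < 0 ∧ 0 < angMomSq x.2 v} := by
  rintro v₀ ⟨hv₀, hL₀⟩
  have hE₀ : 0 < radialVel x.2 (-v₀) := by rw [radialVel_neg_eq]; linarith
  obtain ⟨s₁, hs₁, V, hV, Z, hZc, hZ, hneg⟩ := exists_local_backRays hm (y₀ := x.2) (u₀ := -v₀)
    hx.1 hE₀ (by rwa [angMomSq_neg_right]) hx.2
  have hVmem := mem_of_mem_nhds hV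
  have hB₀ := (hZ _ hVmem).1
  have hT0 : ∀ u ∈ V, 0 < tStar (Z u 0).1 := fun u hu => by rw [(hZ u hu).2]; exact hx.2
  obtain ⟨σ, hσ, hτ⟩ := hB₀.exists_tau_eq_zero hR (hT0 _ hVmem) hneg
  have hσlt : σ < s₁ := by
    refine lt_of_le_of_ne hσ.2 fun h => ?_
    rw [h] at hτ
    linarith [tau_le_tStar hm hR (Z (-v₀) s₁).1]
  have hanti := hB₀.strictAntiOn_tau hR
  have hZat : ∀ s, ContinuousAt (fun p : E3 × ℝ => Z p.1 p.2) (-v₀, s) := fun s =>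
    hZc.continuousAt (prod_mem_nhds hV univ_mem)
  have hτat : ∀ s ∈ Ioc 0 s₁, ContinuousAt (fun u => tau m R (Z u s).1) (-v₀) := fun s hs => by
    have h1 : ContinuousAt (fun u => (Z u s).1) (-v₀) :=
      (ContinuousAt.comp (f := fun u : E3 => (u, s)) (g := fun p : E3 × ℝ => Z p.1 p.2) (hZat s)
        (by fun_prop)).fst
    exact ContinuousAt.comp (g := tau m R) (f := fun u => (Z u s).1)
      (continuousAt_tau hm hR (hB₀.radial.lt_r s hs)) h1
  have hmem : ∀ u ∈ V, ∀ s ∈ Ioc 0 s₁, tau m R (Z u s).1 = 0 → Z u s ∈ initialShell m R :=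
    fun u hu s hs h0 => ⟨(hZ u hu).1.mem_massShell (Ioc_subset_Icc_self hs), h0⟩
  have hval : ∀ u, ∀ hu : u ∈ V, pR x (0, -u) < 0 → ∀ s, ∀ hs : s ∈ Ioc 0 s₁, ∀ h0 : tau m R (Z u s).1 = 0,
      f (x, (pTOf m x (-u), -u))
        = f₀ ⟨Z u s, hmem u hu s hs h0⟩ := by
    intro u hu hp s hs h0
    have h1 := (hZ u hu).1.transport hf hR (hT0 u hu) hs h0
    have h2 := timeRate_eq_pTOf hm hx.1 hp
    rw [angMomSq_neg_right, ← radialVel_neg_eq, neg_neg] at h2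
    rw [← h2]
    exact (congrArg f (hZ u hu).2).symm.trans h1
  set z₀ : initialShell m R :=
    ⟨Z (-v₀) σ, hB₀.mem_massShell (Ioc_subset_Icc_self hσ), hτ⟩ with hz₀
  rw [Metric.continuousWithinAt_iff']
  intro η hη
  have hW : {z | dist (f₀ z) (f₀ z₀) < η} ∈ 𝓝 z₀ :=
    hf₀.continuousAt.eventually (Metric.ball_mem_nhds _ hη)
  rw [nhds_subtype, mem_comap] at hW
  obtain ⟨W, hW, hWη⟩ := hW
  have hZW := (hZat σ).eventually hW
  rw [nhds_prod_eq] at hZW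
  obtain ⟨U, hU, I, hI, hUI⟩ := eventually_prod_iff.mp hZW
  obtain ⟨ε, hε, hball⟩ := Metric.eventually_nhds_iff.mp hI
  -- The last two bounds keep σ ± ε' inside (0, s₁].
  set ε' : ℝ := min (ε / 2) (min (σ / 2) ((s₁ - σ) / 2)) with hε'
  have h0ε : 0 < ε' := lt_min (by linarith) (lt_min (by linarith [hσ.1]) (by linarith))
  have h1ε : ε' ≤ ε / 2 := min_le_left _ _
  have h2ε : ε' ≤ σ / 2 := (min_le_right _ _).trans (min_le_left _ _)
  have h3ε : ε' ≤ (s₁ - σ) / 2 := (min_le_right _ _).trans (min_le_right _ _)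
  have ha : σ - ε' ∈ Ioc 0 s₁ := ⟨by linarith [hσ.1], by linarith⟩
  have hb : σ + ε' ∈ Ioc 0 s₁ := ⟨by linarith [hσ.1], by linarith⟩
  have hpos : 0 < tau m R (Z (-v₀) (σ - ε')).1 := hτ ▸ hanti ha hσ (by linarith)
  have hlt : tau m R (Z (-v₀) (σ + ε')).1 < 0 := hτ ▸ hanti hσ hb (by linarith)
  have ev : ∀ᶠ u in 𝓝 (-v₀), u ∈ V ∧ U u ∧ 0 < tau m R (Z u (σ - ε')).1 ∧
      tau m R (Z u (σ + ε')).1 < 0 := by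
    filter_upwards [hV, hU, (hτat _ ha).eventually (lt_mem_nhds hpos),
      (hτat _ hb).eventually (gt_mem_nhds hlt)] with u h1 h2 h3 h4
    exact ⟨h1, h2, h3, h4⟩
  have ev' := (continuous_neg (G := E3)).continuousAt.eventually ev
  filter_upwards [mem_nhdsWithin_of_mem_nhds ev', self_mem_nhdsWithin] with v hv hvmem
  obtain ⟨huV, huU, hua, hub⟩ := hv
  have hc := ((hZ _ huV).1.continuousOn_tau hR).mono
    (fun t ht => ⟨ha.1.trans_le ht.1, ht.2.trans hb.2⟩ : Icc (σ - ε') (σ + ε') ⊆ Ioc 0 s₁)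
  obtain ⟨t, ht, ht0⟩ := intermediate_value_Icc' (by linarith) hc ⟨hub.le, hua.le⟩
  have htmem : t ∈ Ioc 0 s₁ := ⟨ha.1.trans_le ht.1, ht.2.trans hb.2⟩
  have e1 := hval _ huV (by rw [neg_neg]; exact hvmem.1) t htmem ht0
  have e2 := hval _ hVmem (by rwa [neg_neg]) σ hσ hτ
  rw [neg_neg] at e1 e2
  rw [e1, e2]
  refine hWη (hUI huU (hball ?_))
  rw [Real.dist_eq, abs_lt]
  constructor <;> linarith [ht.1, ht.2]

end ERN

namespace ERN
open Set Filter Topology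

/-! ### Momentum support and lower bounds on the horizon -/

variable {m R Cr Cp : ℝ} {f₀ : initialShell m R → ℝ} {f : Phase → ℝ} {x : Spacetime}

theorem angMomSq_of_mem_horizon (hm : 0 < m) (hx : x ∈ horizon m) (v : E3) :
    angMomSq x.2 v = (m * ‖pAng x (0, v)‖) ^ 2 := by
  rw [angMomSq_eq_of_radius_pos (hx.1.symm ▸ hm), hx.1, mul_pow]

theorem IsVlasovSolution.exists_eq_initial (hf : IsVlasovSolution m R f₀ f) (hm : 0 < m)
    (hR : m < R) (hx : x ∈ horizon m) {v : E3} (hv : pR x (0, v) < 0)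
    (hL : 0 < angMomSq x.2 v) : ∃ z, f (x, (pTOf m x v, v)) = f₀ z := by
  obtain ⟨S, Z, hB, hZ0, hneg⟩ := exists_backRay hm hx hv hL
  have hT0 : 0 < tStar (Z 0).1 := by rw [hZ0]; exact hx.2
  obtain ⟨s, hs, hτ⟩ := hB.exists_tau_eq_zero hR hT0 hneg
  exact ⟨_, hZ0 ▸ hB.transport hf hR hT0 hs hτ⟩

/-- `late_arrival` applied to the part of the ray between the horizon and its crossing with the
initial hypersurface, where the support condition bounds position and momentum; λ = m²|p̸|²
translates the outcome to the fibre. -/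
theorem IsVlasovSolution.support_subset (hf : IsVlasovSolution m R f₀ f) (hm : 0 < m)
    (hR : 2 * m < R) (hsupp : SupportBound m R Cr Cp f₀) (hx : x ∈ horizon m) {v : E3}
    (hv : pR x (0, v) < 0) (hL : 0 < angMomSq x.2 v)
    (hτ : 110 * (m + Cr ^ 2 / m) < tStar x) (hne : f (x, (pTOf m x v, v)) ≠ 0) :
    m ≤ Cr ∧ -pR x (0, v) ≤ Cp ∧
      ((-pR x (0, v) * ((tStar x - 110 * (m + Cr ^ 2 / m)) / m) ^ 2 ≤ 256 * Cp ∧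
          ‖pAng x (0, v)‖ ^ 2 ≤ 16 * Cp * -pR x (0, v)) ∨
        (‖pAng x (0, v)‖ ^ 2 ≤ 256 / 9 * pR x (0, v) ^ 2 ∧ ∀ k ≤ 6,
          |1 - ‖pAng x (0, v)‖ ^ 2 / pR x (0, v) ^ 2 / 16|
            * ((tStar x - 110 * (m + Cr ^ 2 / m)) / m) ^ k ≤ 1440 * 1216 ^ k)) := by
  obtain ⟨S, Z, hB, hZ0, hneg⟩ := exists_backRay hm hx hv hL
  have hT0 : 0 < tStar (Z 0).1 := by rw [hZ0]; exact hx.2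
  obtain ⟨s, hs, hs0⟩ := hB.exists_tau_eq_zero (R := R) (by linarith) hT0 hneg
  have htr := hB.transport hf (by linarith) hT0 hs hs0
  rw [hZ0] at htr
  rw [htr] at hne
  obtain ⟨b1, b2, b3, -⟩ := hsupp (subset_tsupport f₀ hne)
  have hs' := Ioc_subset_Icc_self hs
  have hray := hB.radial.mono hs.1.le hs.2
  have hT := tStar_le_of_tau_eq_zero hm hR (hB.radial.lt_r s hs) hs0
  have key := hray.late_arrival (Cp := Cp) (Cr := Cr) (by rw [← hB.pT_eq s hs']; exact b2)
    (by rwa [abs_neg]) b1 (by linarith) (by rw [hZ0]; exact hτ)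
  rw [angMomSq_of_mem_horizon hm hx, hZ0] at key
  refine ⟨(hB.radial.lt_r s hs).le.trans b1, key.1, ?_⟩
  simp only [neg_sq, mul_pow, mul_neg, neg_mul] at key ⊢
  have hm2 : 0 < m ^ 2 := by positivity
  refine key.2.imp (fun h => ⟨h.1, ?_⟩) fun h => ⟨?_, ?_⟩
  · have := h.2
    nlinarith
  · have := h.1
    nlinarith
  · have h2 := h.2
    rwa [mul_div_mul_left _ _ hm2.ne'] at h2

-- The windows for E and |p̸| form a box inside the region 4L ≤ E τ ≤ 8L of `early_position`, with L
-- = m|p̸|; the ratio 3/2 between the ends of the energy window is what makes both inequalities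
-- hold. The choice of `E₁` places the traced-back momentum below Cp/2.
set_option maxHeartbeats 1000000 in
theorem IsVlasovSolution.inf_le (hf : IsVlasovSolution m R f₀ f) (hm : 0 < m) (hR : 2 * m < R)
    (hf₀ : ∀ z, 0 ≤ f₀ z) (hCp : 0 < Cp) {δ : ℝ} (hδ : 0 < δ) (hδ' : δ < 1 / 2)
    (hx : x ∈ horizon m)
    (hτ : 64 * m / δ < tStar x) {v : E3} {E₁ : ℝ} (hE₁ : E₁ = Cp * m ^ 2 / (8 * tStar x ^ 2))
    (hv1 : E₁ ≤ -pR x (0, v)) (hv2 : -pR x (0, v) ≤ 3 / 2 * E₁)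
    (ha1 : 3 / 2 * (E₁ * tStar x / (8 * m)) ≤ ‖pAng x (0, v)‖)
    (ha2 : ‖pAng x (0, v)‖ ≤ 2 * (E₁ * tStar x / (8 * m))) :
    infAlmostGenerators m R Cp 1 δ f₀ ≤ f (x, (pTOf m x v, v)) := by
  have hT : 0 < tStar x := hx.2
  have hE₁0 : 0 < E₁ := by rw [hE₁]; positivity
  set t := tStar x with ht
  set ρ := ‖pAng x (0, v)‖ with hρdef
  have hρ : 0 < ρ := lt_of_lt_of_le (by positivity) ha1
  have hv : pR x (0, v) < 0 := by linarith
  have hlam := angMomSq_of_mem_horizon hm hx v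
  have hL : 0 < angMomSq x.2 v := by rw [hlam]; positivity
  obtain ⟨S, Z, hB, hZ0, hneg⟩ := exists_backRay hm hx hv hL
  have hT0 : 0 < tStar (Z 0).1 := by rw [hZ0]; exact hx.2
  obtain ⟨s, hs, hs0⟩ := hB.exists_tStar_eq_zero hT0 hneg
  have hs' := Ioc_subset_Icc_self hs
  have hray := hB.radial.mono hs.1.le hs.2
  have ha1' : 3 / 2 * (E₁ * t) ≤ 8 * (m * ρ) := by
    have := mul_le_mul_of_nonneg_left ha1 (by positivity : 0 ≤ 8 * m)
    have e : 8 * m * (3 / 2 * (E₁ * t / (8 * m))) = 3 / 2 * (E₁ * t) := by field_simp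
    linarith
  have ha2' : 4 * (m * ρ) ≤ E₁ * t := by
    have := mul_le_mul_of_nonneg_left ha2 (by positivity : 0 ≤ 4 * m)
    have e : 4 * m * (2 * (E₁ * t / (8 * m))) = E₁ * t := by field_simp; ring
    linarith
  have h64 : 64 * m < δ * t := by rw [div_lt_iff₀ hδ] at hτ; linarith
  have h64' : 64 * m ≤ t := by nlinarith
  obtain ⟨hg, hr43, hq1, hq2⟩ := hray.early_position (mul_pos hm hρ) hlam hs0
    (by rw [hZ0]; exact h64') (by rw [hZ0]; change _ * t ≤ _; nlinarith)
    (by rw [hZ0]; change _ ≤ _ * t; nlinarith)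
  rw [hZ0] at hq1 hq2
  change m ≤ t * _ at hq1
  change t * _ ≤ 8 * m at hq2
  set r := radius (Z s).1 with hrdef
  have hrm : m < r := hB.radial.lt_r s hs
  have hr0 : 0 < r := hm.trans hrm
  have hrR : r ≤ R := by linarith
  have hτ0 : tau m R (Z s).1 = 0 := by rw [tau_of_radius_le hrR]; exact hs0
  have htr := hB.transport hf (by linarith) hT0 hs hτ0
  rw [hZ0] at htr
  have hla : lapseSq m r = ((r - m) / r) ^ 2 := lapseSq_eq m hr0.ne'
  set o := (r - m) / r with ho
  have ho0 : 0 < o := div_pos (by linarith) hr0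
  have ho1 : o ≤ 1 := by rw [ho, div_le_one hr0]; linarith
  have hqo : m * (r - m) / r ^ 2 ≤ o := by
    rw [ho, div_le_div_iff₀ (by positivity) hr0]
    have : 0 ≤ (r - m) * r * (r - m) := by
      have := sub_pos.mpr hrm
      positivity
    nlinarith
  have hmo : m ≤ t * o := hq1.trans (mul_le_mul_of_nonneg_left hqo hT.le)
  have hmo2 : m ^ 2 ≤ t ^ 2 * o ^ 2 := by rw [← mul_pow]; exact pow_le_pow_left₀ hm.le hmo 2
  have hE₁t : 8 * (E₁ * t ^ 2) = Cp * m ^ 2 := by rw [hE₁]; field_simp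
  -- With o² = Ω², the lower bound m ≤ t o for the starting distance turns E₁ ~ Cp m²/t² into E ≲ Cp
  -- Ω²; all momentum conditions of 𝔅_δ follow from this.
  have hE₁o : 8 * E₁ ≤ Cp * o ^ 2 := by
    have : 8 * E₁ * t ^ 2 ≤ Cp * o ^ 2 * t ^ 2 := by nlinarith
    exact le_of_mul_le_mul_right this (by positivity)
  have habs := hray.abs_g_le (right_mem_Icc.mpr hs.1.le)
  rw [abs_le] at habs
  suffices hmem : (⟨Z s, hB.mem_massShell hs', hτ0⟩ : initialShell m R) ∈
      almostGenerators m R Cp 1 δ by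
    rw [htr, ← abs_of_nonneg (hf₀ _)]
    exact csInf_le ⟨0, by rintro _ ⟨z, -, rfl⟩; exact abs_nonneg _⟩ ⟨_, hmem, rfl⟩
  refine ⟨hrm.le, ?_, ?_, ?_, ?_, ?_⟩
  · change r ≤ _
    have h1 : t * (m * (r - m)) ≤ 8 * m * r ^ 2 := by
      rwa [← mul_div_assoc, div_le_iff₀ (by positivity)] at hq2
    have h2 : r ^ 2 ≤ 16 / 9 * m ^ 2 := by
      have := pow_le_pow_left₀ hr0.le (by linarith : r ≤ 4 / 3 * m) 2
      linarith [mul_pow (4 / 3) m 2]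
    have h3 : t * (r - m) ≤ 15 * m ^ 2 := by
      refine le_of_mul_le_mul_left (?_ : m * _ ≤ m * _) hm
      have := mul_le_mul_of_nonneg_left h2 hm.le
      have : 0 < m ^ 3 := by positivity
      linarith
    have h4 : t * (r - m) ≤ t * (δ * m) := by
      have := mul_lt_mul_of_pos_right h64 hm
      have : 0 < m ^ 2 := by positivity
      linarith
    linarith [le_of_mul_le_mul_left h4 hT]
  -- The ray starts outgoing, so the lower bound on p^r is automatic and K = 1 suffices.
  · have : 0 ≤ pR (Z s).1 (Z s).2 := by linarith
    refine le_trans ?_ this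
    rw [neg_nonpos]
    positivity
  · change _ ≤ Cp * lapseSq m r
    rw [hla]
    linarith
  · change _ ≤ 1 * Cp * lapseSq m r ^ (1 / 4 : ℝ)
    have h1 : o ≤ lapseSq m r ^ (1 / 4 : ℝ) := by
      rw [hla, ← Real.rpow_natCast, ← Real.rpow_mul ho0.le]
      calc o = o ^ (1 : ℝ) := (Real.rpow_one o).symm
        _ ≤ _ := Real.rpow_le_rpow_of_exponent_ge ho0 ho1 (by norm_num)
    have h2 := hB.norm_pAng s hs'
    rw [hlam] at h2
    have h3 : ‖pAng (Z s).1 (Z s).2‖ * r = m * ρ := by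
      rw [← mul_pow] at h2
      exact (pow_left_inj₀ (by positivity) (by positivity) two_ne_zero).mp h2
    have h4 : ‖pAng (Z s).1 (Z s).2‖ ≤ ρ := by
      refine le_of_mul_le_mul_right (?_ : _ * m ≤ _ * m) hm
      have := norm_nonneg (pAng (Z s).1 (Z s).2)
      nlinarith
    have h5 : ρ ≤ Cp * o := by
      have h6 : 32 * (m * ρ) * t ≤ Cp * m ^ 2 := by nlinarith
      have h7 : m * (ρ * t) ≤ m * (Cp * m) := by
        have : 0 < m * ρ * t := by positivity
        nlinarith
      have h8 : ρ * t ≤ Cp * m := le_of_mul_le_mul_left h7 hm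
      refine le_of_mul_le_mul_right (?_ : _ * t ≤ _ * t) hT
      nlinarith
    nlinarith
  · simp only
    rw [hB.pT_eq s hs']
    have h1 := hB.radial.P_mul_sq hs'
    beta_reduce at h1
    set P := angMomSq x.2 v / (radius (Z s).1 ^ 2 * (-pR x (0, v) + -pR (Z s).1 (Z s).2)) with hP
    have h2 : P * o ^ 2 = -pR x (0, v) - -pR (Z s).1 (Z s).2 := by
      rw [ho, div_pow, mul_div_assoc', div_eq_iff (by positivity)]
      exact h1
    -- E - g ≤ 2E ≤ 3E₁ ≤ (3/8) Cp Ω². As g ≤ 0, p^{t*} = P + g is at most P.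
    have h3 : P * o ^ 2 ≤ Cp / 2 * o ^ 2 := by rw [h2]; nlinarith
    linarith [le_of_mul_le_mul_right h3 (by positivity : 0 < o ^ 2)]

end ERN

namespace ERN
open Set Filter Topology MeasureTheory

/-! ### Cylindrical coordinates on momentum space -/

/-- The plane of angular momenta. -/
abbrev E2 : Type := EuclideanSpace ℝ (Fin 2)

/-- Coordinates in an orthonormal basis extending n: the radial component becomes one axis and the
angular part a plane, with Lebesgue measure preserved. -/
theorem exists_cylindrical {n : E3} (hn : ‖n‖ = 1) :
    ∃ Ψ : ℝ × E2 ≃ᵐ E3, MeasurePreserving Ψ ∧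
      ∀ a p, inner ℝ n (Ψ (a, p)) = a ∧ ‖Ψ (a, p) - a • n‖ = ‖p‖ := by
  obtain ⟨b, hb⟩ := Orthonormal.exists_orthonormalBasis_extension_of_card_eq
    (𝕜 := ℝ) (E := E3) (ι := Fin 3) (by simp) (v := fun _ => n) (s := {0})
    ⟨fun _ => hn, fun i j hij => (hij (Subsingleton.elim i j)).elim⟩
  have hb0 : b 0 = n := hb 0 rfl
  let e1 : ℝ × E2 ≃ᵐ ℝ × (Fin 2 → ℝ) :=
    (MeasurableEquiv.refl ℝ).prodCongr (MeasurableEquiv.toLp 2 (Fin 2 → ℝ)).symm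
  let e2 : ℝ × (Fin 2 → ℝ) ≃ᵐ (Fin 3 → ℝ) :=
    (MeasurableEquiv.piFinSuccAbove (fun _ : Fin 3 => ℝ) 0).symm
  let e3 : (Fin 3 → ℝ) ≃ᵐ E3 := MeasurableEquiv.toLp 2 (Fin 3 → ℝ)
  let e4 : E3 ≃ᵐ E3 := b.measurableEquiv.symm
  have h1 : MeasurePreserving e1 := (MeasurePreserving.id volume).prod
    (PiLp.volume_preserving_ofLp (Fin 2))
  have h2 : MeasurePreserving e2 := (volume_preserving_piFinSuccAbove (fun _ : Fin 3 => ℝ) 0).symm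
  have h3 : MeasurePreserving e3 := PiLp.volume_preserving_toLp (Fin 3)
  have h4 : MeasurePreserving e4 := b.measurePreserving_measurableEquiv.symm
  refine ⟨((e1.trans e2).trans e3).trans e4, h4.comp (h3.comp (h2.comp h1)), fun a p => ?_⟩
  have hΨ : (((e1.trans e2).trans e3).trans e4) (a, p) = a • n + (p 0 • b 1 + p 1 • b 2) := by
    change b.repr.symm (WithLp.toLp 2 (Fin.insertNth 0 a (WithLp.ofLp p))) = _
    rw [← b.sum_repr_symm, Fin.sum_univ_three]
    simp only [Fin.insertNth_zero, ← hb0, add_assoc]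
    rfl
  rw [hΨ, add_sub_cancel_left]
  have o01 : inner ℝ n (b 1) = 0 := by rw [← hb0]; simp
  have o02 : inner ℝ n (b 2) = 0 := by rw [← hb0]; simp
  constructor
  · rw [inner_add_right, inner_add_right, inner_smul_right, inner_smul_right, inner_smul_right, o01,
      o02, real_inner_self_eq_norm_sq, hn]
    simp
  · have h : ‖p 0 • b 1 + p 1 • b 2‖ ^ 2 = ‖p‖ ^ 2 := by
      rw [norm_add_sq_real, inner_smul_left, inner_smul_right, norm_smul, norm_smul,
        EuclideanSpace.norm_sq_eq, Fin.sum_univ_two]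
      simp
    exact (pow_left_inj₀ (norm_nonneg _) (norm_nonneg _) two_ne_zero).mp h

end ERN

/-! ### Areas in the angular plane and integrals over the fibre. -/

namespace ERN
open Set Filter Topology MeasureTheory

theorem lintegral_enorm_le_of_two_regions {α : Type*} [MeasurableSpace α] {μ : Measure α} {G : α → ℝ}
    {S₁ S₂ : Set α} (h₁ : MeasurableSet S₁) (h₂ : MeasurableSet S₂) {c₁ c₂ : ℝ}
    (h : ∀ᵐ p ∂μ, G p ≠ 0 → (p ∈ S₁ ∧ |G p| ≤ c₁) ∨ (p ∈ S₂ ∧ |G p| ≤ c₂)) :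
    ∫⁻ p, ‖G p‖ₑ ∂μ ≤ ENNReal.ofReal c₁ * μ S₁ + ENNReal.ofReal c₂ * μ S₂ := by
  rw [← lintegral_indicator_const h₁, ← lintegral_indicator_const h₂,
    ← lintegral_add_left (measurable_const.indicator h₁)]
  refine lintegral_mono_ae (h.mono fun p hp => ?_)
  by_cases h0 : G p = 0
  · simp [h0]
  have he : ‖G p‖ₑ = ENNReal.ofReal |G p| := by rw [Real.enorm_eq_ofReal_abs]
  rcases hp h0 with ⟨hS, hc⟩ | ⟨hS, hc⟩
  · rw [indicator_of_mem hS, he]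
    exact (ENNReal.ofReal_le_ofReal hc).trans le_self_add
  · rw [indicator_of_mem hS, he]
    exact (ENNReal.ofReal_le_ofReal hc).trans le_add_self

theorem volume_sq_norm_le {a : ℝ} (ha : 0 ≤ a) :
    volume {p : E2 | ‖p‖ ^ 2 ≤ a} = ENNReal.ofReal (Real.pi * a) := by
  have : {p : E2 | ‖p‖ ^ 2 ≤ a} = Metric.closedBall 0 √a := by
    ext p
    rw [mem_ofPred_eq, mem_closedBall_zero_iff, Real.le_sqrt (norm_nonneg _) ha]
  rw [this, EuclideanSpace.volume_closedBall_fin_two, ← ENNReal.ofReal_pow (Real.sqrt_nonneg a),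
    Real.sq_sqrt ha, ← ENNReal.ofReal_mul ha, mul_comm]

theorem volume_sq_norm_lt {a : ℝ} (ha : 0 ≤ a) :
    volume {p : E2 | ‖p‖ ^ 2 < a} = ENNReal.ofReal (Real.pi * a) := by
  have : {p : E2 | ‖p‖ ^ 2 < a} = Metric.ball 0 √a := by
    ext p
    rw [mem_ofPred_eq, mem_ball_zero_iff, Real.lt_sqrt (norm_nonneg _)]
  rw [this, EuclideanSpace.volume_ball_fin_two, ← ENNReal.ofReal_pow (Real.sqrt_nonneg a),
    Real.sq_sqrt ha, ← ENNReal.ofReal_mul ha, mul_comm]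

theorem volume_annulus {a b : ℝ} (ha : 0 ≤ a) (hab : a ≤ b) :
    volume {p : E2 | a ≤ ‖p‖ ^ 2 ∧ ‖p‖ ^ 2 ≤ b} = ENNReal.ofReal (Real.pi * (b - a)) := by
  have : {p : E2 | a ≤ ‖p‖ ^ 2 ∧ ‖p‖ ^ 2 ≤ b} = {p : E2 | ‖p‖ ^ 2 ≤ b} \ {p : E2 | ‖p‖ ^ 2 < a} := by
    ext p
    simp [and_comm]
  have hms : MeasurableSet {p : E2 | ‖p‖ ^ 2 < a} :=
    measurableSet_lt (by fun_prop) measurable_const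
  have hsub : {p : E2 | ‖p‖ ^ 2 < a} ⊆ {p : E2 | ‖p‖ ^ 2 ≤ b} :=
    fun p hp => (le_of_lt hp).trans hab
  rw [this, measure_sdiff hsub hms.nullMeasurableSet
    (by rw [volume_sq_norm_lt ha]; exact ENNReal.ofReal_ne_top), volume_sq_norm_le (ha.trans hab),
    volume_sq_norm_lt ha, ← ENNReal.ofReal_sub _ (by positivity), mul_sub]

theorem volume_critical_annulus_le {E ε : ℝ} (hE : 0 < E) (hε : 0 ≤ ε) :
    volume {p : E2 | ‖p‖ ^ 2 ≤ 256 / 9 * E ^ 2 ∧ |1 - ‖p‖ ^ 2 / E ^ 2 / 16| ≤ ε}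
      ≤ ENNReal.ofReal (32 * Real.pi * ε * E ^ 2) := by
  have hE2 : 0 < E ^ 2 := by positivity
  -- For ε ≥ 1 the annulus degenerates and the whole disc is used, as 256/9 < 32.
  rcases le_total 1 ε with h | h
  · calc _ ≤ volume {p : E2 | ‖p‖ ^ 2 ≤ 256 / 9 * E ^ 2} := measure_mono fun p hp => hp.1
      _ = ENNReal.ofReal (Real.pi * (256 / 9 * E ^ 2)) := volume_sq_norm_le (by positivity)
      _ ≤ _ := by
        refine ENNReal.ofReal_le_ofReal ?_
        have : Real.pi * (E ^ 2 * 1) ≤ Real.pi * (E ^ 2 * ε) := by gcongr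
        have : 0 < Real.pi * E ^ 2 := by positivity
        linarith
  · calc _ ≤ volume {p : E2 | 16 * E ^ 2 * (1 - ε) ≤ ‖p‖ ^ 2 ∧ ‖p‖ ^ 2 ≤ 16 * E ^ 2 * (1 + ε)} := by
          refine measure_mono fun p hp => ?_
          have h1 := abs_le.mp hp.2
          have h2 : ‖p‖ ^ 2 = ‖p‖ ^ 2 / E ^ 2 / 16 * (16 * E ^ 2) := by field_simp
          constructor <;> rw [h2] <;> nlinarith
      _ = ENNReal.ofReal (Real.pi * (16 * E ^ 2 * (1 + ε) - 16 * E ^ 2 * (1 - ε))) :=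
        volume_annulus (mul_nonneg (by positivity) (by linarith)) (by nlinarith)
      _ ≤ _ := ENNReal.ofReal_le_ofReal (by nlinarith)

/-! ### Integration over the fibre -/

variable {m : ℝ} {x : Spacetime}

theorem exists_fibre_coordinates (hm : 0 < m) (hx : radius x = m) :
    ∃ Ψ : ℝ × E2 ≃ᵐ E3, MeasurePreserving Ψ ∧
      ∀ a p, pR x (0, Ψ (a, p)) = a ∧ ‖pAng x (0, Ψ (a, p))‖ = ‖p‖ := by
  have hx' : ‖x.2‖ = m := hx
  obtain ⟨Ψ, hΨ, h⟩ := exists_cylindrical (n := m⁻¹ • x.2)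
    (by rw [norm_smul, hx', norm_inv, Real.norm_of_nonneg hm.le, inv_mul_cancel₀ hm.ne'])
  refine ⟨Ψ, hΨ, fun a p => ?_⟩
  obtain ⟨h1, h2⟩ := h a p
  have h3 : pR x (0, Ψ (a, p)) = a := by
    rw [real_inner_smul_left] at h1
    rw [pR, hx', div_eq_inv_mul]
    exact h1
  refine ⟨h3, ?_⟩
  rw [← h2, pAng, h3, hx', smul_smul, div_eq_mul_inv]

/-- Only the inequality of Tonelli's theorem is needed, and it holds for arbitrary `H`;
measurability of the integrand plays no role in the upper bound. -/
theorem setLIntegral_le_of_preimage_eq {Ψ : ℝ × E2 ≃ᵐ E3} (hΨ : MeasurePreserving Ψ) {s : Set ℝ}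
    {A : Set E3} (hA : Ψ ⁻¹' A = s ×ˢ univ) (H : E3 → ENNReal) :
    ∫⁻ v in A, H v ≤ ∫⁻ a in s, ∫⁻ p, H (Ψ (a, p)) := by
  rw [← hΨ.setLIntegral_comp_preimage_emb Ψ.measurableEmbedding, hA, Measure.volume_eq_prod,
    ← Measure.prod_restrict, Measure.restrict_univ]
  exact lintegral_prod_le _

/-- Slices at fixed E. In the near-generator region the slice has area at most 16π Cp E, cancelling
the 1/E of the integrand, and E ranges over [0, E₁]. In the nearly trapped region the area is at
most 32π ε E², against an integrand c₂ E, with E ranging over [0, Cp]. -/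
theorem lintegral_ingoing_le (hm : 0 < m) (hx : radius x = m) {H : E3 → ℝ}
    {E₁ Cp c₁ c₂ ε : ℝ} (hE₁ : 0 ≤ E₁) (hCp : 0 ≤ Cp) (hc₁ : 0 ≤ c₁) (hc₂ : 0 ≤ c₂) (hε : 0 ≤ ε)
    (h : ∀ v, pR x (0, v) < 0 → 0 < ‖pAng x (0, v)‖ → H v ≠ 0 → -pR x (0, v) ≤ Cp ∧
      ((-pR x (0, v) ≤ E₁ ∧ ‖pAng x (0, v)‖ ^ 2 ≤ 16 * Cp * -pR x (0, v) ∧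
          |H v| ≤ c₁ / -pR x (0, v)) ∨
        (‖pAng x (0, v)‖ ^ 2 ≤ 256 / 9 * pR x (0, v) ^ 2 ∧
          |1 - ‖pAng x (0, v)‖ ^ 2 / pR x (0, v) ^ 2 / 16| ≤ ε ∧ |H v| ≤ c₂ * -pR x (0, v)))) :
    ∫⁻ v in {v | pR x (0, v) < 0}, ‖H v‖ₑ
      ≤ ENNReal.ofReal (16 * Real.pi * Cp * c₁ * E₁ + 32 * Real.pi * ε * c₂ * Cp ^ 4) := by
  obtain ⟨Ψ, hΨ, hco⟩ := exists_fibre_coordinates hm hx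
  have hpre : Ψ ⁻¹' {v | pR x (0, v) < 0} = Iio 0 ×ˢ univ := by
    ext ⟨a, p⟩
    simp [(hco a p).1]
  refine (setLIntegral_le_of_preimage_eq hΨ hpre _).trans ?_
  set α := 16 * Real.pi * Cp * c₁ with hα
  set β := 32 * Real.pi * ε * c₂ * Cp ^ 3 with hβ
  have hα0 : 0 ≤ α := by positivity
  have hβ0 : 0 ≤ β := by positivity
  have hinner : ∀ a ∈ Iio (0 : ℝ), ∫⁻ p, ‖H (Ψ (a, p))‖ₑ ≤
      (Icc (-E₁) 0).indicator (fun _ => ENNReal.ofReal α) a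
        + (Icc (-Cp) 0).indicator (fun _ => ENNReal.ofReal β) a := by
    intro a ha
    rw [mem_Iio] at ha
    have hE : 0 < -a := neg_pos.mpr ha
    -- The restrictions on a are put into the planar sets, which become empty outside the admissible
    -- energy ranges.
    have h1 := lintegral_enorm_le_of_two_regions (μ := volume) (G := fun p => H (Ψ (a, p)))
      (S₁ := {p | -a ≤ E₁ ∧ ‖p‖ ^ 2 ≤ 16 * Cp * -a})
      (S₂ := {p | -a ≤ Cp ∧ ‖p‖ ^ 2 ≤ 256 / 9 * (-a) ^ 2 ∧ |1 - ‖p‖ ^ 2 / (-a) ^ 2 / 16| ≤ ε})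
      (c₁ := c₁ / -a) (c₂ := c₂ * -a) (by measurability)
      (by measurability) ?_
    · refine h1.trans (add_le_add ?_ ?_)
      · by_cases hc : -a ≤ E₁
        · simp only [hc, true_and]
          rw [indicator_of_mem (by exact ⟨by linarith, ha.le⟩), volume_sq_norm_le (by positivity),
            ← ENNReal.ofReal_mul (by positivity)]
          refine ENNReal.ofReal_le_ofReal (le_of_eq ?_)
          have := ha.ne
          rw [hα]
          field_simp
        · simp [hc]
      · by_cases hc : -a ≤ Cp
        · simp only [hc, true_and]
          rw [indicator_of_mem (by exact ⟨by linarith, ha.le⟩)]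
          refine (mul_le_mul_right (volume_critical_annulus_le hE hε) _).trans ?_
          rw [← ENNReal.ofReal_mul (by positivity)]
          refine ENNReal.ofReal_le_ofReal ?_
          rw [hβ]
          have h3 : (-a) ^ 3 ≤ Cp ^ 3 := pow_le_pow_left₀ hE.le hc 3
          have := mul_le_mul_of_nonneg_left h3 (by positivity : 0 ≤ 32 * Real.pi * ε * c₂)
          linarith
        · simp [hc]
    · have h0 : ∀ᵐ p : E2, p ≠ 0 := by
        rw [ae_iff]
        simp
      filter_upwards [h0] with p hp hne
      have := h (Ψ (a, p)) (by rw [(hco a p).1]; exact ha)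
        (by rw [(hco a p).2]; exact norm_pos_iff.mpr hp) hne
      rw [(hco a p).1, (hco a p).2] at this
      obtain ⟨hC, ⟨k1, k2, k3⟩ | ⟨k1, k2, k3⟩⟩ := this
      · exact Or.inl ⟨⟨k1, k2⟩, k3⟩
      · refine Or.inr ⟨⟨hC, ?_, ?_⟩, k3⟩ <;> rwa [neg_sq]
  refine (setLIntegral_mono' measurableSet_Iio hinner).trans ?_
  refine (setLIntegral_le_lintegral _ _).trans ?_
  rw [lintegral_add_left (measurable_const.indicator measurableSet_Icc),
    lintegral_indicator_const measurableSet_Icc, lintegral_indicator_const measurableSet_Icc,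
    Real.volume_Icc, Real.volume_Icc, ← ENNReal.ofReal_mul hα0, ← ENNReal.ofReal_mul hβ0,
    ← ENNReal.ofReal_add (mul_nonneg hα0 (by linarith)) (mul_nonneg hβ0 (by linarith))]
  refine ENNReal.ofReal_le_ofReal (le_of_eq ?_)
  rw [hα, hβ]
  ring

theorem volume_fibre_shell (hm : 0 < m) (hx : radius x = m) {e₁ e₂ a b : ℝ} (he : e₁ ≤ e₂)
    (ha : 0 ≤ a) (hab : a ≤ b) :
    volume {v | -pR x (0, v) ∈ Icc e₁ e₂ ∧ a ≤ ‖pAng x (0, v)‖ ^ 2 ∧ ‖pAng x (0, v)‖ ^ 2 ≤ b}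
      = ENNReal.ofReal ((e₂ - e₁) * (Real.pi * (b - a))) := by
  obtain ⟨Ψ, hΨ, hco⟩ := exists_fibre_coordinates hm hx
  have hpre : Ψ ⁻¹' {v | -pR x (0, v) ∈ Icc e₁ e₂ ∧ a ≤ ‖pAng x (0, v)‖ ^ 2 ∧
      ‖pAng x (0, v)‖ ^ 2 ≤ b} = Icc (-e₂) (-e₁) ×ˢ {p : E2 | a ≤ ‖p‖ ^ 2 ∧ ‖p‖ ^ 2 ≤ b} := by
    ext ⟨c, p⟩
    simp only [mem_preimage, mem_ofPred_eq, mem_prod, (hco c p).1, (hco c p).2, mem_Icc]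
    refine and_congr_left fun _ => ?_
    constructor <;> rintro ⟨h1, h2⟩ <;> constructor <;> linarith
  rw [← hΨ.measure_preimage_equiv, hpre, Measure.volume_eq_prod, Measure.prod_prod,
    Real.volume_Icc, volume_annulus ha hab, ← ENNReal.ofReal_mul (by linarith)]
  congr 1
  ring

/-- Equality in Cauchy–Schwarz: these vectors lie on the line spanned by y. -/
theorem volume_angMomSq_eq_zero {y : E3} (hy : y ≠ 0) : volume {v | angMomSq y v = 0} = 0 := by
  refine measure_mono_null (t := (Submodule.span ℝ {y} : Submodule ℝ E3)) (fun v hv => ?_)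
    (Measure.addHaar_submodule _ _ fun htop => ?_)
  · have hy2 : ‖y‖ ^ 2 ≠ 0 := pow_ne_zero 2 (norm_ne_zero_iff.mpr hy)
    have h : ‖v - (inner ℝ y v / ‖y‖ ^ 2) • y‖ ^ 2 = 0 := by
      have hv' : ‖y‖ ^ 2 * ‖v‖ ^ 2 - inner ℝ y v ^ 2 = 0 := hv
      rw [real_inner_comm] at hv'
      rw [norm_sub_sq_real, inner_smul_right, real_inner_comm, norm_smul, mul_pow, Real.norm_eq_abs,
        sq_abs]
      field_simp
      linarith
    have h' : v - (inner ℝ y v / ‖y‖ ^ 2) • y = 0 := by simpa using h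
    rw [sub_eq_zero.mp h']
    exact Submodule.smul_mem _ _ (Submodule.mem_span_singleton_self y)
  · have h1 := finrank_span_singleton (K := ℝ) hy
    rw [htop, finrank_top] at h1
    simp at h1

theorem isOpen_ingoing (x : Spacetime) : IsOpen {v | pR x (0, v) < 0} := by
  refine isOpen_lt ?_ continuous_const
  unfold pR
  fun_prop

theorem ingoing_ae_eq (hm : 0 < m) (hx : radius x = m) :
    {v | pR x (0, v) < 0 ∧ 0 < angMomSq x.2 v} =ᵐ[volume] {v | pR x (0, v) < 0} := by
  have h0 : ∀ᵐ v : E3, angMomSq x.2 v ≠ 0 := by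
    rw [ae_iff]
    simpa using volume_angMomSq_eq_zero (norm_pos_iff.mp (hm.trans_eq hx.symm))
  filter_upwards [h0] with v hv
  refine propext (and_iff_left (lt_of_le_of_ne ?_ hv.symm))
  rw [angMomSq_eq_of_radius_pos (hx ▸ hm)]
  positivity

end ERN

namespace ERN
open Set Filter Topology MeasureTheory

/-! ### The moments on the horizon -/

/-- The integrand of the moment with weight `(p^{t*})^{2-j} (-p^r)^j f` on the horizon. -/
def horizonIntegrand (m : ℝ) (f : Phase → ℝ) (x : Spacetime) (j : ℕ) (v : E3) : ℝ :=
  pTOf m x v ^ (2 - j) * (-pR x (0, v)) ^ j * f (x, (pTOf m x v, v)) / -pR x (0, v)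

theorem continuous_pR_right (x : Spacetime) : Continuous fun v : E3 => pR x (0, v) := by
  unfold pR
  fun_prop

theorem continuous_pAng_right (x : Spacetime) : Continuous fun v : E3 => pAng x (0, v) := by
  have := continuous_pR_right x
  unfold pAng
  fun_prop

variable {m R Cr Cp : ℝ} {f₀ : initialShell m R → ℝ} {f : Phase → ℝ} {x : Spacetime}

theorem pTOf_of_mem_horizon (hx : radius x = m) {v : E3} (hv : pR x (0, v) < 0) :
    pTOf m x v = -pR x (0, v) + ‖pAng x (0, v)‖ ^ 2 / (2 * -pR x (0, v)) := by
  rw [pTOf, if_pos hx, abs_of_neg hv]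

theorem pTOf_pos (hx : radius x = m) {v : E3} (hv : pR x (0, v) < 0) : 0 < pTOf m x v := by
  rw [pTOf_of_mem_horizon hx hv]
  have := neg_pos.mpr hv
  positivity

theorem continuousOn_pTOf (hx : radius x = m) :
    ContinuousOn (pTOf m x) {v | pR x (0, v) < 0} := by
  have h1 := (continuous_pR_right x).neg.continuousOn (s := {v | pR x (0, v) < 0})
  have h2 := (continuous_pAng_right x).continuousOn (s := {v | pR x (0, v) < 0})
  refine (h1.add ((h2.norm.pow 2).div (continuousOn_const.mul h1) fun v hv => ?_)).congr
    fun v hv => pTOf_of_mem_horizon hx hv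
  have : pR x (0, v) < 0 := hv
  exact mul_ne_zero two_ne_zero (neg_pos.mpr this).ne'

theorem aestronglyMeasurable_horizonIntegrand (hf : IsVlasovSolution m R f₀ f)
    (hf₀ : Continuous f₀) (hm : 0 < m) (hR : m < R) (hx : x ∈ horizon m) (j : ℕ) :
    AEStronglyMeasurable (horizonIntegrand m f x j)
      (volume.restrict {v | pR x (0, v) < 0}) := by
  rw [← Measure.restrict_congr_set (ingoing_ae_eq hm hx.1)]
  have hsub : {v | pR x (0, v) < 0 ∧ 0 < angMomSq x.2 v} ⊆ {v | pR x (0, v) < 0} :=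
    fun v hv => hv.1
  have h1 := (continuous_pR_right x).neg.continuousOn
    (s := {v | pR x (0, v) < 0 ∧ 0 < angMomSq x.2 v})
  have h2 := (continuousOn_pTOf (m := m) hx.1).mono hsub
  have h3 := hf.continuousOn_fibre hf₀ hm hR hx
  refine ContinuousOn.aestronglyMeasurable (((h2.pow (2 - j)).mul (h1.pow j)).mul h3 |>.div h1
    fun v hv => (neg_pos.mpr hv.1).ne') ?_
  exact ((isOpen_ingoing x).inter
    (isOpen_lt continuous_const (continuous_angMomSq_right x.2))).measurableSet

/-- Near generators have p^{t*} ≤ 9 Cp and E ≤ 256 Cp w² with w = m/(τ - τ₀). Nearly trapped momenta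
have p^{t*} ≤ 16 E, and the width ε is taken with exactly the power of w wanted in the result. -/
theorem lintegral_horizonIntegrand_le (hf : IsVlasovSolution m R f₀ f) (hf₀ : ∀ z, 0 ≤ f₀ z)
    {B : ℝ} (hB : ∀ z, f₀ z ≤ B) (hB0 : 0 ≤ B) (hsupp : SupportBound m R Cr Cp f₀)
    (hm : 0 < m) (hR : 2 * m < R) (hCp : 0 < Cp) (hx : x ∈ horizon m)
    (hτ : 110 * (m + Cr ^ 2 / m) < tStar x) {j : ℕ} (hj : j ≤ 2) :
    ∫⁻ v in {v | pR x (0, v) < 0}, ‖horizonIntegrand m f x j v‖ₑ ≤ ENNReal.ofReal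
      (10 ^ 30 * (Cp ^ 4 * Cr ^ 2 / m ^ 2 * B
        * (m / (tStar x - 110 * (m + Cr ^ 2 / m))) ^ (2 * (j + 1)))) := by
  set D := tStar x - 110 * (m + Cr ^ 2 / m) with hD
  have hD0 : 0 < D := sub_pos.mpr hτ
  set w := m / D with hw
  have hw0 : 0 < w := div_pos hm hD0
  have hDw : D / m = w⁻¹ := by rw [hw, inv_div]
  set F := B * (Cr ^ 2 / m ^ 2) with hF
  have hF0 : 0 ≤ F := by positivity
  refine (lintegral_ingoing_le hm hx.1 (E₁ := 256 * Cp * w ^ 2) (Cp := Cp)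
    (c₁ := (9 * Cp) ^ (2 - j) * (256 * Cp * w ^ 2) ^ j * F) (c₂ := 16 ^ (2 - j) * F)
    (ε := 1440 * 1216 ^ (2 * (j + 1)) * w ^ (2 * (j + 1))) (by positivity) hCp.le (by positivity)
    (by positivity) (by positivity) fun v hv hA hne => ?_).trans (ENNReal.ofReal_le_ofReal ?_)
  · set E := -pR x (0, v) with hE
    have hE0 : 0 < E := neg_pos.mpr hv
    have hpE : pR x (0, v) ^ 2 = E ^ 2 := by rw [hE, neg_sq]
    have hL : 0 < angMomSq x.2 v := by
      rw [angMomSq_of_mem_horizon hm hx]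
      positivity
    have hfne : f (x, (pTOf m x v, v)) ≠ 0 := fun h0 => hne (by simp [horizonIntegrand, h0])
    obtain ⟨hmr, hECp, hreg⟩ := hf.support_subset hm hR hsupp hx hv hL hτ hfne
    rw [← hD, hDw, hpE] at hreg
    rw [hpE]
    obtain ⟨z, hz⟩ := hf.exists_eq_initial hm (by linarith) hx hv hL
    have hf0 : 0 ≤ f (x, (pTOf m x v, v)) := hz ▸ hf₀ z
    have hfF : f (x, (pTOf m x v, v)) ≤ F := by
      -- The factor Cr²/m² comes for free: if f does not vanish here, the starting radius shows m ≤
      -- Cr.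
      have h1 : (1 : ℝ) ≤ Cr ^ 2 / m ^ 2 := by
        rw [one_le_div (by positivity)]
        exact pow_le_pow_left₀ hm.le hmr 2
      rw [hz, hF]
      exact (hB z).trans (le_mul_of_one_le_right hB0 h1)
    have hpT := pTOf_of_mem_horizon hx.1 hv
    have hpT0 := pTOf_pos hx.1 hv
    rw [← hE] at hpT
    have habs : |horizonIntegrand m f x j v|
        = pTOf m x v ^ (2 - j) * E ^ j * f (x, (pTOf m x v, v)) / E :=
      abs_of_nonneg (by unfold horizonIntegrand; positivity)
    rw [habs]
    refine ⟨hECp, hreg.imp ?_ ?_⟩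
    · rintro ⟨h1, h2⟩
      have hEw : E ≤ 256 * Cp * w ^ 2 := by
        have := mul_le_mul_of_nonneg_right h1 (by positivity : 0 ≤ w ^ 2)
        rwa [mul_assoc, ← mul_pow, inv_mul_cancel₀ hw0.ne', one_pow, mul_one] at this
      have h3 : pTOf m x v ≤ 9 * Cp := by
        have h4 : ‖pAng x (0, v)‖ ^ 2 / (2 * E) ≤ 8 * Cp := by
          rw [div_le_iff₀ (by positivity)]
          linarith
        rw [hpT]
        linarith
      refine ⟨hEw, h2, ?_⟩
      gcongr
    · rintro ⟨h1, h2⟩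
      refine ⟨h1, ?_, ?_⟩
      · have h3 := h2 (2 * (j + 1)) (by omega)
        rw [inv_pow, ← div_eq_mul_inv, div_le_iff₀ (by positivity)] at h3
        exact h3
      · have h3 : pTOf m x v ≤ 16 * E := by
          have h4 : ‖pAng x (0, v)‖ ^ 2 / (2 * E) ≤ 15 * E := by
            rw [div_le_iff₀ (by positivity)]
            nlinarith
          rw [hpT]
          linarith
        rw [div_le_iff₀ hE0]
        calc pTOf m x v ^ (2 - j) * E ^ j * f (x, (pTOf m x v, v))
            ≤ (16 * E) ^ (2 - j) * E ^ j * F := by gcongr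
          _ = 16 ^ (2 - j) * F * E ^ (2 - j + j) := by rw [mul_pow, pow_add]; ring
          _ = _ := by rw [Nat.sub_add_cancel hj]; ring
  · have hpi := Real.pi_le_four
    have hX : Cp ^ 4 * Cr ^ 2 / m ^ 2 * B = Cp ^ 4 * F := by rw [hF]; ring
    rw [hX]
    have hY : 0 ≤ Cp ^ 4 * F * w ^ (2 * (j + 1)) := by positivity
    have key : ∀ K : ℝ, 0 ≤ K → 4 * K ≤ 10 ^ 30 → K * Real.pi * (Cp ^ 4 * F * w ^ (2 * (j + 1)))
        ≤ 10 ^ 30 * (Cp ^ 4 * F * w ^ (2 * (j + 1))) := fun K hK0 hK => by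
      refine mul_le_mul_of_nonneg_right ?_ hY
      nlinarith
    interval_cases j
    · refine le_trans (le_of_eq ?_) (key (16 * 81 * 256 + 32 * 1440 * 1216 ^ 2 * 256)
        (by norm_num) (by norm_num))
      ring
    · refine le_trans (le_of_eq ?_) (key (16 * 9 * 256 ^ 2 + 32 * 1440 * 1216 ^ 4 * 16)
        (by norm_num) (by norm_num))
      ring
    · refine le_trans (le_of_eq ?_) (key (16 * 256 ^ 3 + 32 * 1440 * 1216 ^ 6)
        (by norm_num) (by norm_num))
      ring

theorem horizonIntegrand_nonneg_ae (hf : IsVlasovSolution m R f₀ f) (hf₀ : ∀ z, 0 ≤ f₀ z)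
    (hm : 0 < m) (hR : m < R) (hx : x ∈ horizon m) (j : ℕ) :
    0 ≤ᵐ[volume.restrict {v | pR x (0, v) < 0}] horizonIntegrand m f x j := by
  rw [← Measure.restrict_congr_set (ingoing_ae_eq hm hx.1)]
  filter_upwards [ae_restrict_mem ((isOpen_ingoing x).inter
    (isOpen_lt continuous_const (continuous_angMomSq_right x.2))).measurableSet] with v hv
  have hv1 : pR x (0, v) < 0 := hv.1
  obtain ⟨z, hz⟩ := hf.exists_eq_initial hm hR hx hv1 hv.2
  have h1 := pTOf_pos hx.1 hv1
  have h2 := neg_pos.mpr hv1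
  have h3 := hf₀ z
  simp only [Pi.zero_apply, horizonIntegrand, hz]
  positivity

/-- The integral is at least its part over the box `P`, on which f is bounded below by the infimum
over 𝔅_δ. The box has volume of order E₁ ρ², and the integrand there is at least of order Cp^{2-j}
E₁^{j-1} times the infimum. -/
theorem le_integral_horizonIntegrand (hf : IsVlasovSolution m R f₀ f) (hf₀ : ∀ z, 0 ≤ f₀ z)
    (hm : 0 < m) (hR : 2 * m < R) (hCp : 0 < Cp) {δ : ℝ} (hδ : 0 < δ) (hδ' : δ < 1 / 2)
    (hx : x ∈ horizon m) (hτ : 64 * m / δ < tStar x) {j : ℕ} (hj : j ≤ 2)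
    (hint : IntegrableOn (horizonIntegrand m f x j) {v | pR x (0, v) < 0}) :
    1 / 10 ^ 10 * (Cp ^ 4 * infAlmostGenerators m R Cp 1 δ f₀ * (m / tStar x) ^ (2 * (j + 1)))
      ≤ ∫ v in {v | pR x (0, v) < 0}, horizonIntegrand m f x j v := by
  have ht : 0 < tStar x := hx.2
  set I := infAlmostGenerators m R Cp 1 δ f₀ with hI
  have hI0 : 0 ≤ I := Real.sInf_nonneg (by rintro _ ⟨z, -, rfl⟩; exact abs_nonneg _)
  set w := m / tStar x with hw
  have hw0 : 0 < w := div_pos hm ht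
  set E₁ := Cp * w ^ 2 / 8 with hE₁
  have hE₁0 : 0 < E₁ := by positivity
  set ρ := Cp * w / 64 with hρ
  have hρ0 : 0 < ρ := by positivity
  have hE₁' : E₁ = Cp * m ^ 2 / (8 * tStar x ^ 2) := by rw [hE₁, hw]; field_simp
  have hρ' : E₁ * tStar x / (8 * m) = ρ := by rw [hE₁, hρ, hw]; field_simp; norm_num
  set P := {v | -pR x (0, v) ∈ Icc E₁ (3 / 2 * E₁) ∧ (3 / 2 * ρ) ^ 2 ≤ ‖pAng x (0, v)‖ ^ 2 ∧
    ‖pAng x (0, v)‖ ^ 2 ≤ (2 * ρ) ^ 2} with hP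
  have hPvol : volume P = ENNReal.ofReal
      ((3 / 2 * E₁ - E₁) * (Real.pi * ((2 * ρ) ^ 2 - (3 / 2 * ρ) ^ 2))) :=
    volume_fibre_shell hm hx.1 (by linarith) (by positivity) (by gcongr; norm_num)
  have hPm : MeasurableSet P := by
    have h1 := (continuous_pR_right x).neg
    have h2 := (continuous_pAng_right x).norm.pow 2
    exact ((isClosed_Icc.preimage h1).inter ((isClosed_le continuous_const h2).inter
      (isClosed_le h2 continuous_const))).measurableSet
  have hPsub : P ⊆ {v | pR x (0, v) < 0} := fun v hv => by
    have := hv.1.1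
    simp only [mem_ofPred_eq]
    linarith
  have hconst : ∀ v ∈ P, (Cp / 700) ^ (2 - j) * E₁ ^ j * I / (3 / 2 * E₁)
      ≤ horizonIntegrand m f x j v := by
    rintro v ⟨⟨h1, h2⟩, h3, h4⟩
    have hv : pR x (0, v) < 0 := by linarith
    have h3' := le_of_sq_le_sq h3 (norm_nonneg _)
    have h4' := le_of_sq_le_sq h4 (by positivity)
    have hfI := hf.inf_le hm hR hf₀ hCp hδ hδ' hx hτ hE₁' h1 h2 (by rwa [hρ']) (by rwa [hρ'])
    have hpT := pTOf_of_mem_horizon hx.1 hv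
    have hE0 : 0 < -pR x (0, v) := neg_pos.mpr hv
    -- On the box |p̸|²/(2E) ≥ (3ρ/2)²/(3E₁) = 6 Cp/4096 > Cp/700.
    have h5 : Cp / 700 ≤ pTOf m x v := by
      have h6 : Cp / 700 ≤ ‖pAng x (0, v)‖ ^ 2 / (2 * -pR x (0, v)) := by
        rw [le_div_iff₀ (by positivity)]
        have h7 : Cp / 700 * (2 * (3 / 2 * E₁)) ≤ (3 / 2 * ρ) ^ 2 := by
          rw [hE₁, hρ]
          have : 0 ≤ Cp ^ 2 * w ^ 2 := by positivity
          nlinarith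
        have h8 := mul_le_mul_of_nonneg_left h2 hCp.le
        linarith
      linarith
    have hpT0 := pTOf_pos hx.1 hv
    have hf0 := hI0.trans hfI
    unfold horizonIntegrand
    gcongr
  have hvr : volume.real P
      = (3 / 2 * E₁ - E₁) * (Real.pi * ((2 * ρ) ^ 2 - (3 / 2 * ρ) ^ 2)) := by
    rw [Measure.real, hPvol, ENNReal.toReal_ofReal]
    have : (3 / 2 * ρ) ^ 2 ≤ (2 * ρ) ^ 2 := by gcongr; norm_num
    exact mul_nonneg (by linarith) (mul_nonneg Real.pi_pos.le (by linarith))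
  have h1 := setIntegral_ge_of_const_le_real hPm (by rw [hPvol]; exact ENNReal.ofReal_ne_top)
    hconst (hint.mono_set hPsub)
  have h2 := setIntegral_mono_set hint
    (horizonIntegrand_nonneg_ae hf hf₀ hm (by linarith) hx j) hPsub.eventuallyLE
  refine le_trans ?_ (h1.trans h2)
  rw [hvr]
  have hpi := Real.pi_gt_three
  have hY : 0 ≤ Cp ^ 4 * I * w ^ (2 * (j + 1)) := by positivity
  have key : ∀ K : ℝ, 1 / 10 ^ 10 ≤ 3 * K → 1 / 10 ^ 10 * (Cp ^ 4 * I * w ^ (2 * (j + 1)))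
      ≤ K * Real.pi * (Cp ^ 4 * I * w ^ (2 * (j + 1))) := fun K hK => by
    refine mul_le_mul_of_nonneg_right ?_ hY
    have : 0 < K := by linarith [show (0 : ℝ) < 1 / 10 ^ 10 by norm_num]
    nlinarith
  have hred : (Cp / 700) ^ (2 - j) * E₁ ^ j * I / (3 / 2 * E₁)
      * ((3 / 2 * E₁ - E₁) * (Real.pi * ((2 * ρ) ^ 2 - (3 / 2 * ρ) ^ 2)))
      = (Cp / 700) ^ (2 - j) * E₁ ^ j * I * (1 / 3 * (Real.pi * (7 / 4 * ρ ^ 2))) := by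
    field_simp
    ring
  rw [hred, hE₁, hρ]
  interval_cases j
  · refine (key (1 / 700 ^ 2 * (7 / 12) / 64 ^ 2) (by norm_num)).trans (le_of_eq ?_)
    ring
  · refine (key (1 / 700 / 8 * (7 / 12) / 64 ^ 2) (by norm_num)).trans (le_of_eq ?_)
    ring
  · refine (key (1 / 64 * (7 / 12) / 64 ^ 2) (by norm_num)).trans (le_of_eq ?_)
    ring

end ERN

/-! ### From horizon integrals to the energy-momentum components. -/

namespace ERN
open Set Filter Topology MeasureTheory

variable {m R Cr Cp : ℝ} {f₀ : initialShell m R →ᵇ ℝ} {f : Phase → ℝ} {x : Spacetime}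

theorem horizonIntegrand_bounds (hf : IsVlasovSolution m R f₀ f) (hf₀ : ∀ z, 0 ≤ f₀ z)
    (hsupp : SupportBound m R Cr Cp f₀) (hm : 0 < m) (hR : 2 * m < R) (hCp : 0 < Cp) {δ : ℝ}
    (hδ : 0 < δ) (hδ' : δ < 1 / 2) (hx : x ∈ horizon m)
    (hτ : 110 * (m + Cr ^ 2 / m) < tStar x) (hτ' : 64 * m / δ < tStar x) {j : ℕ} (hj : j ≤ 2) :
    IntegrableOn (horizonIntegrand m f x j) {v | pR x (0, v) < 0} ∧
      1 / 10 ^ 10 * (Cp ^ 4 * infAlmostGenerators m R Cp 1 δ f₀ *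
          (m ^ (2 * (j + 1)) / tStar x ^ (2 * (j + 1))))
        ≤ ∫ v in {v | pR x (0, v) < 0}, horizonIntegrand m f x j v ∧
      ∫ v in {v | pR x (0, v) < 0}, horizonIntegrand m f x j v
        ≤ 10 ^ 30 * (Cp ^ 4 * Cr ^ 2 / m ^ 2 * ‖f₀‖ * (m ^ (2 * (j + 1)) /
          (tStar x - 110 * (m + Cr ^ 2 / m)) ^ (2 * (j + 1)))) := by
  have hmR : m < R := by linarith
  have hle := lintegral_horizonIntegrand_le hf hf₀
    (fun z => (le_abs_self _).trans (f₀.norm_coe_le_norm z)) (norm_nonneg f₀) hsupp hm hR hCp hx hτ hj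
  have hint : IntegrableOn (horizonIntegrand m f x j) {v | pR x (0, v) < 0} :=
    ⟨aestronglyMeasurable_horizonIntegrand hf f₀.continuous hm hmR hx j,
      hle.trans_lt ENNReal.ofReal_lt_top⟩
  have hD := sub_pos.mpr hτ
  rw [← div_pow, ← div_pow]
  refine ⟨hint, le_integral_horizonIntegrand hf hf₀ hm hR hCp hδ hδ' hx hτ' hj hint, ?_⟩
  have h := (enorm_integral_le_lintegral_enorm _).trans hle
  rw [Real.enorm_eq_ofReal_abs, ENNReal.ofReal_le_ofReal_iff (by positivity)] at h
  exact (le_abs_self _).trans h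

theorem fibreDomain_of_mem_horizon (hx : radius x = m) :
    fibreDomain m x = {v | pR x (0, v) < 0} := by
  ext v
  refine ⟨fun h => h.2 hx, fun h => ⟨?_, fun _ => h⟩⟩
  rintro rfl
  have h' : pR x (0, 0) < 0 := h
  simp [pR] at h'

theorem energy_of_mem_horizon (hm : 0 < m) (hx : radius x = m) (p : Spacetime) :
    energy m x p = -pR x p := by
  rw [energy, hx, lapseSq_eq m hm.ne']
  simp

theorem momentIntegrand_weightTT (hm : 0 < m) (hx : radius x = m) :
    momentIntegrand m (weightTT f) x = horizonIntegrand m f x 0 := by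
  ext v
  simp only [momentIntegrand, energy_of_mem_horizon hm hx, weightTT, horizonIntegrand, pT, pR]
  ring

theorem momentIntegrand_weightTR (hm : 0 < m) (hx : radius x = m) :
    momentIntegrand m (weightTR f) x = fun v => -horizonIntegrand m f x 1 v := by
  ext v
  simp only [momentIntegrand, energy_of_mem_horizon hm hx, weightTR, horizonIntegrand, pT, pR]
  ring

theorem momentIntegrand_weightRR (hm : 0 < m) (hx : radius x = m) :
    momentIntegrand m (weightRR f) x = horizonIntegrand m f x 2 := by
  ext v
  simp only [momentIntegrand, energy_of_mem_horizon hm hx, weightRR, horizonIntegrand, pR]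
  ring

end ERN

end

theorem mainTheorem4 :
    ∃ C₀ C₁ K c C : ℝ, 0 < C₀ ∧ 0 < C₁ ∧ 0 < K ∧ 0 < c ∧ 0 < C ∧
      ∀ (m R Cr Cp : ℝ), 0 < m → 2 * m < R → 0 < Cr → 0 < Cp →
      ∀ (f₀ : ERN.initialShell m R →ᵇ ℝ), (∀ z, 0 ≤ f₀ z) → ERN.SupportBound m R Cr Cp f₀ →
      ∀ (f : ERN.Phase → ℝ), ERN.IsVlasovSolution m R f₀ f →
      ∀ (δ : ℝ), 0 < δ → δ < 1 / 2 →
      ∀ x ∈ ERN.horizon m, ∀ τ : ℝ, τ = ERN.tau m R x →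
      ∀ τ₀ : ℝ, τ₀ = C₀ * (m + Cr ^ 2 / m) →
      max τ₀ (C₁ * m / δ) < τ →
      ∀ I : ℝ, I = ERN.infAlmostGenerators m R Cp K δ f₀ →
        (ERN.MomentConverges m (ERN.weightTT f) x ∧
          ERN.MomentConverges m (ERN.weightTR f) x ∧
          ERN.MomentConverges m (ERN.weightRR f) x) ∧
        (c * (Cp ^ 4 * I * (m ^ 2 / τ ^ 2)) ≤ ERN.TTT m f x ∧
          ERN.TTT m f x ≤ C * (Cp ^ 4 * Cr ^ 2 / m ^ 2 * ‖f₀‖ * (m ^ 2 / (τ - τ₀) ^ 2))) ∧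
        (c * (Cp ^ 4 * I * (m ^ 4 / τ ^ 4)) ≤ |ERN.TTR m f x| ∧
          |ERN.TTR m f x| ≤ C * (Cp ^ 4 * Cr ^ 2 / m ^ 2 * ‖f₀‖ * (m ^ 4 / (τ - τ₀) ^ 4))) ∧
        (c * (Cp ^ 4 * I * (m ^ 6 / τ ^ 6)) ≤ ERN.TRR m f x ∧
          ERN.TRR m f x ≤ C * (Cp ^ 4 * Cr ^ 2 / m ^ 2 * ‖f₀‖ * (m ^ 6 / (τ - τ₀) ^ 6))) := by
  -- 110 is the threshold of `late_arrival`. 64 makes τ large enough both for `early_position` and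
  -- for r ≤ (1 + δ)m at the start. The last two constants are round numbers leaving room for 1216⁶
  -- and 700⁻².
  refine ⟨110, 64, 1, 1 / 10 ^ 10, 10 ^ 30, by norm_num, by norm_num, by norm_num, by norm_num,
    by norm_num, ?_⟩
  rintro m R Cr Cp hm hR - hCp f₀ hf₀ hsupp f hf δ hδ hδ' x hx τ hτ τ₀ rfl hlt I rfl
  have hx1 : ERN.radius x = m := hx.1
  rw [ERN.tau_of_radius_le (by linarith)] at hτ
  subst hτ
  have ht : 0 < ERN.tStar x := hx.2
  obtain ⟨h1, h2⟩ := max_lt_iff.mp hlt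
  have key := fun {j : ℕ} (hj : j ≤ 2) =>
    ERN.horizonIntegrand_bounds hf hf₀ hsupp hm hR hCp hδ hδ' hx h1 h2 hj
  obtain ⟨i0, l0, u0⟩ := key (j := 0) (by norm_num)
  obtain ⟨i1, l1, u1⟩ := key (j := 1) (by norm_num)
  obtain ⟨i2, l2, u2⟩ := key (j := 2) le_rfl
  have hI : 0 ≤ ERN.infAlmostGenerators m R Cp 1 δ f₀ :=
    Real.sInf_nonneg (by rintro _ ⟨z, -, rfl⟩; exact abs_nonneg _)
  -- The component is negative or zero, because p^r = -E on the horizon; its absolute value is the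
  -- integral with j = 1.
  have e1 : |ERN.TTR m f x| = ∫ v in {v | ERN.pR x (0, v) < 0}, ERN.horizonIntegrand m f x 1 v := by
    rw [ERN.TTR, ERN.moment, ERN.fibreDomain_of_mem_horizon hx1,
      ERN.momentIntegrand_weightTR hm hx1, MeasureTheory.integral_neg, abs_neg]
    exact abs_of_nonneg (le_trans (by positivity) l1)
  rw [e1]
  simp only [ERN.MomentConverges, ERN.TTT, ERN.TRR, ERN.moment,
    ERN.fibreDomain_of_mem_horizon hx1, ERN.momentIntegrand_weightTT hm hx1,
    ERN.momentIntegrand_weightTR hm hx1, ERN.momentIntegrand_weightRR hm hx1]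
  exact ⟨⟨i0, i1.neg, i2⟩, ⟨l0, u0⟩, ⟨l1, u1⟩, ⟨l2, u2⟩⟩
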